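/- Let $\beta$ be an indeterminate and let $\mathfrak{m}\mathrm{QSym}$ be the $\mathbb{Z}[\beta]$-module of quasisymmetric power series (of possibly unbounded degree) in $\mathbb{Z}[\beta][[x_1,x_2,\dots]]$. For a composition $\alpha=(\alpha_1,\dots,\alpha_k)$ of $n$ put $I(\alpha)=\{\alpha_1,\alpha_1+\alpha_2,\dots,\alpha_1+\dots+\alpha_{k-1}\}\subseteq[n-1]$; let $\alpha^{r}$ be its reversal, $\alpha^{c}$ the composition of $n$ with $I(\alpha^c)=[n-1]\setminus I(\alpha)$, and $\alpha^t=(\alpha^c)^r$. Let $M_\alpha=\sum_{i_1<\dots<i_k}x_{i_1}^{\alpha_1}\cdots x_{i_k}^{\alpha_k}$ and $L_\alpha=\sum_{I(\alpha)\subseteq I(\alpha')}M_{\alpha'}$ (sum over compositions $\alpha'$ of $n$), and let $\omega,\psi,\rho:\mathfrak{m}\mathrm{QSym}\to\mathfrak{m}\mathrm{QSym}$ be the continuous $\mathbb{Z}[\beta]$-linear maps with $\omega(L_\alpha)=L_{\alpha^t}$, $\psi(L_\alpha)=L_{\alpha^c}$, $\rho(L_\alpha)=L_{\alpha^r}$ for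 all $\alpha$. For a power series $f$, let $f(\frac{x}{1-\beta x})$ be the result of substituting $x_i\mapsto x_i/(1-\beta x_i)$ for all $i$. Let $\mathbb{M}=\{1'<1<2'<2<\cdots\}$ and $|i'|=|i|=i$. For finite nonempty $S,T\subset\mathbb{M}$ write $S\preceq T$ if $\max S\le\min T$, $S\prec T$ if $\max S<\min T$, and $x^S=\prod_{i\in S}x_{|i|}$. For a family $\sigma$ of such sets indexed by a finite set, let $|\sigma|$ be the sum of the sizes of its members and $x^\sigma$ the product of their monomials. A labeled poset $(P,\gamma)$ is a finite poset $P$ with an injective map $\gamma:P\to\mathbb{Z}$; $P^*$ is the dual poset. Let $\mathcal{E}(P,\gamma)$ be the set of maps $\sigma$ from $P$ to finite nonempty subsets of $\mathbb{M}$ such that for every cover $s\lessdot t$ one has $\sigma(s)\preceq\sigma(t)$, $\sigma(s)\cap\sigma(t)\subset\{1,2,\dots\}$ if $\gamma(s)<\gamma(t)$, and $\sigma(s)\cap\sigma(t)\subset\{1',2',\dots\}$ if $\gamma(s)>\gamma(t)$. For $V\subseteq P$ let $\Omega^{(\beta)}(P,\gamma,V)=\sum_\sigma\beta^{|\sigma|-|P|}x^\sigma$,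 summed over all $\sigma\in\mathcal{E}(P,\gamma)$ with $\sigma(v)\subset\{1,2,\dots\}$ for all $v\in V$, and let $\Omega^{(\beta)}(P,\gamma)=\Omega^{(\beta)}(P,\gamma,\varnothing)$. A peak composition is a composition $\alpha=(\alpha_1,\dots,\alpha_k)$ with $\alpha_i\ge2$ for $i<k$; put $\alpha^\flat=(\alpha_k+1,\alpha_{k-1},\dots,\alpha_2,\alpha_1-1)$ (with $\alpha^\flat=\alpha$ if $k\le1$). For a peak composition $\alpha$ of $N$ let $K^{(\beta)}_\alpha=\sum_S\beta^{|S|-N}x^S$, summed over tuples $S=(S_1\preceq\dots\preceq S_N)$ of finite nonempty subsets of $\mathbb{M}$ with $S_i\cap S_{i+1}\subset\{1',2',\dots\}$ if $i\in I(\alpha)$ and $S_i\cap S_{i+1}\subset\{1,2,\dots\}$ if $i\in[N-1]\setminus I(\alpha)$. Let $\bar K^{(\beta)}_\alpha$ be the same sum over tuples $S_1\preceq\dots\preceq S_N$ with $S_i\prec S_{i+1}$ if $i\in I(\alpha)$, $S_i\cap S_{i+1}\subset\{1,2,\dots\}$ if $i\in[N-1]\setminus I(\alpha)$, and $S_{i+1}\subset\{1,2,\dots\}$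 if $i\in\{0\}\cup I(\alpha)$ and $i<N$. For strict partitions $\mu\subseteq\lambda$ order $\mathsf{SD}_{\lambda/\mu}=\{(i,i+j-1):\mu_i<j\le\lambda_i\}$ componentwise, let $\theta:\mathsf{SD}_{\lambda/\mu}\to\mathbb{Z}$ be any injective labeling with $\theta(i,j)<\theta(i,j+1)$ and $\theta(i,j)>\theta(i+1,j)$ whenever these boxes lie in $\mathsf{SD}_{\lambda/\mu}$, and put $GQ^{(\beta)}_{\lambda/\mu}=\Omega^{(\beta)}(\mathsf{SD}_{\lambda/\mu},\theta)$ and $GP^{(\beta)}_{\lambda/\mu}=\Omega^{(\beta)}(\mathsf{SD}_{\lambda/\mu},\theta,\{(i,j)\in\mathsf{SD}_{\lambda/\mu}:i=j\})$. **Proposition.** For every peak composition $\alpha$, $$\omega(K^{(\beta)}_\alpha)=K^{(\beta)}_{\alpha^\flat}(\tfrac{x}{1-\beta x}),\qquad \psi(K^{(\beta)}_\alpha)=K^{(\beta)}_{\alpha}(\tfrac{x}{1-\beta x}),\qquad \rho(K^{(\beta)}_\alpha)=K^{(\beta)}_{\alpha^\flat},$$ and the same three formulas hold with $\bar K^{(\beta)}$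 in place of $K^{(\beta)}$. For every labeled poset $(P,\gamma)$, $$\omega(\Omega^{(\beta)}(P,\gamma))=\Omega^{(\beta)}(P^*,\gamma)(\tfrac{x}{1-\beta x}),\quad \psi(\Omega^{(\beta)}(P,\gamma))=\Omega^{(\beta)}(P,\gamma)(\tfrac{x}{1-\beta x}),\quad \rho(\Omega^{(\beta)}(P,\gamma))=\Omega^{(\beta)}(P^*,\gamma).$$ Moreover, for all strict partitions $\mu\subseteq\lambda$, $$\omega(GP^{(\beta)}_{\lambda/\mu})=GP^{(\beta)}_{\lambda/\mu}(\tfrac{x}{1-\beta x})\qquad\text{and}\qquad \omega(GQ^{(\beta)}_{\lambda/\mu})=GQ^{(\beta)}_{\lambda/\mu}(\tfrac{x}{1-\beta x}).$$ -/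

import Mathlib

open scoped Polynomial

namespace Multipeak

/-! ### Quasisymmetric power series over `ℤ[β]` in the variables `x_1, x_2, x_3, ...` -/

/-- Power series over `ℤ[β]` in commuting variables `x_i`, `i ∈ {1, 2, 3, ...}`; the parameter `β`
is the polynomial variable. -/
abbrev Series : Type := MvPowerSeries ℕ+ ℤ[X]

/-- The parameter `β`. -/
noncomputable abbrev β : ℤ[X] := Polynomial.X

/-- The list `(a_1, ..., a_k)` of the nonzero exponents of the monomial
`x_{i_1}^{a_1} ⋯ x_{i_k}^{a_k}`, `i_1 < ⋯ < i_k`. -/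
def exps (m : ℕ+ →₀ ℕ) : List ℕ := m.support.sort.map m

/-- The `ℤ[β]`-module of quasisymmetric power series (of possibly unbounded degree): the
coefficients of `x_{i_1}^{a_1} ⋯ x_{i_k}^{a_k}` and `x_{j_1}^{a_1} ⋯ x_{j_k}^{a_k}` agree whenever
`i_1 < ⋯ < i_k`, `j_1 < ⋯ < j_k` and all `a_r` are positive. -/
def QSym : Submodule ℤ[X] Series where
  carrier := {f | ∀ m m' : ℕ+ →₀ ℕ, exps m = exps m' →
    MvPowerSeries.coeff m f = MvPowerSeries.coeff m' f}
  add_mem' hf hg m m' h := by rw [map_add, map_add, hf m m' h, hg m m' h]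
  zero_mem' m m' _ := by simp
  smul_mem' c f hf m m' h := by
    rw [map_smul, map_smul, hf m m' h]

theorem mem_QSym {f : Series} : f ∈ QSym ↔ ∀ m m' : ℕ+ →₀ ℕ, exps m = exps m' →
    MvPowerSeries.coeff m f = MvPowerSeries.coeff m' f := Iff.rfl

/-! ### Compositions -/

variable {n : ℕ}

/-- `I(α) = {α_1, α_1 + α_2, ..., α_1 + ⋯ + α_{k-1}}`. -/
def I (α : Composition n) : Finset ℕ := (Finset.Ioo 0 α.length).image α.sizeUpTo

/-- The bijection between compositions of `n` and subsets of `[n-1]`; here `i : Fin (n - 1)` stands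
for the element `i + 1` of `[n-1]`, see `I_eq_map`. -/
def compEquiv (n : ℕ) : Composition n ≃ Finset (Fin (n - 1)) :=
  (compositionEquiv n).trans (compositionAsSetEquiv n)

/-- `i ↦ i + 1`. -/
def shiftEmb (n : ℕ) : Fin (n - 1) ↪ ℕ := ⟨fun i => (i : ℕ) + 1, by
  intro i j h
  exact Fin.ext (Nat.succ_injective h)⟩

theorem shiftEmb_apply (n : ℕ) (i : Fin (n - 1)) : shiftEmb n i = i + 1 := rfl

theorem I_eq_map (α : Composition n) : I α = (compEquiv n α).map (shiftEmb n) := by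
  ext j
  simp only [I, Finset.mem_image, Finset.mem_Ioo, Finset.mem_map, shiftEmb_apply, compEquiv, Equiv.trans_apply, compositionAsSetEquiv,
    Equiv.coe_fn_mk, compositionEquiv, Composition.toCompositionAsSet, Composition.boundaries]
  constructor
  · rintro ⟨r, ⟨hr0, hr⟩, rfl⟩
    have h1 : 0 < α.sizeUpTo r := by
      have h := α.sizeUpTo_strict_mono (i := 0) (by omega)
      have h' := α.monotone_sizeUpTo (show 0 + 1 ≤ r by omega)
      omega
    have h2 : α.sizeUpTo r < n := by
      have h := α.sizeUpTo_strict_mono hr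
      have h' := α.sizeUpTo_le (r + 1)
      omega
    refine ⟨⟨α.sizeUpTo r - 1, by omega⟩, ?_, by simp only; omega⟩
    simp only [Set.mem_toFinset, Set.mem_ofPred_eq, Finset.mem_univ, true_and]
    refine ⟨⟨r, by omega⟩, ?_⟩
    ext
    simp [Composition.boundary]
    omega
  · rintro ⟨i, hi, rfl⟩
    simp only [Set.mem_toFinset, Set.mem_ofPred_eq, Finset.mem_univ,
      true_and] at hi
    obtain ⟨r, hr⟩ := hi
    have hr' : α.sizeUpTo r = 1 + i := by
      simpa [Composition.boundary, Fin.ext_iff] using hr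
    have hi := i.2
    refine ⟨r, ⟨?_, ?_⟩, by omega⟩
    · rcases Nat.eq_zero_or_pos (r : ℕ) with h | h
      · rw [h, α.sizeUpTo_zero] at hr'; omega
      · exact h
    · by_contra h
      rw [α.sizeUpTo_ofLength_le _ (by omega)] at hr'
      omega

/-- `α^c`: the composition of `n` with `I(α^c) = [n-1] ∖ I(α)`. -/
def compl (α : Composition n) : Composition n := (compEquiv n).symm (compEquiv n α)ᶜ

theorem I_compl (α : Composition n) : I (compl α) = Finset.Ico 1 n \ I α := by
  rw [I_eq_map, I_eq_map, compl, Equiv.apply_symm_apply, Finset.compl_eq_univ_sdiff,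
    Finset.map_sdiff]
  congr 1
  ext j
  simp only [shiftEmb_apply, Finset.mem_map, Finset.mem_univ, true_and, Finset.mem_Ico]
  constructor
  · rintro ⟨i, rfl⟩
    have := i.2
    omega
  · rintro ⟨h1, h2⟩
    exact ⟨⟨j - 1, by omega⟩, by simp only; omega⟩

/-- `α` is a peak composition: `α_i ≥ 2` for `1 ≤ i < ℓ(α)`. -/
def IsPeak (α : Composition n) : Prop :=
  ∀ i : Fin α.length, (i : ℕ) + 1 < α.length → 2 ≤ α.blocksFun i

/-- `α^♭ = (α_k + 1, α_{k-1}, ..., α_2, α_1 - 1)`; for `k = 1` both modifications apply to the same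
entry, so `(α_1)^♭ = (α_1)`, and the empty composition is fixed. -/
def flat (α : Composition n) (hα : IsPeak α) : Composition n where
  blocks := List.ofFn fun j : Fin α.length =>
    α.blocksFun j.rev + (if (j : ℕ) = 0 then 1 else 0) - (if (j : ℕ) + 1 = α.length then 1 else 0)
  blocks_pos := by
    intro b hb
    rw [List.mem_ofFn] at hb
    obtain ⟨j, rfl⟩ := hb
    have h1 := α.one_le_blocksFun j.rev
    have hj := j.2
    by_cases hl : (j : ℕ) + 1 = α.length
    · by_cases h0 : (j : ℕ) = 0
      · rw [if_pos hl, if_pos h0]; omega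
      · have h2 := hα j.rev (by rw [Fin.val_rev]; omega)
        rw [if_pos hl, if_neg h0]; omega
    · rw [if_neg hl]; omega
  blocks_sum := by
    rw [List.sum_ofFn]
    have key : ∀ j : Fin α.length,
        (α.blocksFun j.rev + (if (j : ℕ) = 0 then 1 else 0)
          - (if (j : ℕ) + 1 = α.length then 1 else 0))
          + (if (j : ℕ) + 1 = α.length then 1 else 0)
        = α.blocksFun j.rev + (if (j : ℕ) = 0 then 1 else 0) := by
      intro j
      have h1 := α.one_le_blocksFun j.rev
      split_ifs <;> omega
    have hsum := Finset.sum_congr (rfl : (Finset.univ : Finset (Fin α.length)) = _)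
      (fun j _ => key j)
    rw [Finset.sum_add_distrib, Finset.sum_add_distrib,
      Fintype.sum_equiv Fin.revPerm (fun j : Fin α.length => α.blocksFun j.rev) α.blocksFun
        (fun j => rfl), α.sum_blocksFun] at hsum
    have hswap : ∑ j : Fin α.length, (if (j : ℕ) + 1 = α.length then 1 else 0)
        = ∑ j : Fin α.length, (if (j : ℕ) = 0 then 1 else 0) := by
      refine Fintype.sum_equiv Fin.revPerm _ _ fun j => ?_
      have hj := j.2
      have : ((j : ℕ) + 1 = α.length) ↔ ((Fin.revPerm j : Fin α.length) : ℕ) = 0 := by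
        rw [Fin.revPerm_apply, Fin.val_rev]; omega
      simp only [this]
    omega

/-! ### The bases `M_α`, `L_α` and the involutions -/

/-- The monomial quasisymmetric function
`M_α = ∑_{i_1 < ⋯ < i_k} x_{i_1}^{α_1} ⋯ x_{i_k}^{α_k}`. -/
noncomputable def M (α : Composition n) : Series := fun m => if exps m = α.blocks then 1 else 0

theorem coeff_M (α : Composition n) (m : ℕ+ →₀ ℕ) :
    MvPowerSeries.coeff m (M α) = if exps m = α.blocks then 1 else 0 := rfl

theorem M_mem (α : Composition n) : M α ∈ QSym := by
  intro m m' h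
  rw [coeff_M, coeff_M, h]

/-- The fundamental quasisymmetric function `L_α`, the sum of `M_γ` over all compositions `γ` of `n`
with `I(α) ⊆ I(γ)`. -/
noncomputable def L (α : Composition n) : Series := ∑ γ : Composition n with I α ⊆ I γ, M γ

theorem L_mem (α : Composition n) : L α ∈ QSym := Submodule.sum_mem _ fun γ _ => M_mem γ

/-- The monomial `x_1^{α_1} ⋯ x_k^{α_k}`. -/
noncomputable def packed (α : Composition n) : ℕ+ →₀ ℕ :=
  ∑ r : Fin α.length, Finsupp.single (Nat.succPNat r) (α.blocksFun r)

/-- The coefficient of `L_α` in the expansion of a quasisymmetric power series `f`. As the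
coefficient of `M_γ` in `f` is that of `x_1^{γ_1} ⋯ x_k^{γ_k}` and
`M_γ = ∑_{I(γ) ⊆ I(α)} (-1)^{|I(α) ∖ I(γ)|} L_α`, it is an alternating sum of coefficients of `f`. -/
noncomputable def coeffL (f : Series) (α : Composition n) : ℤ[X] :=
  ∑ γ : Composition n with I γ ⊆ I α,
    (-1) ^ (I α \ I γ).card * MvPowerSeries.coeff (packed γ) f

/-- The homogeneous component of degree `n` of `twist τ f`. -/
noncomputable def twistPart (τ : ∀ n, Composition n → Composition n) (n : ℕ) (f : Series) :
    Series := ∑ α : Composition n, coeffL f α • L (τ n α)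

/-- `∑_α c_α L_α ↦ ∑_α c_α L_{τ(α)}`. -/
noncomputable def twistFun (τ : ∀ n, Composition n → Composition n) (f : Series) : Series :=
  fun m => MvPowerSeries.coeff m (twistPart τ m.degree f)

theorem coeff_twistFun (τ : ∀ n, Composition n → Composition n) (f : Series) (m : ℕ+ →₀ ℕ) :
    MvPowerSeries.coeff m (twistFun τ f) = MvPowerSeries.coeff m (twistPart τ m.degree f) := rfl

theorem degree_eq (m : ℕ+ →₀ ℕ) : m.degree = (exps m).sum := by
  rw [Finsupp.degree_apply, exps, ← Multiset.sum_coe, ← Multiset.map_coe, Finset.sort_eq]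
  rfl

theorem twistPart_mem (τ : ∀ n, Composition n → Composition n) (n : ℕ) (f : Series) :
    twistPart τ n f ∈ QSym :=
  Submodule.sum_mem _ fun _ _ => Submodule.smul_mem _ _ (L_mem _)

theorem twistFun_mem (τ : ∀ n, Composition n → Composition n) (f : Series) :
    twistFun τ f ∈ QSym := by
  refine mem_QSym.2 fun m m' h => ?_
  rw [coeff_twistFun, coeff_twistFun, degree_eq, degree_eq, h]
  exact mem_QSym.1 (twistPart_mem τ _ _) m m' h

theorem twistFun_add (τ : ∀ n, Composition n → Composition n) (f g : Series) :
    twistFun τ (f + g) = twistFun τ f + twistFun τ g := by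
  apply MvPowerSeries.ext
  intro m
  rw [map_add]
  simp only [coeff_twistFun]
  rw [← map_add]
  congr 1
  simp only [twistPart, ← Finset.sum_add_distrib, ← add_smul]
  refine Finset.sum_congr rfl fun α _ => ?_
  congr 1
  simp only [coeffL, map_add, mul_add, Finset.sum_add_distrib]

theorem twistFun_smul (τ : ∀ n, Composition n → Composition n) (c : ℤ[X]) (f : Series) :
    twistFun τ (c • f) = c • twistFun τ f := by
  apply MvPowerSeries.ext
  intro m
  rw [map_smul]
  simp only [coeff_twistFun]
  rw [← map_smul]
  congr 1
  simp only [twistPart, Finset.smul_sum, smul_smul]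
  refine Finset.sum_congr rfl fun α _ => ?_
  congr 1
  simp only [coeffL, Finset.mul_sum, map_smul, smul_eq_mul]
  exact Finset.sum_congr rfl fun γ _ => by ring

/-- The continuous `ℤ[β]`-linear map on quasisymmetric power series with `L_α ↦ L_{τ(α)}` for all
compositions `α`; see `twist_L` and `continuous_twist`. -/
noncomputable def twist (τ : ∀ n, Composition n → Composition n) : QSym →ₗ[ℤ[X]] QSym where
  toFun f := ⟨twistFun τ f, twistFun_mem τ f⟩
  map_add' f g := Subtype.ext (twistFun_add τ f g)
  map_smul' c f := Subtype.ext (twistFun_smul τ c f)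

/-- The involution `ω`, with `ω(L_α) = L_{α^t}` where `α^t = (α^c)^r`. -/
noncomputable def omega : QSym →ₗ[ℤ[X]] QSym := twist fun _ α => (compl α).reverse

/-- The involution `ψ`, with `ψ(L_α) = L_{α^c}`. -/
noncomputable def psi : QSym →ₗ[ℤ[X]] QSym := twist fun _ α => compl α

/-- The involution `ρ`, with `ρ(L_α) = L_{α^r}`, where `α^r` is the reversal of `α`. -/
noncomputable def rho : QSym →ₗ[ℤ[X]] QSym := twist fun _ α => α.reverse

theorem exps_packed (α : Composition n) : exps (packed α) = α.blocks := by
  have hval : ∀ r : Fin α.length, packed α (Nat.succPNat r) = α.blocksFun r := by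
    intro r
    simp only [packed, Finsupp.coe_finsetSum, Finset.sum_apply, Finsupp.single_apply]
    rw [Finset.sum_eq_single r]
    · simp
    · intro b _ hb
      rw [if_neg]
      intro h
      exact hb (Fin.ext (Nat.succPNat_injective h))
    · simp
  have hinj : Function.Injective fun r : Fin α.length => Nat.succPNat r :=
    fun a b h => Fin.ext (Nat.succPNat_injective h)
  have hsupp : (packed α).support = (List.ofFn fun r : Fin α.length => Nat.succPNat r).toFinset := by
    ext x
    simp only [Finsupp.mem_support_iff, List.mem_toFinset, List.mem_ofFn]
    constructor
    · intro hx
      by_contra hne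
      apply hx
      simp only [packed, Finsupp.coe_finsetSum, Finset.sum_apply]
      refine Finset.sum_eq_zero fun r _ => ?_
      rw [Finsupp.single_apply, if_neg]
      intro h
      exact hne ⟨r, h⟩
    · rintro ⟨r, rfl⟩
      rw [hval]
      have := α.one_le_blocksFun r
      omega
  have hsort : (packed α).support.sort = List.ofFn fun r : Fin α.length => Nat.succPNat r := by
    rw [hsupp]
    refine (List.toFinset_sort _ (List.nodup_ofFn.2 hinj)).2 ?_
    rw [List.pairwise_ofFn]
    intro a b hab
    exact (Nat.succPNat_le_succPNat).2 hab.le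
  rw [exps, hsort, List.map_ofFn, ← α.ofFn_blocksFun]
  congr 1
  ext r
  exact hval r

theorem sum_moebius {κ : Type*} [DecidableEq κ] [Fintype κ] (A B : Finset κ) :
    ∑ T : Finset κ with T ⊆ A, (-1 : ℤ[X]) ^ (A \ T).card * (if B ⊆ T then 1 else 0)
      = if B = A then 1 else 0 := by
  by_cases hBA : B ⊆ A
  · have h1 : ∑ T : Finset κ with T ⊆ A, (-1 : ℤ[X]) ^ (A \ T).card * (if B ⊆ T then 1 else 0)
        = ∑ U ∈ (A \ B).powerset, (-1 : ℤ[X]) ^ U.card := by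
      simp only [mul_ite, mul_one, mul_zero]
      rw [← Finset.sum_filter, Finset.filter_filter]
      refine Finset.sum_bij' (fun T _ => A \ T) (fun U _ => A \ U) ?_ ?_ ?_ ?_ ?_
      · intro T hT
        simp only [Finset.mem_filter, Finset.mem_univ, true_and, Finset.mem_powerset] at hT ⊢
        exact Finset.sdiff_subset_sdiff subset_rfl hT.2
      · intro U hU
        simp only [Finset.mem_filter, Finset.mem_univ, true_and, Finset.mem_powerset] at hU ⊢
        refine ⟨Finset.sdiff_subset, fun x hx => Finset.mem_sdiff.2 ⟨hBA hx, fun hxU => ?_⟩⟩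
        exact (Finset.mem_sdiff.1 (hU hxU)).2 hx
      · intro T hT
        simp only [Finset.mem_filter, Finset.mem_univ, true_and] at hT
        exact Finset.sdiff_sdiff_eq_self hT.1
      · intro U hU
        exact Finset.sdiff_sdiff_eq_self
          ((Finset.mem_powerset.1 hU).trans Finset.sdiff_subset)
      · intro T _
        rfl
    rw [h1]
    have h2 := congrArg (Int.castRingHom ℤ[X])
      (Finset.sum_powerset_neg_one_pow_card (x := A \ B))
    rw [map_sum] at h2
    simp only [map_pow, map_neg, map_one] at h2
    rw [h2]
    by_cases h : B = A
    · simp [h]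
    · have : A \ B ≠ ∅ := fun h' => h (subset_antisymm hBA (Finset.sdiff_eq_empty_iff_subset.1 h'))
      simp [h, this]
  · rw [if_neg (fun h => hBA h.subset)]
    refine Finset.sum_eq_zero fun T hT => ?_
    rw [if_neg (fun h => hBA (h.trans (Finset.mem_filter.1 hT).2)), mul_zero]

theorem coeff_L (β' : Composition n) (m : ℕ+ →₀ ℕ) : MvPowerSeries.coeff m (L β')
    = ∑ γ : Composition n with I β' ⊆ I γ, if exps m = γ.blocks then 1 else 0 := by
  rw [L, map_sum]
  rfl

theorem coeff_packed_L (α γ : Composition n) :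
    MvPowerSeries.coeff (packed γ) (L α) = if I α ⊆ I γ then 1 else 0 := by
  rw [coeff_L, exps_packed]
  simp only [← Composition.ext_iff]
  simp [Finset.sum_ite_eq]

theorem I_subset_iff (α γ : Composition n) : I α ⊆ I γ ↔ compEquiv n α ⊆ compEquiv n γ := by
  rw [I_eq_map, I_eq_map, Finset.map_subset_map]

theorem coeffL_L (α γ : Composition n) : coeffL (L α) γ = if α = γ then 1 else 0 := by
  simp only [coeffL, coeff_packed_L]
  have h : (if α = γ then (1 : ℤ[X]) else 0)
      = if compEquiv n α = compEquiv n γ then 1 else 0 := by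
    simp only [(compEquiv n).injective.eq_iff]
  rw [h, ← sum_moebius (compEquiv n γ) (compEquiv n α), Finset.sum_filter, Finset.sum_filter]
  refine Fintype.sum_equiv (compEquiv n) _ _ fun δ => ?_
  simp only [I_subset_iff]
  rw [I_eq_map, I_eq_map, ← Finset.map_sdiff, Finset.card_map]

theorem coeff_L_of_degree_ne (α : Composition n) (m : ℕ+ →₀ ℕ) (h : m.degree ≠ n) :
    MvPowerSeries.coeff m (L α) = 0 := by
  rw [coeff_L]
  refine Finset.sum_eq_zero fun γ _ => if_neg fun h' => h ?_
  rw [degree_eq, h', γ.blocks_sum]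

theorem twist_L (τ : ∀ n, Composition n → Composition n) (α : Composition n) :
    twist τ ⟨L α, L_mem α⟩ = ⟨L (τ n α), L_mem _⟩ := by
  ext1
  ext1 m
  change MvPowerSeries.coeff m (twistPart τ m.degree (L α)) = MvPowerSeries.coeff m (L (τ n α))
  by_cases h : m.degree = n
  · subst h
    simp [twistPart, coeffL_L]
  · rw [coeff_L_of_degree_ne _ _ h, twistPart, map_sum]
    refine Finset.sum_eq_zero fun γ _ => ?_
    have : coeffL (L α) γ = 0 := by
      refine Finset.sum_eq_zero fun δ _ => ?_
      rw [coeff_L_of_degree_ne, mul_zero]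
      rwa [degree_eq, exps_packed, δ.blocks_sum]
    rw [this, zero_smul, map_zero]

theorem omega_L (α : Composition n) :
    omega ⟨L α, L_mem α⟩ = ⟨L (compl α).reverse, L_mem _⟩ := twist_L _ α

theorem psi_L (α : Composition n) : psi ⟨L α, L_mem α⟩ = ⟨L (compl α), L_mem _⟩ := twist_L _ α

theorem rho_L (α : Composition n) : rho ⟨L α, L_mem α⟩ = ⟨L α.reverse, L_mem _⟩ := twist_L _ α

open scoped MvPowerSeries.WithPiTopology in
/-- Continuity for the topology of coefficientwise (eventually constant) convergence. -/
theorem continuous_twist [TopologicalSpace ℤ[X]] [DiscreteTopology ℤ[X]]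
    (τ : ∀ n, Composition n → Composition n) : Continuous (twist τ) := by
  refine Continuous.subtype_mk ?_ _
  refine continuous_pi fun m => ?_
  change Continuous fun f : QSym => MvPowerSeries.coeff m (twistPart τ m.degree f)
  simp only [twistPart, map_sum, map_smul, smul_eq_mul, coeffL]
  have h1 : Continuous fun f : QSym => (f : Series) := continuous_subtype_val
  have h2 : ∀ d : ℕ+ →₀ ℕ, Continuous fun f : QSym => MvPowerSeries.coeff d (f : Series) :=
    fun d => (MvPowerSeries.WithPiTopology.continuous_coeff ℤ[X] d).comp h1
  have h3 : ∀ (c : ℤ[X]) (d : ℕ+ →₀ ℕ),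
      Continuous fun f : QSym => c * MvPowerSeries.coeff d (f : Series) :=
    fun c d => continuous_const.mul (h2 d)
  have h4 : ∀ (c : ℤ[X]) (g : QSym → ℤ[X]), Continuous g → Continuous fun f => g f * c :=
    fun c g hg => hg.mul continuous_const
  exact continuous_finsetSum _ fun α _ => h4 _ _ (continuous_finsetSum _ fun γ _ => h3 _ _)

/-! ### The substitution `x_i ↦ x_i / (1 - β x_i)` -/

/-- The power series `x_i / (1 - β x_i)`. -/
noncomputable def geom (i : ℕ+) : Series :=
  MvPowerSeries.X i *
    MvPowerSeries.invOfUnit (1 - MvPowerSeries.C β * MvPowerSeries.X i) 1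

theorem geom_mul (i : ℕ+) :
    geom i * (1 - MvPowerSeries.C β * MvPowerSeries.X i) = MvPowerSeries.X i := by
  rw [geom, mul_assoc, MvPowerSeries.invOfUnit_mul _ _ (by simp), mul_one]

theorem hasSubst_geom : MvPowerSeries.HasSubst geom where
  const_coeff i := by simp [geom]
  coeff_zero d := by
    refine d.support.finite_toSet.subset fun i hi => ?_
    by_contra h
    exact hi (MvPowerSeries.X_dvd_iff.1 (Dvd.intro _ rfl) d (by simpa using h))

/-- `f(x / (1 - β x))`. -/
noncomputable def substGeom (f : Series) : Series := MvPowerSeries.subst geom f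

/-! ### Set-valued fillings by marked integers -/

/-- The marked integers `1' < 1 < 2' < 2 < ⋯`: the pair `(i, false)` is `i'` and `(i, true)` is
`i`, ordered lexicographically. -/
abbrev Marked : Type := ℕ+ ×ₗ Bool

/-- `|i'| = |i| = i`. -/
def absVal (x : Marked) : ℕ+ := (ofLex x).1

/-- `x ∈ {1', 2', 3', ...}`. -/
def IsPrimed (x : Marked) : Prop := (ofLex x).2 = false

/-- `x ∈ {1, 2, 3, ...}`. -/
def IsUnprimed (x : Marked) : Prop := (ofLex x).2 = true

/-- `S ≼ T`, that is `max S ≤ min T` when `S` and `T` are nonempty. -/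
def WeakLE (S T : Finset Marked) : Prop := ∀ x ∈ S, ∀ y ∈ T, x ≤ y

/-- `S ≺ T`, that is `max S < min T` when `S` and `T` are nonempty. -/
def StrictLT (S T : Finset Marked) : Prop := ∀ x ∈ S, ∀ y ∈ T, x < y

section Enumerator

variable {ι : Type*} [Fintype ι]

/-- `|σ| = ∑_s |σ(s)|`. -/
def size (σ : ι → Finset Marked) : ℕ := ∑ s, (σ s).card

/-- The exponent vector of `x^σ = ∏_s ∏_{x ∈ σ(s)} x_{|x|}`. -/
noncomputable def weight (σ : ι → Finset Marked) : ℕ+ →₀ ℕ :=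
  ∑ s, ∑ x ∈ σ s, Finsupp.single (absVal x) 1

/-- The generating function `∑_{σ ∈ E} β^{|σ| - |ι|} x^σ` of a set `E` of fillings by nonempty sets
(so that `|σ| ≥ |ι|`). Only finitely many fillings have a given weight, see `finite_weight`. -/
noncomputable def enumerator (E : Set (ι → Finset Marked)) : Series :=
  fun m => ∑ᶠ σ ∈ {σ | σ ∈ E ∧ weight σ = m}, β ^ (size σ - Fintype.card ι)

theorem mem_support_weight {σ : ι → Finset Marked} {i : ℕ+} :
    i ∈ (weight σ).support ↔ ∃ s, ∃ x ∈ σ s, absVal x = i := by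
  rw [Finsupp.mem_support_iff, weight, Finsupp.coe_finsetSum, Finset.sum_apply, ne_eq,
    Finset.sum_eq_zero_iff]
  simp only [Finsupp.coe_finsetSum, Finset.sum_apply, Finset.sum_eq_zero_iff, Finset.mem_univ,
    true_imp_iff, Finsupp.single_apply]
  push Not
  simp

theorem finite_weight (m : ℕ+ →₀ ℕ) : {σ : ι → Finset Marked | weight σ = m}.Finite := by
  classical
  have h : (↑(m.support ×ˢ (Finset.univ : Finset Bool)) : Set (ℕ+ × Bool)).Finite :=
    Finset.finite_toSet _
  have h2 : {S : Finset Marked | ∀ x ∈ S, absVal x ∈ m.support}.Finite := by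
    refine ((((m.support ×ˢ (Finset.univ : Finset Bool)).image toLex).powerset).finite_toSet).subset
      fun S hS => ?_
    simp only [Finset.coe_powerset, Set.mem_preimage, Set.mem_powerset_iff, Finset.coe_subset]
    intro x hx
    exact Finset.mem_image.2 ⟨ofLex x, Finset.mem_product.2 ⟨hS x hx, Finset.mem_univ _⟩, rfl⟩
  refine (Set.Finite.pi' (t := fun _ : ι => {S : Finset Marked | ∀ x ∈ S, absVal x ∈ m.support})
    fun _ => h2).subset ?_
  rintro σ rfl s x hx
  exact mem_support_weight.2 ⟨s, x, hx, rfl⟩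

/-- `i' ↦ f(i)'` and `i ↦ f(i)`. -/
def relabel (f : ℕ+ → ℕ+) (x : Marked) : Marked := toLex (f (ofLex x).1, (ofLex x).2)

/-- `E` is stable under increasing relabelings of the letters. -/
def RelabelInvariant (E : Set (ι → Finset Marked)) : Prop :=
  ∀ (f : ℕ+ → ℕ+) (σ : ι → Finset Marked), StrictMonoOn f ↑(weight σ).support → σ ∈ E →
    (fun s => (σ s).image (relabel f)) ∈ E

end Enumerator

theorem exists_relabel {m m' : ℕ+ →₀ ℕ} (h : exps m = exps m') :
    ∃ f : ℕ+ → ℕ+, StrictMonoOn f ↑m.support ∧ (∀ x ∈ m.support, f x ∈ m'.support) ∧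
      (∀ x ∈ m.support, m' (f x) = m x) ∧ (∀ y ∈ m'.support, ∃ x ∈ m.support, f x = y) := by
  classical
  have hc : m'.support.card = m.support.card := by
    have := congrArg List.length h
    simpa [exps] using this.symm
  let e := m.support.orderIsoOfFin rfl
  let e' := m'.support.orderIsoOfFin hc
  have hm : ∀ r, m (e r) = m' (e' r) := by
    intro r
    have h1 : (exps m)[(r : ℕ)]'(by simp [exps]) = m (e r) := by
      simp only [exps, List.getElem_map]; rfl
    have h2 : (exps m')[(r : ℕ)]'(by simp [exps, hc]) = m' (e' r) := by
      simp only [exps, List.getElem_map]; rfl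
    rw [← h1, ← h2]
    simp only [h]
  have hf : ∀ x (hx : x ∈ m.support),
      (if hx : x ∈ m.support then (e' (e.symm ⟨x, hx⟩) : ℕ+) else x) = e' (e.symm ⟨x, hx⟩) :=
    fun x hx => dif_pos hx
  refine ⟨fun x => if hx : x ∈ m.support then e' (e.symm ⟨x, hx⟩) else x, ?_, ?_, ?_, ?_⟩
  · intro x hx y hy hxy
    simp only [hf x hx, hf y hy]
    exact e'.strictMono (e.symm.strictMono hxy)
  · intro x hx
    simp only [hf x hx]
    exact (e' (e.symm ⟨x, hx⟩)).2
  · intro x hx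
    simp only [hf x hx]
    rw [← hm, OrderIso.apply_symm_apply]
  · intro y hy
    refine ⟨e (e'.symm ⟨y, hy⟩), (e _).2, ?_⟩
    refine (hf _ (e _).2).trans ?_
    simp

section Enumerator

variable {ι : Type*} [Fintype ι]

theorem relabel_injOn {f : ℕ+ → ℕ+} {σ : ι → Finset Marked}
    (hf : Set.InjOn f ↑(weight σ).support) (s : ι) : Set.InjOn (relabel f) ↑(σ s) := by
  intro x hx y hy hxy
  have h1 : (ofLex (relabel f x)).1 = (ofLex (relabel f y)).1 := by rw [hxy]
  have h2 : (ofLex (relabel f x)).2 = (ofLex (relabel f y)).2 := by rw [hxy]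
  have h3 := hf (mem_support_weight.2 ⟨s, x, hx, rfl⟩) (mem_support_weight.2 ⟨s, y, hy, rfl⟩) h1
  exact ofLex.injective (Prod.ext h3 h2)

theorem weight_relabel {f : ℕ+ → ℕ+} {σ : ι → Finset Marked}
    (hf : Set.InjOn f ↑(weight σ).support) :
    weight (fun s => (σ s).image (relabel f)) = (weight σ).mapDomain f := by
  simp only [weight, Finsupp.mapDomain_finsetSum, Finsupp.mapDomain_single]
  refine Finset.sum_congr rfl fun s _ => ?_
  rw [Finset.sum_image (relabel_injOn hf s)]
  rfl

theorem size_relabel {f : ℕ+ → ℕ+} {σ : ι → Finset Marked}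
    (hf : Set.InjOn f ↑(weight σ).support) :
    size (fun s => (σ s).image (relabel f)) = size σ :=
  Finset.sum_congr rfl fun s _ => Finset.card_image_of_injOn (relabel_injOn hf s)

theorem mapDomain_eq {m m' : ℕ+ →₀ ℕ} {f : ℕ+ → ℕ+} (h1 : Set.InjOn f ↑m.support)
    (h2 : ∀ x ∈ m.support, f x ∈ m'.support) (h3 : ∀ x ∈ m.support, m' (f x) = m x)
    (h4 : ∀ y ∈ m'.support, ∃ x ∈ m.support, f x = y) : m.mapDomain f = m' := by
  rw [Finsupp.mapDomain, Finsupp.sum]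
  conv_rhs => rw [← Finsupp.sum_single m', Finsupp.sum]
  refine Finset.sum_nbij f h2 h1 (fun y hy => ?_) fun x hx => by rw [h3 x hx]
  obtain ⟨x, hx, hxy⟩ := h4 y hy
  exact ⟨x, hx, hxy⟩

theorem enumerator_mem {E : Set (ι → Finset Marked)} (hE : RelabelInvariant E) :
    enumerator E ∈ QSym := by
  intro m m' h
  obtain ⟨f, f1, f2, f3, f4⟩ := exists_relabel h
  have hinj := f1.injOn
  let g : ℕ+ → ℕ+ := Function.invFunOn f ↑m.support
  have gl : ∀ x ∈ m.support, g (f x) = x := fun x hx => hinj.leftInvOn_invFunOn hx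
  have gm : ∀ y ∈ m'.support, g y ∈ m.support := by
    intro y hy
    obtain ⟨x, hx, rfl⟩ := f4 y hy
    rw [gl x hx]; exact hx
  have gr : ∀ y ∈ m'.support, f (g y) = y := by
    intro y hy
    obtain ⟨x, hx, rfl⟩ := f4 y hy
    rw [gl x hx]
  have g1 : StrictMonoOn g ↑m'.support := by
    intro a ha b hb hab
    rw [← gr a ha, ← gr b hb] at hab
    exact (f1.lt_iff_lt (gm a ha) (gm b hb)).1 hab
  have mapf : m.mapDomain f = m' := mapDomain_eq hinj f2 f3 f4
  have mapg : m'.mapDomain g = m := by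
    refine mapDomain_eq g1.injOn gm (fun y hy => ?_) fun x hx => ⟨f x, f2 x hx, gl x hx⟩
    rw [← f3 _ (gm y hy), gr y hy]
  change (∑ᶠ σ ∈ {σ | σ ∈ E ∧ weight σ = m}, β ^ (size σ - Fintype.card ι))
    = ∑ᶠ σ ∈ {σ | σ ∈ E ∧ weight σ = m'}, β ^ (size σ - Fintype.card ι)
  have inv : ∀ (f g : ℕ+ → ℕ+) (σ : ι → Finset Marked),
      (∀ x ∈ (weight σ).support, g (f x) = x) →
      (fun s => ((σ s).image (relabel f)).image (relabel g)) = σ := by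
    intro f g σ hgf
    funext s
    rw [Finset.image_image]
    conv_rhs => rw [← Finset.image_id (s := σ s)]
    refine Finset.image_congr fun x hx => ?_
    exact ofLex.injective (Prod.ext (hgf _ (mem_support_weight.2 ⟨s, x, hx, rfl⟩)) rfl)
  refine finsum_mem_eq_of_bijOn (fun σ s => (σ s).image (relabel f)) ?_ ?_
  · refine Set.InvOn.bijOn (f' := fun σ s => (σ s).image (relabel g)) ⟨?_, ?_⟩ ?_ ?_
    · rintro σ ⟨_, rfl⟩
      exact inv f g σ gl
    · rintro σ ⟨_, rfl⟩
      exact inv g f σ gr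
    · rintro σ ⟨hσ, rfl⟩
      exact ⟨hE f σ f1 hσ, (weight_relabel hinj).trans mapf⟩
    · rintro σ ⟨hσ, rfl⟩
      exact ⟨hE g σ g1 hσ, (weight_relabel g1.injOn).trans mapg⟩
  · rintro σ ⟨hσ, rfl⟩
    rw [size_relabel hinj]

theorem relabel_le_iff {f : ℕ+ → ℕ+} {σ : ι → Finset Marked}
    (hf : StrictMonoOn f ↑(weight σ).support) {s t : ι} {x y : Marked} (hx : x ∈ σ s)
    (hy : y ∈ σ t) : relabel f x ≤ relabel f y ↔ x ≤ y := by
  have hx' := mem_support_weight.2 ⟨s, x, hx, rfl⟩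
  have hy' := mem_support_weight.2 ⟨t, y, hy, rfl⟩
  rw [Prod.Lex.le_iff, Prod.Lex.le_iff]
  exact or_congr (hf.lt_iff_lt hx' hy') (and_congr (hf.injOn.eq_iff hx' hy') Iff.rfl)

theorem weakLE_relabel {f : ℕ+ → ℕ+} {σ : ι → Finset Marked}
    (hf : StrictMonoOn f ↑(weight σ).support) {s t : ι} (h : WeakLE (σ s) (σ t)) :
    WeakLE ((σ s).image (relabel f)) ((σ t).image (relabel f)) := by
  intro x' hx' y' hy'
  obtain ⟨x, hx, rfl⟩ := Finset.mem_image.1 hx'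
  obtain ⟨y, hy, rfl⟩ := Finset.mem_image.1 hy'
  exact (relabel_le_iff hf hx hy).2 (h x hx y hy)

theorem strictLT_relabel {f : ℕ+ → ℕ+} {σ : ι → Finset Marked}
    (hf : StrictMonoOn f ↑(weight σ).support) {s t : ι} (h : StrictLT (σ s) (σ t)) :
    StrictLT ((σ s).image (relabel f)) ((σ t).image (relabel f)) := by
  intro x' hx' y' hy'
  obtain ⟨x, hx, rfl⟩ := Finset.mem_image.1 hx'
  obtain ⟨y, hy, rfl⟩ := Finset.mem_image.1 hy'
  rw [← not_le, relabel_le_iff hf hy hx, not_le]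
  exact h x hx y hy

theorem inter_relabel {f : ℕ+ → ℕ+} {σ : ι → Finset Marked}
    (hf : StrictMonoOn f ↑(weight σ).support) {s t : ι} {p : Marked → Prop}
    (hp : ∀ x, p x → p (relabel f x)) (h : ∀ x ∈ σ s, x ∈ σ t → p x) :
    ∀ x ∈ (σ s).image (relabel f), x ∈ (σ t).image (relabel f) → p x := by
  intro x' hx' hx''
  obtain ⟨x, hx, rfl⟩ := Finset.mem_image.1 hx'
  obtain ⟨y, hy, hyx⟩ := Finset.mem_image.1 hx''
  have h1 := (relabel_le_iff hf hy hx).1 hyx.le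
  have h2 := (relabel_le_iff hf hx hy).1 hyx.ge
  obtain rfl := le_antisymm h1 h2
  exact hp _ (h _ hx hy)

end Enumerator

/-! ### The weight enumerators `Ω(P, γ, V)` -/

section Omega

variable {P : Type*} [PartialOrder P]

/-- The set of enriched set-valued `(P, γ)`-partitions `σ` with `σ(v) ⊂ {1, 2, 3, ...}` for all
`v ∈ V`. -/
def enriched (γ : P → ℤ) (V : Set P) : Set (P → Finset Marked) :=
  {σ | (∀ s, (σ s).Nonempty) ∧
    (∀ s t, s ⋖ t → WeakLE (σ s) (σ t) ∧
      (γ s < γ t → ∀ x ∈ σ s, x ∈ σ t → IsUnprimed x) ∧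
      (γ t < γ s → ∀ x ∈ σ s, x ∈ σ t → IsPrimed x)) ∧
    ∀ v ∈ V, ∀ x ∈ σ v, IsUnprimed x}

variable [Fintype P]

theorem enriched_invariant (γ : P → ℤ) (V : Set P) : RelabelInvariant (enriched γ V) := by
  rintro f σ hf ⟨h1, h2, h3⟩
  refine ⟨fun s => (h1 s).image _, fun s t hst => ⟨weakLE_relabel hf (h2 s t hst).1,
    fun h => inter_relabel hf (fun x hx => hx) ((h2 s t hst).2.1 h),
    fun h => inter_relabel hf (fun x hx => hx) ((h2 s t hst).2.2 h)⟩, fun v hv x' hx' => ?_⟩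
  obtain ⟨x, hx, rfl⟩ := Finset.mem_image.1 hx'
  exact h3 v hv x hx

/-- `Ω^{(β)}(P, γ, V)`, the enriched set-valued weight enumerator; here `V` is meant to be a set of
valleys of `(P, γ)`. -/
noncomputable def OmegaV (γ : P → ℤ) (V : Set P) : QSym :=
  ⟨enumerator (enriched γ V), enumerator_mem (enriched_invariant γ V)⟩

/-- `Ω^{(β)}(P, γ)`. -/
noncomputable def Omega (γ : P → ℤ) : QSym := OmegaV γ ∅

end Omega

/-! ### Multipeak quasisymmetric functions -/

/-- The index set of `K^{(β)}_α`: tuples `(S_1, ..., S_n)` of nonempty finite sets of marked integers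
with `S_1 ≼ ⋯ ≼ S_n`, such that `S_i ∩ S_{i+1}` consists of primed numbers if `i ∈ I(α)` and of
unprimed numbers if `i ∉ I(α)`. Indices are shifted by one: `S_{i+1}` is the value at `i`. -/
def setsK (α : Composition n) : Set (Fin n → Finset Marked) :=
  {S | (∀ i, (S i).Nonempty) ∧
    ∀ i j : Fin n, (j : ℕ) = i + 1 → WeakLE (S i) (S j) ∧
      ((j : ℕ) ∈ I α → ∀ x ∈ S i, x ∈ S j → IsPrimed x) ∧
      ((j : ℕ) ∉ I α → ∀ x ∈ S i, x ∈ S j → IsUnprimed x)}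

theorem setsK_invariant (α : Composition n) : RelabelInvariant (setsK α) := by
  rintro f σ hf ⟨h1, h2⟩
  exact ⟨fun s => (h1 s).image _, fun s t hst => ⟨weakLE_relabel hf (h2 s t hst).1,
    fun h => inter_relabel hf (fun x hx => hx) ((h2 s t hst).2.1 h),
    fun h => inter_relabel hf (fun x hx => hx) ((h2 s t hst).2.2 h)⟩⟩

/-- The multipeak quasisymmetric function `K^{(β)}_α` (of a peak composition `α`). -/
noncomputable def K (α : Composition n) : QSym :=
  ⟨enumerator (setsK α), enumerator_mem (setsK_invariant α)⟩

/-- The index set of the barred variant of `K^{(β)}_α`: tuples `(S_1, ..., S_n)` of nonempty finite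
sets of marked integers with `S_1 ≼ ⋯ ≼ S_n`, such that `S_i ≺ S_{i+1}` if `i ∈ I(α)`,
`S_i ∩ S_{i+1}` consists of unprimed numbers if `i ∉ I(α)`, and `S_{i+1}` consists of unprimed
numbers if `i ∈ {0} ∪ I(α)`. Indices are shifted by one: `S_{i+1}` is the value at `i`. -/
def setsKBar (α : Composition n) : Set (Fin n → Finset Marked) :=
  {S | (∀ i, (S i).Nonempty) ∧
    (∀ i j : Fin n, (j : ℕ) = i + 1 → WeakLE (S i) (S j) ∧
      ((j : ℕ) ∈ I α → StrictLT (S i) (S j)) ∧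
      ((j : ℕ) ∉ I α → ∀ x ∈ S i, x ∈ S j → IsUnprimed x)) ∧
    ∀ j : Fin n, (j : ℕ) = 0 ∨ (j : ℕ) ∈ I α → ∀ x ∈ S j, IsUnprimed x}

theorem setsKBar_invariant (α : Composition n) : RelabelInvariant (setsKBar α) := by
  rintro f σ hf ⟨h1, h2, h3⟩
  refine ⟨fun s => (h1 s).image _, fun s t hst => ⟨weakLE_relabel hf (h2 s t hst).1,
    fun h => strictLT_relabel hf ((h2 s t hst).2.1 h),
    fun h => inter_relabel hf (fun x hx => hx) ((h2 s t hst).2.2 h)⟩, fun v hv x' hx' => ?_⟩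
  obtain ⟨x, hx, rfl⟩ := Finset.mem_image.1 hx'
  exact h3 v hv x hx

/-- The variant of `K^{(β)}_α` written with a bar (for a peak composition `α`). -/
noncomputable def KBar (α : Composition n) : QSym :=
  ⟨enumerator (setsKBar α), enumerator_mem (setsKBar_invariant α)⟩

/-! ### Shifted stable Grothendieck polynomials -/

/-- Strict partitions `λ_1 > λ_2 > ⋯ > λ_k > 0`, with the convention `λ_i = 0` for `i > k`. The
condition forces `λ_i = 0` for all large `i`. -/
structure StrictPartition where
  /-- The parts. -/
  part : ℕ+ → ℕ
  strict : ∀ i j, i < j → part j = 0 ∨ part j < part i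

/-- `μ ⊆ λ`, that is, `μ_i ≤ λ_i` for all `i`. -/
def StrictPartition.Contained (mu la : StrictPartition) : Prop := ∀ i, mu.part i ≤ la.part i

/-- The shifted skew diagram `{(i, i + j - 1) : μ_i < j ≤ λ_i}` of `λ/μ`. -/
def SD (la mu : StrictPartition) : Set (ℕ+ × ℕ+) :=
  {c | ∃ j : ℕ, 0 < j ∧ mu.part c.1 < j ∧ j ≤ la.part c.1 ∧ (c.2 : ℕ) = c.1 + j - 1}

theorem part_add_le (la : StrictPartition) (k : ℕ) (h : la.part (Nat.succPNat k) ≠ 0) :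
    la.part (Nat.succPNat k) + k ≤ la.part 1 := by
  induction k with
  | zero => exact le_rfl
  | succ k ih =>
    have h1 := (la.strict (Nat.succPNat k) (Nat.succPNat (k + 1))
      (Nat.succPNat_lt_succPNat.2 (Nat.lt_succ_self k))).resolve_left h
    have h2 := ih (by omega)
    omega

theorem finite_SD (la mu : StrictPartition) : (SD la mu).Finite := by
  refine ((Set.finite_Iic (Nat.succPNat (la.part 1))).prod
    (Set.finite_Iic (Nat.succPNat (la.part 1)))).subset ?_
  rintro ⟨a, b⟩ ⟨j, hj0, -, hj, hb⟩
  simp only at hj hb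
  have h := part_add_le la a.natPred (by rw [PNat.succPNat_natPred]; omega)
  rw [PNat.succPNat_natPred] at h
  have ha := PNat.natPred_add_one a
  refine ⟨?_, ?_⟩ <;> rw [Set.mem_Iic, ← PNat.coe_le_coe, Nat.succPNat_coe] <;> simp only <;> omega

/-- The diagram carries the order `(i, j) ≤ (i', j')` iff `i ≤ i'` and `j ≤ j'`. -/
noncomputable instance (la mu : StrictPartition) : Fintype (SD la mu) := (finite_SD la mu).fintype

/-- An injective labeling `θ` of the diagram by integers with `θ(i,j) < θ(i,j+1)` and
`θ(i,j) > θ(i+1,j)` whenever both boxes belong to the diagram. -/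
structure IsTableauLabeling {la mu : StrictPartition} (θ : SD la mu → ℤ) : Prop where
  injective : Function.Injective θ
  row : ∀ c d : SD la mu, d.1.1 = c.1.1 → d.1.2 = c.1.2 + 1 → θ c < θ d
  col : ∀ c d : SD la mu, d.1.1 = c.1.1 + 1 → d.1.2 = c.1.2 → θ d < θ c

/-- Such labelings exist, even with image `[n]` where `n` is the number of boxes. -/
theorem exists_labeling (la mu : StrictPartition) :
    ∃ θ : SD la mu → ℤ, IsTableauLabeling θ ∧
      Set.range θ = Set.Icc 1 (Fintype.card (SD la mu) : ℤ) := by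
  let key : SD la mu → ℕ+ᵒᵈ ×ₗ ℕ+ := fun c => toLex (OrderDual.toDual c.1.1, c.1.2)
  have hkey : Function.Injective key := fun c d h => by
    have h1 : OrderDual.ofDual (ofLex (key c)).1 = OrderDual.ofDual (ofLex (key d)).1 := by rw [h]
    have h2 : (ofLex (key c)).2 = (ofLex (key d)).2 := by rw [h]
    exact Subtype.ext (Prod.ext h1 h2)
  obtain ⟨e, he⟩ : ∃ e : Fin (Fintype.card (SD la mu)) ≃ SD la mu,
      ∀ c d, key c < key d → e.symm c < e.symm d := by
    let u : SD la mu ≃ Set.range key := Equiv.ofInjective key hkey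
    let e := Fintype.orderIsoFinOfCardEq (Set.range key) (Fintype.card_congr u).symm
    exact ⟨e.toEquiv.trans u.symm, fun c d h => e.symm.strictMono (a := u c) (b := u d) h⟩
  have hlt : ∀ c d, key c < key d → ((e.symm c : ℕ) : ℤ) + 1 < ((e.symm d : ℕ) : ℤ) + 1 := by
    intro c d h
    have := Fin.lt_def.1 (he c d h)
    omega
  refine ⟨fun c => ((e.symm c : ℕ) : ℤ) + 1, ⟨?_, ?_, ?_⟩, ?_⟩
  · intro c d h
    have : (e.symm c : ℕ) = e.symm d := by simp only at h; omega
    exact e.symm.injective (Fin.ext this)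
  · intro c d h1 h2
    apply hlt
    rw [Prod.Lex.lt_iff]
    right
    refine ⟨congrArg OrderDual.toDual h1.symm, ?_⟩
    change c.1.2 < d.1.2
    rw [h2]
    exact PNat.lt_add_right _ _
  · intro c d h1 h2
    apply hlt
    rw [Prod.Lex.lt_iff]
    left
    change c.1.1 < d.1.1
    rw [h1]
    exact PNat.lt_add_right _ _
  · ext z
    simp only [Set.mem_range, Set.mem_Icc]
    constructor
    · rintro ⟨c, rfl⟩
      have := (e.symm c).2
      omega
    · rintro ⟨h1, h2⟩
      refine ⟨e ⟨(z - 1).toNat, by omega⟩, ?_⟩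
      rw [Equiv.symm_apply_apply]
      simp only
      omega

/-- The `K`-theoretic Schur `Q`-function `GQ^{(β)}_{λ/μ}`, computed with the labeling `θ`. -/
noncomputable def GQ {la mu : StrictPartition} (θ : SD la mu → ℤ) : QSym := Omega θ

/-- The `K`-theoretic Schur `P`-function `GP^{(β)}_{λ/μ}`, computed with the labeling `θ`: boxes on
the main diagonal contain only unprimed numbers. -/
noncomputable def GP {la mu : StrictPartition} (θ : SD la mu → ℤ) : QSym :=
  OmegaV θ {c | c.1.1 = c.1.2}

end Multipeak

namespace Multipeak

variable {n : ℕ}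

/-! ### Expansions in the basis `L_α` -/

/-! Every series in question has a transfer-matrix description. Fill the boxes of P with the letters
1', 1, 2', 2, ... in increasing order, and let the state be the set of boxes still waiting for their
largest letter. Putting a letter into the box s acts by a matrix u_s (`boxOp`) with u_s² = βu_s, and
u_s, u_t commute unless one of s, t covers the other. Each number i contributes the same polynomial
F(x), a product of factors 1 + x u_s: one per box outside V by decreasing label (the primed letter),
followed by one per box by increasing label (the unprimed letter). So the coefficient of x_1^{a_1} ⋯
x_k^{a_k} in Ω(P, γ, V) is a fixed entry of F_{a_1} ⋯ F_{a_k}, where F_a is the coefficient of x^a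
in F (`coeff_OmegaV`).

The formula for ψ. The coefficients in the basis L_α are the same entry of alternating sums of such
products, the noncommutative ribbons built from the F_a. Complementing the descent set of a ribbon
amounts to replacing F(x) by the inverse of F(-x) (`cutSum_compl`). From u² = βu one gets (1 + u
x/(1-βx))(1 - ux) = 1, so this inverse is F(x/(1-βx)) as soon as F is unchanged when its factors are
written in the opposite order. That holds whenever all elements of V are valleys
(`boxPoly_boxOrder_reverse`), which gives `psi_OmegaV`.

The formula for ρ. Reversing the order of the numbers, and exchanging primed and unprimed letters
outside V, turns fillings of (P, γ) into fillings of the dual poset (`isReversal_OmegaV`). Since ω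
is ψ after ρ, the statement on labeled posets follows.

The functions K and K̄ are weight enumerators of chains with descent set I(α), without a valley
condition and with one at all valleys. Dualizing the chain gives the reversed complement of I(α) as
descent set, whose peaks form I(α^♭). Only the peaks matter: the lowest box of a descending run can
be moved one step along the chain. For K this is an identity between two products of four factors;
for K̄ it needs an intertwining matrix (`OmegaV_slide`).

For GP and GQ one must see that Ω is its own reversal. This follows once the F_a commute with each
other. Label the boxes by content and let u_k be the sum of the u_s over the boxes s of content k.
Then F(x) = h_N(x) ⋯ h_1(x) · F₀(x) · h_1(x) ⋯ h_N(x) with h_k(x) = 1 + x u_k, where F₀ is h_0(x)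
for GP and h_0(x)² for GQ. The h_k with k ≥ 1 satisfy a Yang-Baxter equation and F₀ a reflection
equation, so F(x) and F(y) commute, as do transfer matrices of an integrable model with a boundary
(`ShiftedRelations.dressed_mul_comm`). -/

theorem sum_moebius_right {κ : Type*} [DecidableEq κ] [Fintype κ] (c : Finset κ → ℤ[X])
    (E : Finset κ) :
    ∑ A : Finset κ with A ⊆ E, ∑ T : Finset κ with T ⊆ A, (-1) ^ (A \ T).card * c T = c E := by
  let Mo : Matrix (Finset κ) (Finset κ) ℤ[X] :=
    fun A T => if T ⊆ A then (-1) ^ (A \ T).card else 0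
  let Z : Matrix (Finset κ) (Finset κ) ℤ[X] := fun T B => if B ⊆ T then 1 else 0
  have h1 : Mo * Z = 1 := by
    ext1 A B
    rw [Matrix.mul_apply, Matrix.one_apply]
    have := sum_moebius A B
    rw [Finset.sum_filter] at this
    simp only [eq_comm (a := A)]
    rw [← this]
    refine Finset.sum_congr rfl fun T _ => ?_
    simp only [Mo, Z, ite_mul, zero_mul]
  -- `sum_moebius` makes `Mo` a left inverse of `Z`; for square matrices over a commutative ring it
  -- is then also a right inverse.
  have h2 : Z.mulVec (Mo.mulVec c) = c := by
    rw [Matrix.mulVec_mulVec, mul_eq_one_comm.1 h1, Matrix.one_mulVec]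
  have h3 := congrFun h2 E
  simp only [Matrix.mulVec, dotProduct, Mo, Z, ite_mul, zero_mul, one_mul] at h3
  simpa only [Finset.sum_filter] using h3

/-- Möbius inversion recovers the M-coefficients from the L-coefficients, because M_ε occurs in L_α
exactly when I(α) ⊆ I(ε). -/
theorem sum_coeffL (g : Series) (ε : Composition n) :
    ∑ α : Composition n with I α ⊆ I ε, coeffL g α = MvPowerSeries.coeff (packed ε) g := by
  have h := sum_moebius_right
    (fun T => MvPowerSeries.coeff (packed ((compEquiv n).symm T)) g) (compEquiv n ε)
  simp only [Equiv.symm_apply_apply] at h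
  rw [← h, Finset.sum_filter, Finset.sum_filter]
  refine Fintype.sum_equiv (compEquiv n) _ _ fun α => ?_
  simp only [I_subset_iff]
  refine if_congr Iff.rfl ?_ rfl
  rw [coeffL, Finset.sum_filter, Finset.sum_filter]
  refine Fintype.sum_equiv (compEquiv n) _ _ fun γ => ?_
  simp only [I_subset_iff, Equiv.symm_apply_apply]
  rw [I_eq_map, I_eq_map, ← Finset.map_sdiff, Finset.card_map]

/-- The composition formed by the nonzero exponents of a monomial. -/
def expsComp (m : ℕ+ →₀ ℕ) : Composition m.degree where
  blocks := exps m
  blocks_pos := by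
    intro i hi
    obtain ⟨x, hx, rfl⟩ := List.mem_map.1 hi
    exact Nat.pos_of_ne_zero (Finsupp.mem_support_iff.1 ((Finset.mem_sort _).1 hx))
  blocks_sum := (degree_eq m).symm

/-- All formulas for ω, ψ and ρ are proved through this criterion. Quasisymmetry reduces the claim
to packed monomials, whose coefficients are determined by the L-coefficients. -/
theorem twist_eq {τ : ∀ n, Composition n → Composition n} (hτ : ∀ n, Function.Bijective (τ n))
    {f g : Series} (hg : g ∈ QSym)
    (h : ∀ (n : ℕ) (α : Composition n), coeffL g (τ n α) = coeffL f α) : twistFun τ f = g := by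
  ext1 m
  have h1 : exps m = exps (packed (expsComp m)) := (exps_packed (expsComp m)).symm
  rw [coeff_twistFun, mem_QSym.1 hg _ _ h1, ← sum_coeffL]
  simp only [twistPart, ← h]
  rw [(hτ m.degree).sum_comp (fun α => coeffL g α • L α), mem_QSym.1 (Submodule.sum_mem _ fun α _ =>
    Submodule.smul_mem _ _ (L_mem α)) _ _ h1, map_sum, Finset.sum_filter]
  refine Finset.sum_congr rfl fun α _ => ?_
  rw [map_smul, coeff_packed_L, smul_eq_mul, mul_ite, mul_one, mul_zero]

theorem I_injective : Function.Injective (I : Composition n → Finset ℕ) := by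
  intro α γ h
  rw [I_eq_map, I_eq_map] at h
  exact (compEquiv n).injective (Finset.map_injective _ h)

theorem I_subset_Ico (α : Composition n) : I α ⊆ Finset.Ico 1 n := by
  rw [I_eq_map]
  intro j hj
  obtain ⟨i, -, rfl⟩ := Finset.mem_map.1 hj
  have := i.2
  rw [shiftEmb_apply, Finset.mem_Ico]
  omega

theorem exists_I_eq {T : Finset ℕ} (hT : T ⊆ Finset.Ico 1 n) : ∃ α : Composition n, I α = T := by
  refine ⟨(compEquiv n).symm (Finset.univ.filter fun i => shiftEmb n i ∈ T), ?_⟩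
  rw [I_eq_map, Equiv.apply_symm_apply]
  ext j
  simp only [Finset.mem_map, Finset.mem_filter, Finset.mem_univ, true_and]
  constructor
  · rintro ⟨i, hi, rfl⟩
    exact hi
  · intro hj
    have h := Finset.mem_Ico.1 (hT hj)
    have h2 : shiftEmb n ⟨j - 1, by omega⟩ = j := by rw [shiftEmb_apply]; simp only; omega
    exact ⟨_, by rwa [h2], h2⟩

theorem sum_I_subset {E : Type*} [AddCommMonoid E] (F : Finset ℕ → E) {A : Finset ℕ}
    (hA : A ⊆ Finset.Ico 1 n) :
    ∑ γ : Composition n with I γ ⊆ A, F (I γ) = ∑ T ∈ A.powerset, F T := by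
  refine Finset.sum_nbij I ?_ (I_injective.injOn) ?_ fun _ _ => rfl
  · intro γ hγ
    exact Finset.mem_powerset.2 (Finset.mem_filter.1 hγ).2
  · intro T hT
    have hT' := Finset.mem_powerset.1 hT
    obtain ⟨α, rfl⟩ := exists_I_eq (hT'.trans hA)
    exact ⟨α, by simpa using hT', rfl⟩

/-! ### Reversal and complement -/

theorem sizeUpTo_reverse (α : Composition n) (i : ℕ) :
    α.reverse.sizeUpTo i = n - α.sizeUpTo (α.length - i) := by
  have h1 : α.reverse.sizeUpTo i = (α.blocks.drop (α.length - i)).sum := by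
    simp only [Composition.sizeUpTo, Composition.reverse_blocks, List.take_reverse,
      List.sum_reverse]
  have h2 := congrArg List.sum (List.take_append_drop (α.length - i) α.blocks)
  rw [List.sum_append, α.blocks_sum] at h2
  rw [h1, Composition.sizeUpTo]
  omega

theorem I_reverse (α : Composition n) : I α.reverse = (I α).image (n - ·) := by
  have hl : α.reverse.length = α.length := by
    simp [Composition.length]
  ext j
  simp only [I, Finset.mem_image, Finset.mem_Ioo, hl, sizeUpTo_reverse]
  constructor
  · rintro ⟨i, hi, rfl⟩
    exact ⟨_, ⟨α.length - i, by omega, rfl⟩, rfl⟩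
  · rintro ⟨_, ⟨i, hi, rfl⟩, rfl⟩
    exact ⟨α.length - i, by omega, by rw [Nat.sub_sub_self hi.2.le]⟩

theorem mem_I_reverse {α : Composition n} {j : ℕ} : j ∈ I α.reverse ↔ j ≤ n ∧ n - j ∈ I α := by
  rw [I_reverse, Finset.mem_image]
  constructor
  · rintro ⟨i, hi, rfl⟩
    have h := Finset.mem_Ico.1 (I_subset_Ico α hi)
    rw [Nat.sub_sub_self h.2.le]
    exact ⟨by omega, hi⟩
  · rintro ⟨h1, h2⟩
    exact ⟨n - j, h2, by omega⟩

theorem I_reverse_subset_iff {α γ : Composition n} : I α.reverse ⊆ I γ.reverse ↔ I α ⊆ I γ := by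
  constructor
  · intro h j hj
    have hj' := Finset.mem_Ico.1 (I_subset_Ico α hj)
    have h2 : n - j ∈ I α.reverse := mem_I_reverse.2 ⟨by omega, by rwa [Nat.sub_sub_self hj'.2.le]⟩
    have h3 := (mem_I_reverse.1 (h h2)).2
    rwa [Nat.sub_sub_self hj'.2.le] at h3
  · intro h
    rw [I_reverse, I_reverse]
    exact Finset.image_subset_image h

theorem card_I_reverse_sdiff (α γ : Composition n) :
    (I α.reverse \ I γ.reverse).card = (I α \ I γ).card := by
  have hinj : Set.InjOn (n - ·) (↑(I α ∪ I γ) : Set ℕ) := by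
    intro a ha b hb hab
    have hs := Finset.union_subset (I_subset_Ico α) (I_subset_Ico γ)
    have h1 := Finset.mem_Ico.1 (hs ha)
    have h2 := Finset.mem_Ico.1 (hs hb)
    simp only at hab
    omega
  have h : I α.reverse \ I γ.reverse = (I α \ I γ).image (n - ·) := by
    rw [I_reverse, I_reverse]
    ext j
    simp only [Finset.mem_sdiff, Finset.mem_image]
    constructor
    · rintro ⟨⟨i, hi, rfl⟩, h2⟩
      exact ⟨i, ⟨hi, fun h3 => h2 ⟨i, h3, rfl⟩⟩, rfl⟩
    · rintro ⟨i, ⟨h1, h2⟩, rfl⟩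
      refine ⟨⟨i, h1, rfl⟩, ?_⟩
      rintro ⟨i', h3, h4⟩
      exact h2 (hinj (Finset.mem_union_right _ h3) (Finset.mem_union_left _ h1) h4 ▸ h3)
  rw [h]
  exact Finset.card_image_of_injOn (hinj.mono
    (Finset.coe_subset.2 (Finset.sdiff_subset.trans Finset.subset_union_left)))

theorem compl_compl (α : Composition n) : compl (compl α) = α := by
  simp [compl]

theorem compl_reverse (α : Composition n) : compl α.reverse = (compl α).reverse := by
  apply I_injective
  ext j
  rw [mem_I_reverse, I_compl, I_compl, Finset.mem_sdiff, Finset.mem_sdiff, mem_I_reverse,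
    Finset.mem_Ico, Finset.mem_Ico]
  constructor
  · rintro ⟨h1, h2⟩
    exact ⟨by omega, by omega, fun h => h2 ⟨by omega, h⟩⟩
  · rintro ⟨h1, h2, h3⟩
    exact ⟨by omega, fun h => h3 h.2⟩

theorem bijective_compl : Function.Bijective (compl : Composition n → Composition n) :=
  Function.Involutive.bijective compl_compl

theorem bijective_reverse :
    Function.Bijective (Composition.reverse : Composition n → Composition n) :=
  Function.Involutive.bijective Composition.reverse_reverse

/-- Reversal is an automorphism of the refinement order and preserves the signs, so the Möbius sum
is only reindexed. -/
theorem coeffL_reverse {f g : Series} (α : Composition n)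
    (h : ∀ γ : Composition n, MvPowerSeries.coeff (packed γ.reverse) g
      = MvPowerSeries.coeff (packed γ) f) :
    coeffL g α.reverse = coeffL f α := by
  rw [coeffL, coeffL, Finset.sum_filter, Finset.sum_filter]
  refine (bijective_reverse.sum_comp _).symm.trans (Finset.sum_congr rfl fun γ _ => ?_)
  rw [h, card_I_reverse_sdiff]
  exact if_congr I_reverse_subset_iff rfl rfl

/-! ### Products over blocks -/

section Blocks

variable {E : Type*} [Ring E] (B : ℕ → E)

/-- The product of `B` over the sizes of the blocks into which `{1, ..., n + p}` is cut at the
points of `T ∩ [n]`. -/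
def cutProd (T : Finset ℕ) : ℕ → ℕ → E
  | 0, p => B p
  | n + 1, p => if n + 1 ∈ T then cutProd T n 1 * B p else cutProd T n (p + 1)

theorem cutProd_congr {T T' : Finset ℕ} {n : ℕ} (h : ∀ i ≤ n, i ∈ T ↔ i ∈ T') (p : ℕ) :
    cutProd B T n p = cutProd B T' n p := by
  induction n generalizing p with
  | zero => rfl
  | succ n ih =>
    simp only [cutProd, h (n + 1) le_rfl]
    rw [ih (fun i hi => h i (by omega)), ih (fun i hi => h i (by omega))]

theorem cutProd_add {T : Finset ℕ} {n r : ℕ} (h : ∀ i, n < i → i ≤ n + r → i ∉ T) (p : ℕ) :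
    cutProd B T (n + r) p = cutProd B T n (p + r) := by
  induction r generalizing p with
  | zero => rfl
  | succ r ih =>
    rw [← add_assoc, cutProd, if_neg (h _ (by omega) (by omega)),
      ih (fun i h1 h2 => h i h1 (by omega))]
    congr 1
    omega

/-- The n points are split as (n - 1) + 1: every point of [n-1] may be a cut, and the last block
starts with size 1. Positivity of n keeps the truncated subtraction harmless. -/
theorem cutProd_I (α : Composition n) (hn : 0 < n) :
    cutProd B (I α) (n - 1) 1 = (α.blocks.map B).prod := by
  have hpos : ∀ i (hi : i < α.length), 1 ≤ α.blocks[i] := fun i hi =>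
    α.blocks_pos (List.getElem_mem hi)
  have hcut : ∀ i (hi : i < α.length), ∀ j, α.sizeUpTo i < j → j < α.sizeUpTo i + α.blocks[i] →
      j ∉ I α := by
    intro i hi j h1 h2 hj
    obtain ⟨r, hr, rfl⟩ := Finset.mem_image.1 hj
    rw [← α.sizeUpTo_succ hi] at h2
    have h3 : ¬ r ≤ i := fun h => absurd (α.monotone_sizeUpTo h) (by omega)
    have h4 : ¬ i + 1 ≤ r := fun h => absurd (α.monotone_sizeUpTo h) (by omega)
    omega
  have key : ∀ i, i < α.length → cutProd B (I α) (α.sizeUpTo (i + 1) - 1) 1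
      = ((α.blocks.take (i + 1)).map B).prod := by
    intro i
    induction i with
    | zero =>
      intro hi
      have h := hcut 0 hi
      rw [α.sizeUpTo_zero] at h
      have hp := hpos 0 hi
      have h1 := cutProd_add B (T := I α) (n := 0) (r := α.blocks[0] - 1)
        (fun j h1 h2 => h j h1 (by omega)) 1
      rw [α.sizeUpTo_succ hi, α.sizeUpTo_zero, List.take_add_one, List.getElem?_eq_getElem hi]
      simp only [zero_add] at h1 ⊢
      rw [h1, cutProd, Nat.add_sub_cancel' hp]
      simp
    | succ i ih =>
      intro hi
      have h := hcut (i + 1) hi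
      have hp := hpos (i + 1) hi
      have hs := α.sizeUpTo_strict_mono (i := i) (by omega)
      have h1 := cutProd_add B (T := I α) (n := α.sizeUpTo (i + 1)) (r := α.blocks[i + 1] - 1)
        (fun j h1 h2 => h j h1 (by omega)) 1
      have hmem : α.sizeUpTo (i + 1) ∈ I α :=
        Finset.mem_image_of_mem _ (Finset.mem_Ioo.2 ⟨by omega, hi⟩)
      rw [α.sizeUpTo_succ hi, List.take_add_one, List.getElem?_eq_getElem hi, Nat.add_sub_assoc hp,
        h1, Nat.add_sub_cancel' hp]
      obtain ⟨t, ht⟩ : ∃ t, α.sizeUpTo (i + 1) = t + 1 := ⟨α.sizeUpTo (i + 1) - 1, by omega⟩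
      have ih' := ih (by omega)
      rw [ht] at hmem ih' ⊢
      rw [Nat.add_sub_cancel] at ih'
      rw [cutProd, if_pos hmem, ih', List.map_append, List.prod_append]
      simp only [Option.toList_some, List.map_cons, List.map_nil, List.prod_singleton]
  have hl : 0 < α.length := α.length_pos_of_pos hn
  have := key (α.length - 1) (by omega)
  rwa [Nat.sub_add_cancel hl, α.sizeUpTo_length, List.take_of_length_le (by rfl)] at this

/-- The alternating sum of `cutProd B T` over the subsets `T` of `A`. -/
def cutSum (A : Finset ℕ) (n p : ℕ) : E :=
  ∑ T ∈ A.powerset, (-1) ^ (A \ T).card * cutProd B T n p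

theorem cutSum_zero (p : ℕ) : cutSum B ∅ 0 p = B p := by
  simp [cutSum, cutProd]

theorem cutSum_of_notMem {A : Finset ℕ} {n : ℕ} (h : n + 1 ∉ A) (p : ℕ) :
    cutSum B A (n + 1) p = cutSum B A n (p + 1) := by
  refine Finset.sum_congr rfl fun T hT => ?_
  rw [cutProd, if_neg fun h' => h (Finset.mem_powerset.1 hT h')]

/-- This is the ribbon product rule R_α H_p = R_{(α,p)} + R_{α⊙p}, where ⊙ merges the adjacent
parts. Subsets T containing n + 1 give the product; those avoiding it merge the last two blocks and
carry one more sign. -/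
theorem cutSum_insert {A : Finset ℕ} {n : ℕ} (h : n + 1 ∉ A) (p : ℕ) :
    cutSum B (insert (n + 1) A) (n + 1) p = cutSum B A n 1 * B p - cutSum B A n (p + 1) := by
  rw [cutSum, Finset.sum_powerset_insert h, cutSum, cutSum, Finset.sum_mul,
    ← Finset.sum_sub_distrib, ← Finset.sum_add_distrib]
  refine Finset.sum_congr rfl fun T hT => ?_
  have hT' := Finset.mem_powerset.1 hT
  have h1 : n + 1 ∉ T := fun h' => h (hT' h')
  have h2 : insert (n + 1) A \ insert (n + 1) T = A \ T := by
    rw [Finset.insert_sdiff_insert, Finset.sdiff_insert_of_notMem h]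
  have h3 : (insert (n + 1) A \ T).card = (A \ T).card + 1 := by
    rw [Finset.insert_sdiff_of_notMem _ h1, Finset.card_insert_of_notMem]
    exact fun h' => h (Finset.sdiff_subset h')
  rw [h2, h3, cutProd, if_neg h1, cutProd, if_pos (Finset.mem_insert_self _ _),
    cutProd_congr B (T := insert (n + 1) T) (T' := T)]
  · rw [pow_succ]
    noncomm_ring
  · intro i hi
    rw [Finset.mem_insert, or_iff_right (by omega)]

/-- The relation says that B' is, up to signs, inverse to B, as the elementary functions are to the
complete ones. For p = 1 the right side is a single ribbon in B' for the complementary set; a last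
block of arbitrary size p is needed to make the induction on n close. -/
theorem cutSum_eq_sum {B' : ℕ → E} (h0 : B 0 = 1)
    (h : ∀ p, 0 < p → ∑ j ∈ Finset.range (p + 1), (-1) ^ j * (B' j * B (p - j)) = 0)
    (h0' : B' 0 = 1) (n : ℕ) {A A' : Finset ℕ} (hd : Disjoint A A')
    (hu : A ∪ A' = Finset.Icc 1 n)
    {p : ℕ} (hp : 0 < p) :
    cutSum B A n p
      = ∑ j ∈ Finset.range p, (-1) ^ j * (cutSum B' A' n (j + 1) * B (p - 1 - j)) := by
  have base : ∀ p, 0 < p →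
      B p = ∑ j ∈ Finset.range p, (-1) ^ j * (B' (j + 1) * B (p - 1 - j)) := by
    intro p hp
    have h1 := h p hp
    rw [Finset.sum_range_succ', h0'] at h1
    simp only [pow_zero, one_mul, Nat.sub_zero, pow_succ, mul_neg, mul_one, neg_mul,
      Finset.sum_neg_distrib] at h1
    rw [neg_add_eq_zero] at h1
    rw [← h1]
    refine Finset.sum_congr rfl fun j _ => ?_
    rw [Nat.sub_sub, add_comm 1 j]
  have shift : ∀ (F : ℕ → E) p,
      ∑ j ∈ Finset.range (p + 1), (-1) ^ j * (F (j + 1) * B (p + 1 - 1 - j))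
        = F 1 * B p - ∑ j ∈ Finset.range p, (-1) ^ j * (F (j + 2) * B (p - 1 - j)) := by
    intro F p
    rw [Finset.sum_range_succ']
    simp only [pow_zero, one_mul, Nat.sub_zero, pow_succ, mul_neg, mul_one, neg_mul,
      Finset.sum_neg_distrib]
    rw [add_comm, sub_eq_add_neg, Nat.add_sub_cancel]
    congr 2
    refine Finset.sum_congr rfl fun j _ => ?_
    rw [Nat.sub_sub, add_comm 1 j]
  induction n generalizing A A' p with
  | zero =>
    obtain ⟨rfl, rfl⟩ := Finset.union_eq_empty.1 (hu.trans (by simp))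
    simp only [cutSum_zero]
    exact base p hp
  | succ n ih =>
    have hmem : n + 1 ∈ A ∪ A' := by rw [hu]; simp
    have hIcc : (Finset.Icc 1 (n + 1)).erase (n + 1) = Finset.Icc 1 n := by
      ext i
      simp only [Finset.mem_erase, Finset.mem_Icc]
      omega
    rcases Finset.mem_union.1 hmem with hA | hA'
    · have hA' : n + 1 ∉ A' := Finset.disjoint_left.1 hd hA
      have hd' : Disjoint (A.erase (n + 1)) A' := hd.mono_left (Finset.erase_subset _ _)
      have hu' : A.erase (n + 1) ∪ A' = Finset.Icc 1 n := by
        rw [← hIcc, ← hu, Finset.erase_union_distrib, Finset.erase_eq_of_notMem hA']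
      rw [← Finset.insert_erase hA, cutSum_insert _ (Finset.notMem_erase _ _), ih hd' hu' one_pos,
        ih hd' hu' (p := p + 1) p.succ_pos]
      simp only [Finset.sum_range_one, pow_zero, one_mul, zero_add, Nat.sub_self, h0, mul_one,
        cutSum_of_notMem B' hA']
      -- The j = 0 term of the induction hypothesis for p + 1 is exactly the product coming from
      -- `cutSum_insert`, so it cancels.
      rw [shift, sub_sub_cancel]
    · have hA : n + 1 ∉ A := Finset.disjoint_right.1 hd hA'
      have hd' : Disjoint A (A'.erase (n + 1)) := hd.mono_right (Finset.erase_subset _ _)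
      have hu' : A ∪ A'.erase (n + 1) = Finset.Icc 1 n := by
        rw [← hIcc, ← hu, Finset.erase_union_distrib, Finset.erase_eq_of_notMem hA]
      have hC := Finset.insert_erase hA'
      have hC' : n + 1 ∉ A'.erase (n + 1) := Finset.notMem_erase _ _
      generalize A'.erase (n + 1) = C at *
      subst hC
      rw [cutSum_of_notMem _ hA, ih hd' hu' (p := p + 1) p.succ_pos]
      simp only [cutSum_insert _ hC', sub_mul, mul_sub, Finset.sum_sub_distrib]
      -- The products created by `cutSum_insert` share the left factor `cutSum B' C n 1`; by `base`
      -- they add up to that factor times `B p`, the term split off by `shift`.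
      rw [shift, base p hp, Finset.mul_sum]
      congr 1
      refine Finset.sum_congr rfl fun j _ => ?_
      rw [mul_assoc, ← mul_assoc, ((Commute.neg_one_right _).pow_right j).eq, mul_assoc]

theorem cutSum_compl {B' : ℕ → E} (h0 : B 0 = 1) (h0' : B' 0 = 1)
    (h : ∀ p, 0 < p → ∑ j ∈ Finset.range (p + 1), (-1) ^ j * (B' j * B (p - j)) = 0)
    (n : ℕ) {A A' : Finset ℕ} (hd : Disjoint A A') (hu : A ∪ A' = Finset.Icc 1 n) :
    cutSum B A n 1 = cutSum B' A' n 1 := by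
  rw [cutSum_eq_sum B h0 h h0' n hd hu one_pos]
  simp [h0]

end Blocks

/-! ### Fillings as products of elementary operators -/

section Operators

open scoped Classical

set_option linter.unusedSectionVars false

variable {P : Type*} [PartialOrder P]

/-- `s` is a minimal element of the upper set `U`. -/
def IsMinOf (s : P) (U : Finset P) : Prop :=
  IsUpperSet (U : Set P) ∧ s ∈ U ∧ ∀ t ∈ U, ¬ t ⋖ s

theorem sum_update [Fintype P] {A : Type*} [AddCommMonoid A] (f : Finset Marked → A)
    (σ : P → Finset Marked) (s : P) {S : Finset Marked} {c : A} (h : f S = c + f (σ s)) :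
    ∑ t, f (Function.update σ s S t) = c + ∑ t, f (σ t) := by
  rw [← Finset.add_sum_erase _ _ (Finset.mem_univ s),
    ← Finset.add_sum_erase _ (fun t => f (σ t)) (Finset.mem_univ s), Function.update_self, h,
    add_assoc]
  congr 2
  refine Finset.sum_congr rfl fun t ht => ?_
  rw [Function.update_of_ne (Finset.ne_of_mem_erase ht)]

variable [Fintype P]

theorem IsMinOf.isUpperSet_erase {s : P} {U : Finset P} (h : IsMinOf s U) :
    IsUpperSet ((U.erase s : Finset P) : Set P) := by
  intro t t' htt' ht
  rw [Finset.mem_coe, Finset.mem_erase] at ht ⊢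
  refine ⟨?_, h.1 htt' ht.2⟩
  rintro rfl
  obtain ⟨r, hr, hrt⟩ := exists_le_covBy_of_lt (lt_of_le_of_ne htt' ht.1)
  exact h.2.2 r (h.1 hr ht.2) hrt

theorem IsMinOf.not_lt {s t : P} {U : Finset P} (h : IsMinOf s U) (ht : t ∈ U) : ¬ t < s := by
  intro hts
  obtain ⟨r, hr, hrt⟩ := exists_le_covBy_of_lt hts
  exact h.2.2 r (h.1 hr ht) hrt

/-- The operator that inserts a letter into the box `s`. A state is the set of boxes which are still
to receive their largest letter. -/
noncomputable def boxOp (s : P) : Matrix (Finset P) (Finset P) ℤ[X] := fun U K =>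
  if IsMinOf s U then (if U.erase s = K then 1 else 0) + β * (if U = K then 1 else 0) else 0

theorem boxOp_mul_apply {κ : Type*} (s : P) (N : Matrix (Finset P) κ ℤ[X]) (U : Finset P)
    (j : κ) : (boxOp s * N) U j
      = if IsMinOf s U then N (U.erase s) j + β * N U j else 0 := by
  rw [Matrix.mul_apply]
  split_ifs with h
  · simp only [boxOp, if_pos h, add_mul, ite_mul, one_mul, zero_mul, Finset.sum_add_distrib,
      Finset.sum_ite_eq, Finset.mem_univ, if_true, mul_assoc, ← Finset.mul_sum]
  · simp only [boxOp, if_neg h, zero_mul, Finset.sum_const_zero]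

/-- Fillings of `U` which use only the letters in the list `T` of pairs (letter, box). -/
def fillings (γ : P → ℤ) (T : List (Marked × P)) (U : Finset P) : Set (P → Finset Marked) :=
  {σ | IsUpperSet (U : Set P) ∧ (∀ s, (σ s).Nonempty ↔ s ∈ U) ∧ (∀ s, ∀ k ∈ σ s, (k, s) ∈ T) ∧
    ∀ s t, s ⋖ t → ∀ k ∈ σ s, ∀ l ∈ σ t,
      k < l ∨ k = l ∧ (IsUnprimed k → γ s < γ t) ∧ (IsPrimed k → γ t < γ s)}

/-- The order in which letters are inserted. -/
def StepLE (γ : P → ℤ) (a b : Marked × P) : Prop :=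
  a.1 < b.1 ∨ a.1 = b.1 ∧ (IsUnprimed a.1 → γ a.2 ≤ γ b.2) ∧ (IsPrimed a.1 → γ b.2 ≤ γ a.2)

/-- Ensures that the truncated exponent of β in `fillSum` is a true difference. -/
theorem card_le_size {γ : P → ℤ} {T : List (Marked × P)} {U : Finset P} {σ : P → Finset Marked}
    (h : σ ∈ fillings γ T U) : U.card ≤ size σ := by
  have h1 : U.card = ∑ s : P, if s ∈ U then 1 else 0 := by simp
  rw [h1, size]
  refine Finset.sum_le_sum fun s _ => ?_
  split_ifs with hs
  · exact Finset.card_pos.2 ((h.2.1 s).2 hs)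
  · exact Nat.zero_le _

/-- The generating function of the fillings of weight `m`. -/
noncomputable def fillSum (γ : P → ℤ) (T : List (Marked × P)) (U : Finset P) (m : ℕ+ →₀ ℕ) :
    ℤ[X] :=
  ∑ᶠ σ ∈ {σ | σ ∈ fillings γ T U ∧ weight σ = m}, β ^ (size σ - U.card)

theorem weight_insert {σ : P → Finset Marked} {s : P} {k : Marked} (h : k ∉ σ s) :
    weight (Function.update σ s (insert k (σ s))) = Finsupp.single (absVal k) 1 + weight σ :=
  sum_update (fun S => ∑ x ∈ S, Finsupp.single (absVal x) 1) σ s (Finset.sum_insert h)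

theorem size_insert {σ : P → Finset Marked} {s : P} {k : Marked} (h : k ∉ σ s) :
    size (Function.update σ s (insert k (σ s))) = 1 + size σ :=
  sum_update Finset.card σ s (by rw [Finset.card_insert_of_notMem h, add_comm])

theorem not_isPrimed_and {k : Marked} (h1 : IsPrimed k) (h2 : IsUnprimed k) : False := by
  rw [IsPrimed] at h1
  rw [IsUnprimed, h1] at h2
  exact Bool.false_ne_true h2

theorem isPrimed_or (k : Marked) : IsPrimed k ∨ IsUnprimed k := by
  rw [IsPrimed, IsUnprimed]
  cases (ofLex k).2 <;> simp

variable {γ : P → ℤ} {T : List (Marked × P)} {k : Marked} {s : P} {U : Finset P}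

/-- A pending box t covered by s would hold a letter at most k. Since (k, s) is the first step, that
letter equals k, and then the marks and labels would place the step (k, t) before (k, s). -/
theorem isMinOf_of_mem (hT : ∀ b ∈ T, StepLE γ (k, s) b) {σ : P → Finset Marked}
    (hσ : σ ∈ fillings γ ((k, s) :: T) U) (hk : k ∈ σ s) : IsMinOf s U := by
  obtain ⟨h1, h2, h3, h4⟩ := hσ
  refine ⟨h1, (h2 s).1 ⟨k, hk⟩, fun t ht hts => ?_⟩
  obtain ⟨l, hl⟩ := (h2 t).2 ht
  have h5 : (l, t) ∈ T := by
    refine (List.mem_cons.1 (h3 t l hl)).resolve_left fun h => hts.lt.ne ?_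
    exact congrArg Prod.snd h
  have h6 := hT _ h5
  rw [StepLE] at h6
  simp only at h6
  rcases h4 t s hts l hl k hk with h7 | ⟨rfl, h7, h8⟩
  · rcases h6 with h6 | ⟨h6, -⟩
    · exact lt_asymm h6 h7
    · exact h7.ne' h6
  · rcases h6 with h6 | ⟨-, h6, h6'⟩
    · exact lt_irrefl _ h6
    · rcases isPrimed_or l with h9 | h9
      · exact absurd (h6' h9) (h8 h9).not_ge
      · exact absurd (h6 h9) (h7 h9).not_ge

/-- The condition `insert s U' = U` treats two cases at once: U' = U, where s receives further
letters, and U' = U ∖ {s}, where k is its only remaining letter. -/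
theorem insert_mem_fillings (hγ : ∀ s t, s ⋖ t → γ s ≠ γ t) (hT : ∀ b ∈ T, StepLE γ (k, s) b)
    (hU : IsMinOf s U) {U' : Finset P} (hU' : insert s U' = U) {σ : P → Finset Marked}
    (hσ : σ ∈ fillings γ T U') :
    Function.update σ s (insert k (σ s)) ∈ fillings γ ((k, s) :: T) U := by
  obtain ⟨h1, h2, h3, h4⟩ := hσ
  have hmem : ∀ t l, l ∈ Function.update σ s (insert k (σ s)) t → (l = k ∧ t = s) ∨ l ∈ σ t := by
    intro t l hl
    by_cases ht : t = s
    · subst ht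
      rw [Function.update_self, Finset.mem_insert] at hl
      exact hl.imp (fun h => ⟨h, rfl⟩) id
    · rw [Function.update_of_ne ht] at hl
      exact Or.inr hl
  refine ⟨hU.1, fun t => ?_, fun t l hl => ?_, fun t t' htt' l hl l' hl' => ?_⟩
  · rw [← hU', Finset.mem_insert]
    by_cases ht : t = s
    · subst ht
      rw [Function.update_self]
      simp
    · rw [Function.update_of_ne ht, h2]
      simp [ht]
  · rcases hmem t l hl with ⟨rfl, rfl⟩ | h
    · exact List.mem_cons_self
    · exact List.mem_cons_of_mem _ (h3 t l h)
  · rcases hmem t' l' hl' with ⟨rfl, rfl⟩ | h'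
    · refine absurd htt' (hU.2.2 t ?_)
      rcases hmem t l hl with ⟨rfl, rfl⟩ | h
      · exact hU.2.1
      · rw [← hU']
        exact Finset.mem_insert_of_mem ((h2 t).1 ⟨l, h⟩)
    · rcases hmem t l hl with ⟨rfl, rfl⟩ | h
      · rcases hT _ (h3 t' l' h') with h5 | ⟨h5, h6, h7⟩
        · exact Or.inl h5
        · exact Or.inr ⟨h5, fun hp => lt_of_le_of_ne (h6 hp) (hγ _ _ htt'),
            fun hp => lt_of_le_of_ne (h7 hp) (hγ _ _ htt').symm⟩
      · exact h4 t t' htt' l h l' h'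

theorem erase_mem_fillings {U' : Finset P} (hu : IsUpperSet (U' : Set P)) {σ : P → Finset Marked}
    (hσ : σ ∈ fillings γ ((k, s) :: T) U)
    (hU' : ∀ t, (Function.update σ s ((σ s).erase k) t).Nonempty ↔ t ∈ U') :
    Function.update σ s ((σ s).erase k) ∈ fillings γ T U' := by
  obtain ⟨h1, h2, h3, h4⟩ := hσ
  have hmem : ∀ t l, l ∈ Function.update σ s ((σ s).erase k) t → (l, t) ≠ (k, s) ∧ l ∈ σ t := by
    intro t l hl
    by_cases ht : t = s
    · subst ht
      rw [Function.update_self, Finset.mem_erase] at hl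
      exact ⟨fun h => hl.1 (congrArg Prod.fst h), hl.2⟩
    · rw [Function.update_of_ne ht] at hl
      exact ⟨fun h => ht (congrArg Prod.snd h), hl⟩
  refine ⟨hu, hU', fun t l hl => ?_, fun t t' htt' l hl l' hl' => ?_⟩
  · obtain ⟨h5, h6⟩ := hmem t l hl
    exact (List.mem_cons.1 (h3 t l h6)).resolve_left h5
  · exact h4 t t' htt' l (hmem _ _ hl).2 l' (hmem _ _ hl').2

theorem notMem_of_fillings (hs : (k, s) ∉ T) {σ : P → Finset Marked}
    (hσ : σ ∈ fillings γ T U) : k ∉ σ s := fun h => hs (hσ.2.2.1 s k h)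

/-- Either the first step is not used, or k is the smallest letter of s. In the latter case k is
removed, and the two outcomes are the two terms of `boxOp s`. -/
theorem fillSum_cons (hγ : ∀ s t, s ⋖ t → γ s ≠ γ t) (hT : ∀ b ∈ T, StepLE γ (k, s) b)
    (hs : (k, s) ∉ T) (U : Finset P) (m : ℕ+ →₀ ℕ) :
    fillSum γ ((k, s) :: T) U m = fillSum γ T U m +
      if 0 < m (absVal k) then
        if IsMinOf s U then fillSum γ T (U.erase s) (m - Finsupp.single (absVal k) 1)
          + β * fillSum γ T U (m - Finsupp.single (absVal k) 1) else 0
      else 0 := by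
  have hrem : ∀ σ : P → Finset Marked, k ∈ σ s → Function.update (Function.update σ s
      ((σ s).erase k)) s (insert k (Function.update σ s ((σ s).erase k) s)) = σ := by
    intro σ h
    rw [Function.update_self, Function.update_idem, Finset.insert_erase h,
      Function.update_eq_self]
  have hins : ∀ σ : P → Finset Marked, k ∉ σ s → Function.update (Function.update σ s
      (insert k (σ s))) s ((Function.update σ s (insert k (σ s)) s).erase k) = σ := by
    intro σ h
    rw [Function.update_self, Function.update_idem, Finset.erase_insert h,
      Function.update_eq_self]
  have hsplit : {σ | σ ∈ fillings γ ((k, s) :: T) U ∧ weight σ = m}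
      = {σ | σ ∈ fillings γ T U ∧ weight σ = m} ∪
        {σ | (σ ∈ fillings γ ((k, s) :: T) U ∧ weight σ = m) ∧ k ∈ σ s} := by
    ext σ
    simp only [Set.mem_union, Set.mem_ofPred_eq]
    constructor
    · rintro ⟨h1, h2⟩
      by_cases hk : k ∈ σ s
      · exact Or.inr ⟨⟨h1, h2⟩, hk⟩
      · refine Or.inl ⟨?_, h2⟩
        have h3 : Function.update σ s ((σ s).erase k) = σ := by
          rw [Finset.erase_eq_of_notMem hk, Function.update_eq_self]
        have := erase_mem_fillings (k := k) (s := s) h1.1 h1 (by rw [h3]; exact h1.2.1)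
        rwa [h3] at this
    · rintro (⟨h1, h2⟩ | ⟨h1, -⟩)
      · exact ⟨⟨h1.1, h1.2.1, fun t l hl => List.mem_cons_of_mem _ (h1.2.2.1 t l hl), h1.2.2.2⟩, h2⟩
      · exact h1
  have hfin : ∀ S : Set (P → Finset Marked), (∀ σ ∈ S, weight σ = m) → S.Finite := fun S hS =>
    (finite_weight m).subset hS
  rw [fillSum, hsplit, finsum_mem_union _ (hfin _ fun σ h => h.2) (hfin _ fun σ h => h.1.2)]
  swap
  · rw [Set.disjoint_left]
    rintro σ ⟨h1, -⟩ ⟨-, h2⟩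
    exact notMem_of_fillings hs h1 h2
  congr 1
  split_ifs with hm hU
  · have hw : ∀ σ : P → Finset Marked, k ∉ σ s →
        (weight (Function.update σ s (insert k (σ s))) = m ↔
          weight σ = m - Finsupp.single (absVal k) 1) := by
      intro σ h
      have hle : Finsupp.single (absVal k) 1 ≤ m := Finsupp.single_le_iff.2 hm
      rw [weight_insert h]
      exact ⟨fun h => by rw [← h, add_tsub_cancel_left], fun h => by
        rw [h, add_tsub_cancel_of_le hle]⟩
    have hsplit2 : {σ | (σ ∈ fillings γ ((k, s) :: T) U ∧ weight σ = m) ∧ k ∈ σ s}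
        = {σ | (σ ∈ fillings γ ((k, s) :: T) U ∧ weight σ = m) ∧ σ s = {k}} ∪
        {σ | (σ ∈ fillings γ ((k, s) :: T) U ∧ weight σ = m) ∧ k ∈ σ s ∧ σ s ≠ {k}} := by
      ext σ
      simp only [Set.mem_union, Set.mem_ofPred_eq]
      constructor
      · rintro ⟨h1, h2⟩
        by_cases h3 : σ s = {k}
        · exact Or.inl ⟨h1, h3⟩
        · exact Or.inr ⟨h1, h2, h3⟩
      · rintro (⟨h1, h2⟩ | ⟨h1, h2, -⟩)
        · exact ⟨h1, by rw [h2]; exact Finset.mem_singleton_self k⟩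
        · exact ⟨h1, h2⟩
    rw [hsplit2, finsum_mem_union _ (hfin _ fun σ h => h.1.2) (hfin _ fun σ h => h.1.2)]
    swap
    · rw [Set.disjoint_left]
      rintro σ ⟨-, h1⟩ ⟨-, -, h2⟩
      exact h2 h1
    have hcard : 0 < U.card := Finset.card_pos.2 ⟨s, hU.2.1⟩
    congr 1
    -- If k is the only letter of s, its removal lowers both the size and the number of boxes by
    -- one: no factor β.
    · symm
      refine finsum_mem_eq_of_bijOn (fun σ => Function.update σ s (insert k (σ s))) ?_ ?_
      · refine Set.InvOn.bijOn (f' := fun σ => Function.update σ s ((σ s).erase k)) ⟨?_, ?_⟩ ?_ ?_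
        · rintro σ ⟨h1, -⟩
          exact hins σ (notMem_of_fillings hs h1)
        · rintro σ ⟨-, h1⟩
          exact hrem σ (by rw [h1]; exact Finset.mem_singleton_self k)
        · rintro σ ⟨h1, h2⟩
          have hk := notMem_of_fillings hs h1
          refine ⟨⟨insert_mem_fillings hγ hT hU (Finset.insert_erase hU.2.1) h1,
            (hw σ hk).2 h2⟩, ?_⟩
          have h3 : σ s = ∅ := Finset.not_nonempty_iff_eq_empty.1 fun h =>
            Finset.notMem_erase s U ((h1.2.1 s).1 h)
          simp only [Function.update_self, h3]
          rfl
        · rintro σ ⟨⟨h1, h2⟩, h3⟩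
          have hk : k ∈ σ s := by rw [h3]; exact Finset.mem_singleton_self k
          refine ⟨erase_mem_fillings hU.isUpperSet_erase h1 fun t => ?_, ?_⟩
          · by_cases ht : t = s
            · subst ht
              rw [Function.update_self, h3]
              simp
            · rw [Function.update_of_ne ht, h1.2.1, Finset.mem_erase]
              simp [ht]
          · rw [← hw, hrem σ hk]
            · exact h2
            · simp only [Function.update_self]
              exact Finset.notMem_erase _ _
      · rintro σ ⟨h1, -⟩
        rw [size_insert (notMem_of_fillings hs h1), Finset.card_erase_of_mem hU.2.1]
        have := card_le_size h1
        rw [Finset.card_erase_of_mem hU.2.1] at this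
        congr 1
        omega
    -- If s has further letters, only the size drops, which accounts for the factor β.
    · rw [fillSum, mul_finsum_mem]
      symm
      refine finsum_mem_eq_of_bijOn (fun σ => Function.update σ s (insert k (σ s))) ?_ ?_
      · refine Set.InvOn.bijOn (f' := fun σ => Function.update σ s ((σ s).erase k)) ⟨?_, ?_⟩ ?_ ?_
        · rintro σ ⟨h1, -⟩
          exact hins σ (notMem_of_fillings hs h1)
        · rintro σ ⟨-, h1, -⟩
          exact hrem σ h1
        · rintro σ ⟨h1, h2⟩
          have hk := notMem_of_fillings hs h1
          refine ⟨⟨insert_mem_fillings hγ hT hU (Finset.insert_eq_of_mem hU.2.1) h1,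
            (hw σ hk).2 h2⟩, ?_, ?_⟩
          · simp only [Function.update_self]
            exact Finset.mem_insert_self _ _
          · simp only [Function.update_self]
            intro h
            obtain ⟨l, hl⟩ := (h1.2.1 s).2 hU.2.1
            have h4 : l ∈ insert k (σ s) := Finset.mem_insert_of_mem hl
            rw [h, Finset.mem_singleton] at h4
            exact hk (h4 ▸ hl)
        · rintro σ ⟨⟨h1, h2⟩, hk, h3⟩
          refine ⟨erase_mem_fillings h1.1 h1 fun t => ?_, ?_⟩
          · by_cases ht : t = s
            · subst ht
              rw [Function.update_self]
              refine iff_of_true ?_ hU.2.1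
              rw [Finset.nonempty_iff_ne_empty, ne_eq, Finset.erase_eq_empty_iff]
              rintro (h | h)
              · rw [h] at hk
                simp at hk
              · exact h3 h
            · rw [Function.update_of_ne ht, h1.2.1]
          · rw [← hw, hrem σ hk]
            · exact h2
            · simp only [Function.update_self]
              exact Finset.notMem_erase _ _
      · rintro σ ⟨h1, -⟩
        rw [size_insert (notMem_of_fillings hs h1), ← pow_succ']
        have := card_le_size h1
        congr 1
        omega
  · rw [finsum_mem_eq_zero_of_forall_eq_zero]
    rintro σ ⟨⟨h1, -⟩, h2⟩
    exact absurd (isMinOf_of_mem hT h1 h2) hU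
  · rw [finsum_mem_eq_zero_of_forall_eq_zero]
    rintro σ ⟨⟨-, h1⟩, h2⟩
    refine absurd (Nat.pos_of_ne_zero (Finsupp.mem_support_iff.1 ?_)) hm
    rw [← h1]
    exact mem_support_weight.2 ⟨s, k, h2, rfl⟩

end Operators

/-! ### Transfer matrices: the insertions of one number grouped into a polynomial -/

section Letters

open scoped Classical

set_option linter.unusedSectionVars false

variable {P : Type*} [PartialOrder P] [Fintype P]

/-- Square matrices indexed by subsets of `P`. -/
abbrev StateMatrix (P : Type*) : Type _ := Matrix (Finset P) (Finset P) ℤ[X]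

/-- The product of the factors `1 + x u_s` over the boxes `s` in the list `L`. -/
noncomputable def boxPoly (L : List P) : (StateMatrix P)[X] :=
  (L.map fun s => 1 + Polynomial.C (boxOp s) * Polynomial.X).prod

theorem boxPoly_nil : boxPoly ([] : List P) = 1 := rfl

theorem boxPoly_cons (s : P) (L : List P) :
    boxPoly (s :: L) = (1 + Polynomial.C (boxOp s) * Polynomial.X) * boxPoly L := rfl

theorem boxPoly_append (L L' : List P) : boxPoly (L ++ L') = boxPoly L * boxPoly L' := by
  simp [boxPoly]

theorem boxPoly_coeff_zero (L : List P) : (boxPoly L).coeff 0 = 1 := by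
  induction L with
  | nil => simp [boxPoly_nil]
  | cons s L ih =>
    rw [boxPoly_cons, Polynomial.mul_coeff_zero, ih]
    simp

theorem boxPoly_cons_coeff_succ (s : P) (L : List P) (a : ℕ) :
    (boxPoly (s :: L)).coeff (a + 1)
      = (boxPoly L).coeff (a + 1) + boxOp s * (boxPoly L).coeff a := by
  rw [boxPoly_cons, add_mul, one_mul, mul_assoc, Polynomial.X_mul, Polynomial.coeff_add,
    Polynomial.coeff_C_mul, Polynomial.coeff_mul_X]

theorem fillSum_eq_zero {γ : P → ℤ} {T : List (Marked × P)} {U : Finset P} {m : ℕ+ →₀ ℕ} {i : ℕ+}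
    (hT : ∀ b ∈ T, absVal b.1 ≠ i) (hm : m i ≠ 0) : fillSum γ T U m = 0 := by
  rw [fillSum]
  refine finsum_mem_eq_zero_of_forall_eq_zero ?_
  rintro σ ⟨h1, rfl⟩
  obtain ⟨s, x, hx, h⟩ := mem_support_weight.1 (Finsupp.mem_support_iff.2 hm)
  exact absurd h (hT _ (h1.2.2.1 s x hx))

/-- All steps in L insert the number i and none in T does, so exactly m i of the steps in L are
used; this selects the coefficient of x^{m i} in the product of the factors 1 + x u_s. -/
theorem fillSum_append {γ : P → ℤ} (hγ : ∀ s t, s ⋖ t → γ s ≠ γ t) {i : ℕ+}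
    {T : List (Marked × P)} (hT : ∀ b ∈ T, absVal b.1 ≠ i) (L : List (Marked × P))
    (hL : ∀ b ∈ L, absVal b.1 = i) (hs : (L ++ T).Pairwise (StepLE γ)) (hn : (L ++ T).Nodup)
    (U : Finset P) (m : ℕ+ →₀ ℕ) :
    fillSum γ (L ++ T) U m = ((boxPoly (L.map Prod.snd)).coeff (m i)).mulVec
      (fun K => fillSum γ T K (m.erase i)) U := by
  induction L generalizing U m with
  | nil =>
    rw [List.nil_append, List.map_nil, boxPoly_nil, Polynomial.coeff_one]
    split_ifs with h
    · rw [Matrix.one_mulVec, Finsupp.erase_of_notMem_support]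
      simp [h]
    · rw [Matrix.zero_mulVec, fillSum_eq_zero hT h]
      rfl
  | cons b L ih =>
    obtain ⟨k, s⟩ := b
    rw [List.cons_append, List.pairwise_cons] at hs
    rw [List.cons_append, List.nodup_cons] at hn
    have hk : absVal k = i := hL (k, s) List.mem_cons_self
    have ih' := ih (fun b hb => hL b (List.mem_cons_of_mem _ hb)) hs.2 hn.2
    rw [List.cons_append, fillSum_cons hγ hs.1 hn.1, hk, List.map_cons, ih' U m]
    rcases Nat.eq_zero_or_pos (m i) with h0 | h0
    · rw [h0, boxPoly_coeff_zero, boxPoly_coeff_zero, if_neg (lt_irrefl _), add_zero]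
    · rw [if_pos h0]
      obtain ⟨a, ha⟩ : ∃ a, m i = a + 1 := ⟨m i - 1, by omega⟩
      have herase : (m - Finsupp.single i 1).erase i = m.erase i := by
        ext j
        by_cases hj : j = i
        · subst hj; simp
        · rw [Finsupp.erase_ne hj, Finsupp.erase_ne hj, Finsupp.tsub_apply,
            Finsupp.single_eq_of_ne hj, Nat.sub_zero]
      have hsub : (m - Finsupp.single i 1 : ℕ+ →₀ ℕ) i = a := by
        rw [Finsupp.tsub_apply, Finsupp.single_eq_same, ha, Nat.add_sub_cancel]
      rw [ih', ih', herase, hsub, ha, boxPoly_cons_coeff_succ, Matrix.add_mulVec, Pi.add_apply]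
      congr 1
      simp only [Matrix.mulVec, dotProduct, boxOp_mul_apply]
      split_ifs
      · simp only [add_mul, Finset.sum_add_distrib, mul_assoc, Finset.mul_sum]
      · simp

/-- The boxes in the order in which they receive a given number, first with and then without a
prime. -/
noncomputable def boxOrder (l : List P) (V : Set P) : List P :=
  (l.reverse.filter fun s => s ∉ V) ++ l

/-- The steps in which the numbers `i'` and `i` are inserted. -/
noncomputable def letterSteps (l : List P) (V : Set P) (i : ℕ+) : List (Marked × P) :=
  ((l.reverse.filter fun s => s ∉ V).map fun s => (toLex (i, false), s)) ++
    l.map fun s => (toLex (i, true), s)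

theorem letterSteps_snd (l : List P) (V : Set P) (i : ℕ+) :
    (letterSteps l V i).map Prod.snd = boxOrder l V := by
  simp [letterSteps, boxOrder, Function.comp_def]

theorem mem_letterSteps {l : List P} {V : Set P} {i : ℕ+} {b : Marked × P} :
    b ∈ letterSteps l V i ↔ absVal b.1 = i ∧ b.2 ∈ l ∧ (b.2 ∈ V → IsUnprimed b.1) := by
  obtain ⟨k, s⟩ := b
  simp only [letterSteps, List.mem_append, List.mem_map, List.mem_filter, List.mem_reverse,
    decide_eq_true_eq, absVal, IsUnprimed]
  constructor
  · rintro (⟨a, ⟨h1, h2⟩, h3⟩ | ⟨a, h1, h3⟩) <;> obtain ⟨rfl, rfl⟩ := Prod.mk.inj h3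
    · exact ⟨rfl, h1, fun h => absurd h h2⟩
    · exact ⟨rfl, h1, fun _ => rfl⟩
  · rintro ⟨rfl, h1, h2⟩
    rcases isPrimed_or k with h | h
    · left
      refine ⟨s, ⟨h1, fun h3 => not_isPrimed_and h (h2 h3)⟩, ?_⟩
      rw [← h]
      rfl
    · right
      refine ⟨s, h1, ?_⟩
      rw [← h]
      rfl

theorem nodup_letterSteps {l : List P} (hl : l.Nodup) (V : Set P) (i : ℕ+) :
    (letterSteps l V i).Nodup := by
  rw [letterSteps, List.nodup_append]
  refine ⟨((List.nodup_reverse.2 hl).filter _).map fun a b h => congrArg Prod.snd h,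
    hl.map fun a b h => congrArg Prod.snd h, ?_⟩
  intro a ha b hb hab
  obtain ⟨s, -, rfl⟩ := List.mem_map.1 ha
  obtain ⟨t, -, rfl⟩ := List.mem_map.1 hb
  have h : false = true := congrArg (fun x : Marked × P => (ofLex x.1).2) hab
  exact Bool.false_ne_true h

/-- A repeated unprimed letter goes up along increasing labels and a repeated primed letter along
decreasing ones; hence the reversed list for primed letters. -/
theorem pairwise_letterSteps {γ : P → ℤ} {l : List P} (hl : l.Pairwise fun s t => γ s ≤ γ t)
    (V : Set P) (i : ℕ+) : (letterSteps l V i).Pairwise (StepLE γ) := by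
  rw [letterSteps, List.pairwise_append, List.pairwise_map, List.pairwise_map]
  refine ⟨?_, ?_, ?_⟩
  · refine List.Pairwise.filter _ (List.pairwise_reverse.2 (hl.imp ?_))
    intro s t hst
    exact Or.inr ⟨rfl, fun h => absurd h Bool.false_ne_true, fun _ => hst⟩
  · refine hl.imp ?_
    intro s t hst
    exact Or.inr ⟨rfl, fun _ => hst, fun h => absurd h.symm Bool.false_ne_true⟩
  · intro a ha b hb
    obtain ⟨s, -, rfl⟩ := List.mem_map.1 ha
    obtain ⟨t, -, rfl⟩ := List.mem_map.1 hb
    left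
    rw [Prod.Lex.lt_iff]
    exact Or.inr ⟨rfl, Bool.false_lt_true⟩

theorem lt_of_absVal_lt {k l : Marked} (h : absVal k < absVal l) : k < l := by
  rw [Prod.Lex.lt_iff]
  exact Or.inl h

theorem nodup_steps {l : List P} (hl : l.Nodup) (V : Set P) {ls : List ℕ+}
    (hls : ls.Pairwise (· < ·)) : (ls.flatMap (letterSteps l V)).Nodup := by
  rw [List.nodup_flatMap]
  refine ⟨fun i _ => nodup_letterSteps hl V i, hls.imp fun {i j} hij => ?_⟩
  intro b hb hb'
  exact hij.ne ((mem_letterSteps.1 hb).1.symm.trans (mem_letterSteps.1 hb').1)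

theorem pairwise_steps {γ : P → ℤ} {l : List P} (hl : l.Pairwise fun s t => γ s ≤ γ t) (V : Set P)
    {ls : List ℕ+} (hls : ls.Pairwise (· < ·)) :
    (ls.flatMap (letterSteps l V)).Pairwise (StepLE γ) := by
  rw [List.pairwise_flatMap]
  refine ⟨fun i _ => pairwise_letterSteps hl V i, hls.imp fun {i j} hij => ?_⟩
  intro b hb b' hb'
  left
  refine lt_of_absVal_lt ?_
  rwa [(mem_letterSteps.1 hb).1, (mem_letterSteps.1 hb').1]

theorem fillSum_nil (γ : P → ℤ) (U : Finset P) : fillSum γ [] U 0 = if U = ∅ then 1 else 0 := by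
  have hw : weight (fun _ : P => (∅ : Finset Marked)) = 0 := by simp [weight]
  have hz : ∀ σ ∈ fillings γ [] U, σ = fun _ => ∅ := by
    intro σ h
    funext s
    exact Finset.eq_empty_of_forall_notMem fun k hk => List.not_mem_nil (h.2.2.1 s k hk)
  rw [fillSum]
  split_ifs with hU
  · subst hU
    rw [show {σ | σ ∈ fillings γ [] ∅ ∧ weight σ = 0} = {fun _ => ∅} from ?_, finsum_mem_singleton]
    · simp [size]
    · ext σ
      rw [Set.mem_singleton_iff]
      refine ⟨fun h => hz σ h.1, ?_⟩
      rintro rfl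
      refine ⟨⟨?_, ?_, ?_, ?_⟩, hw⟩ <;> simp [isUpperSet_empty]
  · refine finsum_mem_eq_zero_of_forall_eq_zero ?_
    rintro σ ⟨h, -⟩
    refine absurd ?_ hU
    refine Finset.eq_empty_of_forall_notMem fun s hs => ?_
    have h1 := (h.2.1 s).2 hs
    rw [hz σ h] at h1
    exact Finset.not_nonempty_empty h1

/-- The row records that the boxes of U are pending at the start, the column ∅ that none is pending
at the end. Numbers in `ls` of exponent zero are harmless, since the constant term of `boxPoly` is
1. -/
theorem fillSum_steps {γ : P → ℤ} (hγ : ∀ s t, s ⋖ t → γ s ≠ γ t) {l : List P} (hn : l.Nodup)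
    (hl : l.Pairwise fun s t => γ s ≤ γ t) (V : Set P) {ls : List ℕ+} (hls : ls.Pairwise (· < ·))
    (U : Finset P) {m : ℕ+ →₀ ℕ} (hm : ∀ i ∈ m.support, i ∈ ls) :
    fillSum γ (ls.flatMap (letterSteps l V)) U m
      = (ls.map fun i => (boxPoly (boxOrder l V)).coeff (m i)).prod U ∅ := by
  induction ls generalizing U m with
  | nil =>
    have h0 : m = 0 := by
      rw [← Finsupp.support_eq_empty]
      exact Finset.eq_empty_of_forall_notMem fun i hi => List.not_mem_nil (hm i hi)
    subst h0
    rw [List.flatMap_nil, fillSum_nil, List.map_nil, List.prod_nil, Matrix.one_apply]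
  | cons i ls ih =>
    have hp := pairwise_steps hl V hls
    have hd := nodup_steps hn V hls
    rw [List.pairwise_cons] at hls
    rw [List.flatMap_cons] at hp hd ⊢
    rw [fillSum_append hγ (i := i) ?_ _ (fun b hb => (mem_letterSteps.1 hb).1) hp hd,
      letterSteps_snd, List.map_cons, List.prod_cons, Matrix.mul_apply]
    · simp only [Matrix.mulVec, dotProduct]
      refine Finset.sum_congr rfl fun K _ => ?_
      rw [ih hls.2]
      · congr 2
        rw [List.map_congr_left]
        intro j hj
        rw [Finsupp.erase_ne (hls.1 j hj).ne']
      · intro j hj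
        rw [Finsupp.support_erase, Finset.mem_erase] at hj
        exact (List.mem_cons.1 (hm j hj.2)).resolve_left hj.1
    · intro b hb
      obtain ⟨j, hj, hb⟩ := List.mem_flatMap.1 hb
      rw [(mem_letterSteps.1 hb).1]
      exact (hls.1 j hj).ne'

/-- Coefficients of `Ω(P, γ, V)` as matrix entries. -/
theorem coeff_OmegaV {γ : P → ℤ} (hγ : ∀ s t, s ⋖ t → γ s ≠ γ t) {l : List P} (hn : l.Nodup)
    (hl : l.Pairwise fun s t => γ s ≤ γ t) (hc : ∀ s, s ∈ l) (V : Set P) {ls : List ℕ+}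
    (hls : ls.Pairwise (· < ·)) {m : ℕ+ →₀ ℕ} (hm : ∀ i ∈ m.support, i ∈ ls) :
    MvPowerSeries.coeff m (OmegaV γ V : Series)
      = (ls.map fun i => (boxPoly (boxOrder l V)).coeff (m i)).prod Finset.univ ∅ := by
  rw [← fillSum_steps hγ hn hl V hls Finset.univ hm, fillSum]
  change (∑ᶠ σ ∈ {σ | σ ∈ enriched γ V ∧ weight σ = m}, β ^ (size σ - Fintype.card P)) = _
  rw [show {σ | σ ∈ enriched γ V ∧ weight σ = m} = {σ | σ ∈ fillings γ (ls.flatMap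
    (letterSteps l V)) Finset.univ ∧ weight σ = m} from ?_]
  · rfl
  ext σ
  refine and_congr_left ?_
  rintro rfl
  constructor
  · rintro ⟨h1, h2, h3⟩
    refine ⟨?_, fun s => by simpa using h1 s, fun s k hk => ?_, fun s t hst k hk l hl => ?_⟩
    · rw [Finset.coe_univ]
      exact isUpperSet_univ
    · refine List.mem_flatMap.2 ⟨absVal k, hm _ (mem_support_weight.2 ⟨s, k, hk, rfl⟩),
        mem_letterSteps.2 ⟨rfl, hc s, fun hs => h3 s hs k hk⟩⟩
    · obtain ⟨h4, h5, h6⟩ := h2 s t hst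
      rcases (h4 k hk l hl).lt_or_eq with h | rfl
      · exact Or.inl h
      · refine Or.inr ⟨rfl, fun hp => ?_, fun hp => ?_⟩
        · refine lt_of_le_of_ne (not_lt.1 fun h => ?_) (hγ s t hst)
          exact not_isPrimed_and (h6 h k hk hl) hp
        · refine lt_of_le_of_ne (not_lt.1 fun h => ?_) (hγ s t hst).symm
          exact not_isPrimed_and hp (h5 h k hk hl)
  · rintro ⟨-, h1, h2, h3⟩
    refine ⟨fun s => (h1 s).2 (Finset.mem_univ s), fun s t hst => ⟨fun k hk l hl => ?_,
      fun h k hk hl => ?_, fun h k hk hl => ?_⟩, fun v hv k hk => ?_⟩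
    · rcases h3 s t hst k hk l hl with h | ⟨h, -⟩
      · exact h.le
      · exact h.le
    · refine (isPrimed_or k).resolve_left fun hp => ?_
      rcases h3 s t hst k hk k hl with h4 | ⟨-, -, h4⟩
      · exact lt_irrefl _ h4
      · exact lt_asymm h (h4 hp)
    · refine (isPrimed_or k).resolve_right fun hp => ?_
      rcases h3 s t hst k hk k hl with h4 | ⟨-, h4, -⟩
      · exact lt_irrefl _ h4
      · exact lt_asymm h (h4 hp)
    · obtain ⟨i, -, hi⟩ := List.mem_flatMap.1 (h2 v k hk)
      exact (mem_letterSteps.1 hi).2.2 hv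

theorem exists_sorted_list (γ : P → ℤ) :
    ∃ l : List P, l.Nodup ∧ (l.Pairwise fun s t => γ s ≤ γ t) ∧ ∀ s, s ∈ l := by
  refine ⟨Finset.univ.toList.mergeSort fun s t => γ s ≤ γ t, ?_, ?_, ?_⟩
  · exact (List.mergeSort_perm _ _).nodup_iff.2 (Finset.nodup_toList _)
  · have := List.pairwise_mergeSort (le := fun s t : P => decide (γ s ≤ γ t))
      (by simp only [decide_eq_true_eq]; exact fun a b c => le_trans)
      (by simp only [Bool.or_eq_true, decide_eq_true_eq]; exact fun a b => le_total _ _)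
      Finset.univ.toList
    simpa using this
  · intro s
    rw [List.mem_mergeSort]
    simp

end Letters

/-! ### The substitution `x ↦ x / (1 - β x)` in products of one-variable series -/

/-- The univariate power series `x / (1 - β x)`. -/
noncomputable def geomSeries : PowerSeries ℤ[X] :=
  PowerSeries.X * PowerSeries.mk fun a => β ^ a

theorem geomSeries_mul :
    geomSeries * (1 - PowerSeries.C β * PowerSeries.X) = PowerSeries.X := by
  have h : (PowerSeries.mk fun a => β ^ a) * (1 - PowerSeries.C β * PowerSeries.X) = 1 := by
    ext1 a
    rw [mul_sub, mul_one, map_sub, mul_left_comm, PowerSeries.coeff_C_mul]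
    cases a with
    | zero => simp
    | succ a =>
      rw [PowerSeries.coeff_succ_mul_X, PowerSeries.coeff_mk, PowerSeries.coeff_mk,
        PowerSeries.coeff_one, if_neg a.succ_ne_zero, pow_succ', sub_self]
  rw [geomSeries, mul_assoc, h, mul_one]

theorem coeff_geomSeries_pow_of_lt {a b : ℕ} (h : a < b) :
    PowerSeries.coeff a (geomSeries ^ b) = 0 := by
  rw [geomSeries, mul_pow, PowerSeries.coeff_X_pow_mul', if_neg (by omega)]

/-- Both sides solve y (1 - β x_i) = x_i, and power series over ℤ[β] form a domain. -/
theorem geom_eq_subst (i : ℕ+) :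
    geom i = PowerSeries.subst (MvPowerSeries.X i : Series) geomSeries := by
  have hX : PowerSeries.HasSubst (MvPowerSeries.X i : Series) := PowerSeries.HasSubst.X i
  have h1 := congrArg (PowerSeries.subst (MvPowerSeries.X i : Series)) geomSeries_mul
  rw [PowerSeries.subst_mul hX, PowerSeries.subst_X hX] at h1
  have h2 : PowerSeries.subst (MvPowerSeries.X i : Series)
      (1 - PowerSeries.C β * PowerSeries.X : PowerSeries ℤ[X])
      = 1 - MvPowerSeries.C β * MvPowerSeries.X i := by
    rw [← PowerSeries.smul_eq_C_mul, PowerSeries.subst_sub hX, PowerSeries.subst_smul hX,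
      PowerSeries.subst_X hX, ← PowerSeries.coe_substAlgHom hX, map_one,
      ← MvPowerSeries.smul_eq_C_mul]
  rw [h2] at h1
  have h3 : (1 - MvPowerSeries.C β * MvPowerSeries.X i : Series) ≠ 0 := by
    intro h
    have := congrArg MvPowerSeries.constantCoeff h
    simp at this
  exact mul_right_cancel₀ h3 ((geom_mul i).trans h1.symm)

theorem coeff_prod_subst_X (S : Finset ℕ+) (φ : ℕ+ → PowerSeries ℤ[X]) (m : ℕ+ →₀ ℕ) :
    MvPowerSeries.coeff m (∏ i ∈ S, PowerSeries.subst (MvPowerSeries.X i : Series) (φ i))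
      = if m.support ⊆ S then ∏ i ∈ S, PowerSeries.coeff (m i) (φ i) else 0 := by
  classical
  induction S using Finset.induction_on generalizing m with
  | empty =>
    rw [Finset.prod_empty, Finset.prod_empty, MvPowerSeries.coeff_one]
    simp only [Finset.subset_empty, Finsupp.support_eq_empty]
  | insert j S hj ih =>
    rw [Finset.prod_insert hj, MvPowerSeries.coeff_mul,
      Finset.sum_eq_single (Finsupp.single j (m j), m.erase j)]
    · simp only [PowerSeries.coeff_subst_single, ih]
      rw [Finsupp.single_eq_same, if_pos rfl, Finsupp.support_erase, mul_ite, mul_zero,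
        Finset.prod_insert hj]
      have h1 : m.support.erase j ⊆ S ↔ m.support ⊆ insert j S := by
        rw [Finset.subset_insert_iff]
      refine if_congr h1 ?_ rfl
      congr 1
      refine Finset.prod_congr rfl fun i hi => ?_
      rw [Finsupp.erase_ne]
      rintro rfl
      exact hj hi
    · rintro ⟨p, q⟩ hpq hne
      rw [Finset.HasAntidiagonal.mem_antidiagonal] at hpq
      simp only at hpq
      simp only [PowerSeries.coeff_subst_single, ih]
      by_cases h1 : p = Finsupp.single j (p j)
      · rw [if_pos h1]
        by_cases h2 : q.support ⊆ S
        · exfalso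
          apply hne
          have hq : q j = 0 := Finsupp.notMem_support_iff.1 fun h => hj (h2 h)
          have hmj : m j = p j := by rw [← hpq, Finsupp.add_apply, hq, add_zero]
          refine Prod.ext ?_ ?_
          · simp only
            rw [h1, hmj]
          · simp only
            rw [← hpq, h1]
            ext i
            by_cases hi : i = j
            · subst hi; simp [hq]
            · rw [Finsupp.erase_ne hi, Finsupp.add_apply, Finsupp.single_eq_of_ne hi, zero_add]
        · rw [if_neg h2, mul_zero]
      · rw [if_neg h1, zero_mul]
    · intro h
      exfalso
      apply h
      rw [Finset.HasAntidiagonal.mem_antidiagonal]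
      exact Finsupp.single_add_erase j m

/-! ### Series whose coefficients are read off from noncommutative products -/

section Algebra

set_option linter.unusedSectionVars false

variable {E : Type*} [Ring E] [Algebra ℤ[X] E] (B : ℕ → E)

/-- The coefficients of `∑_b B_b (x / (1 - β x))^b`. -/
noncomputable def geomTransform (a : ℕ) : E :=
  ∑ b ∈ Finset.range (a + 1), PowerSeries.coeff a (geomSeries ^ b) • B b

theorem geomTransform_zero : geomTransform B 0 = B 0 := by
  simp [geomTransform]

/-- Expanding the product gives a finite sum over exponent vectors d ≤ m, because (x/(1-βx))^b
starts in degree b. -/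
theorem prod_map_geomTransform {ls : List ℕ+} (hls : ls.Nodup) {m : ℕ+ →₀ ℕ} :
    (ls.map fun i => geomTransform B (m i)).prod
      = ∑ d ∈ ls.toFinset.finsupp fun i => Finset.range (m i + 1),
        (∏ i ∈ ls.toFinset, PowerSeries.coeff (m i) (geomSeries ^ d i)) •
          (ls.map fun i => B (d i)).prod := by
  classical
  induction ls with
  | nil =>
    have h : (∅ : Finset ℕ+).finsupp (fun i => Finset.range (m i + 1)) = {0} := by
      ext d
      rw [Finset.mem_finsupp_iff, Finset.mem_singleton, Finset.subset_empty,
        Finsupp.support_eq_empty]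
      simp
    rw [List.toFinset_nil, h]
    simp
  | cons i ls ih =>
    rw [List.nodup_cons] at hls
    have hi : i ∉ ls.toFinset := fun h => hls.1 (List.mem_toFinset.1 h)
    rw [List.map_cons, List.prod_cons, ih hls.2, geomTransform, Finset.sum_mul_sum,
      ← Finset.sum_product', List.toFinset_cons]
    refine Finset.sum_bij' (fun p _ => p.2.update i p.1) (fun d _ => (d i, d.erase i))
       ?_ ?_ ?_ ?_ ?_
    · rintro ⟨b, d⟩ h
      obtain ⟨h1, h2⟩ := Finset.mem_product.1 h
      rw [Finset.mem_finsupp_iff] at h2 ⊢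
      refine ⟨(Finsupp.support_update_subset _ _).trans (Finset.insert_subset_insert _ h2.1),
        fun j hj => ?_⟩
      rcases eq_or_ne j i with rfl | hji
      · simpa using h1
      · rw [Finsupp.coe_update, Function.update_of_ne hji]
        exact h2.2 j ((Finset.mem_insert.1 hj).resolve_left hji)
    · intro d h
      rw [Finset.mem_finsupp_iff] at h
      refine Finset.mem_product.2 ⟨h.2 i (Finset.mem_insert_self _ _), ?_⟩
      rw [Finset.mem_finsupp_iff, Finsupp.support_erase]
      refine ⟨Finset.subset_insert_iff.1 h.1, fun j hj => ?_⟩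
      rw [Finsupp.erase_ne (ne_of_mem_of_not_mem hj hi)]
      exact h.2 j (Finset.mem_insert_of_mem hj)
    · rintro ⟨b, d⟩ h
      have h2 := (Finset.mem_finsupp_iff.1 (Finset.mem_product.1 h).2).1
      have h3 : d i = 0 := Finsupp.notMem_support_iff.1 fun h => hi (h2 h)
      refine Prod.ext (by simp) ?_
      ext j
      rcases eq_or_ne j i with rfl | hji
      · simp [h3]
      · simp [Finsupp.erase_ne hji]
    · intro d h
      ext j
      rcases eq_or_ne j i with rfl | hji
      · simp
      · simp
    · rintro ⟨b, d⟩ h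
      have hne : ∀ j ∈ ls, (d.update i b) j = d j := fun j hj => by
        rw [Finsupp.coe_update, Function.update_of_ne]
        rintro rfl
        exact hls.1 hj
      have h1 : (ls.map fun j => B ((d.update i b) j)) = ls.map fun j => B (d j) :=
        List.map_congr_left fun j hj => by rw [hne j hj]
      have h2 : ∏ j ∈ ls.toFinset, PowerSeries.coeff (m j) (geomSeries ^ (d.update i b) j)
          = ∏ j ∈ ls.toFinset, PowerSeries.coeff (m j) (geomSeries ^ d j) :=
        Finset.prod_congr rfl fun j hj => by rw [hne j (List.mem_toFinset.1 hj)]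
      rw [Finset.prod_insert hi, List.map_cons, List.prod_cons, h1, h2, Finsupp.coe_update,
        Function.update_self, smul_mul_smul_comm]

/-- The coefficients of `f` are given by products of the elements `B a`. -/
def HasExpansion (ℓ : E →ₗ[ℤ[X]] ℤ[X]) (B : ℕ → E) (f : Series) : Prop :=
  ∀ (ls : List ℕ+) (m : ℕ+ →₀ ℕ), ls.Pairwise (· < ·) → (∀ i ∈ m.support, i ∈ ls) →
    MvPowerSeries.coeff m f = ℓ (ls.map fun i => B (m i)).prod

variable {B} {ℓ : E →ₗ[ℤ[X]] ℤ[X]} {f : Series}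

/-- The substitution treats each variable separately, so it acts on the matrix-like series ∑ B_b x^b
one factor at a time. Monomials whose support is smaller than `ls` occur in the sum, which is why
expansions are required for every list containing the support. -/
theorem HasExpansion.substGeom (hf : HasExpansion ℓ B f) :
    HasExpansion ℓ (geomTransform B) (substGeom f) := by
  classical
  intro ls m hls hm
  have hn : ls.Nodup := hls.imp fun h => h.ne
  have hterm : ∀ d : ℕ+ →₀ ℕ,
      MvPowerSeries.coeff m (d.prod fun i e => geom i ^ e) =
        if d.support ⊆ ls.toFinset then
          ∏ i ∈ ls.toFinset, PowerSeries.coeff (m i) (geomSeries ^ d i) else 0 := by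
    intro d
    have hp : ∀ S : Finset ℕ+, d.support ⊆ S → (d.prod fun i e => geom i ^ e)
        = ∏ i ∈ S, PowerSeries.subst (MvPowerSeries.X i : Series) (geomSeries ^ d i) := by
      intro S hS
      rw [Finsupp.prod_of_support_subset d hS _ fun i _ => pow_zero _]
      refine Finset.prod_congr rfl fun i _ => ?_
      rw [PowerSeries.subst_pow (PowerSeries.HasSubst.X i), geom_eq_subst]
    split_ifs with hd
    · rw [hp _ hd, coeff_prod_subst_X, if_pos]
      exact fun i hi => List.mem_toFinset.2 (hm i hi)
    -- Here d involves a variable outside `ls`, on which m vanishes; a positive power of x/(1-βx)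
    -- has no constant term.
    · rw [hp _ subset_rfl, coeff_prod_subst_X]
      obtain ⟨i, hi, hi'⟩ := Finset.not_subset.1 hd
      have h0 : m i = 0 := Finsupp.notMem_support_iff.1 fun h => hi' (List.mem_toFinset.2 (hm i h))
      rw [Finset.prod_eq_zero hi, ite_self]
      rw [h0]
      exact coeff_geomSeries_pow_of_lt (Nat.pos_of_ne_zero (Finsupp.mem_support_iff.1 hi))
  rw [Multipeak.substGeom, MvPowerSeries.coeff_subst hasSubst_geom,
    prod_map_geomTransform _ hn, map_sum, finsum_eq_sum_of_support_subset]
  · refine Finset.sum_congr rfl fun d hd => ?_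
    have hd' : d.support ⊆ ls.toFinset := (Finset.mem_finsupp_iff.1 hd).1
    rw [hterm, if_pos hd', map_smul, hf ls d hls fun i hi => List.mem_toFinset.1 (hd' hi),
      smul_eq_mul, smul_eq_mul, mul_comm]
  · intro d hd
    rw [Function.mem_support, hterm] at hd
    have h1 := right_ne_zero_of_smul hd
    rw [ite_ne_right_iff] at h1
    rw [Finset.mem_coe, Finset.mem_finsupp_iff]
    refine ⟨h1.1, fun i hi => Finset.mem_range.2 ?_⟩
    by_contra h2
    exact h1.2 (Finset.prod_eq_zero hi (coeff_geomSeries_pow_of_lt (by omega)))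

theorem HasExpansion.coeff_packed (hf : HasExpansion ℓ B f) (γ : Composition n) :
    MvPowerSeries.coeff (packed γ) f = ℓ (γ.blocks.map B).prod := by
  have h := exps_packed γ
  rw [exps] at h
  rw [hf (packed γ).support.sort (packed γ) (Finset.sortedLT_sort _).pairwise
    fun i hi => (Finset.mem_sort _).2 hi, ← h, List.map_map]
  rfl

theorem HasExpansion.mem_QSym (hf : HasExpansion ℓ B f) : f ∈ QSym := by
  have h : ∀ m, MvPowerSeries.coeff m f = ℓ ((exps m).map B).prod := by
    intro m
    rw [hf m.support.sort m (Finset.sortedLT_sort _).pairwise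
      fun i hi => (Finset.mem_sort _).2 hi, exps, List.map_map]
    rfl
  intro m m' hm
  rw [h, h, hm]

/-- The M-coefficients are ℓ of products over blocks, so their alternating sum is ℓ of a ribbon. -/
theorem HasExpansion.coeffL (hf : HasExpansion ℓ B f) (hn : 0 < n) (α : Composition n) :
    coeffL f α = ℓ (cutSum B (I α) (n - 1) 1) := by
  have h := sum_I_subset
    (fun T => ℓ ((-1) ^ (I α \ T).card * cutProd B T (n - 1) 1)) (I_subset_Ico α)
  rw [cutSum, map_sum, ← h, Multipeak.coeffL]
  refine Finset.sum_congr rfl fun γ _ => ?_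
  rw [cutProd_I B γ hn, hf.coeff_packed]
  rcases Nat.even_or_odd (I α \ I γ).card with h | h
  · rw [h.neg_one_pow, h.neg_one_pow, one_mul, one_mul]
  · rw [h.neg_one_pow, h.neg_one_pow, neg_one_mul, neg_one_mul, map_neg]

/-- The coefficients in the basis `L_α` of `f(x / (1 - β x))` are those of `f` for the complementary
compositions. -/
theorem HasExpansion.coeffL_substGeom (hf : HasExpansion ℓ B f) (h0 : B 0 = 1)
    (h : ∀ p, 0 < p → ∑ j ∈ Finset.range (p + 1), (-1) ^ j * (geomTransform B j * B (p - j)) = 0)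
    (α : Composition n) : Multipeak.coeffL (Multipeak.substGeom f) (compl α)
      = Multipeak.coeffL f α := by
  -- Degree 0 falls outside the (n - 1) + 1 convention; there both coefficients are ℓ of the empty
  -- product.
  rcases Nat.eq_zero_or_pos n with rfl | hn
  · have h1 : ∀ γ : Composition 0, MvPowerSeries.coeff (packed γ) (Multipeak.substGeom f)
        = MvPowerSeries.coeff (packed γ) f := by
      intro γ
      have h2 : γ.blocks = [] := by
        rw [← List.length_eq_zero_iff]
        exact Nat.le_zero.1 γ.length_le
      rw [hf.coeff_packed, hf.substGeom.coeff_packed, h2]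
      rfl
    have h2 : compl α = α := I_injective <| (Finset.subset_empty.1 (I_subset_Ico (compl α))).trans
      (Finset.subset_empty.1 (I_subset_Ico α)).symm
    rw [h2]
    simp only [Multipeak.coeffL, h1]
  · rw [hf.coeffL hn α, hf.substGeom.coeffL hn (compl α)]
    refine congrArg ℓ (Eq.symm ?_)
    refine cutSum_compl B h0 ((geomTransform_zero B).trans h0) h _ ?_ ?_
    · rw [I_compl]
      exact Finset.disjoint_sdiff
    · rw [I_compl, Finset.union_sdiff_of_subset (I_subset_Ico α)]
      ext j
      rw [Finset.mem_Ico, Finset.mem_Icc]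
      omega

/-- The coefficients of a polynomial evaluated at `x / (1 - β x)`. -/
noncomputable def evalGeom : E[X] →+* PowerSeries E :=
  Polynomial.eval₂RingHom' PowerSeries.C (PowerSeries.map (algebraMap ℤ[X] E) geomSeries) <| by
    intro e
    ext1 a
    rw [PowerSeries.coeff_C_mul, PowerSeries.coeff_mul_C, PowerSeries.coeff_map]
    exact (Algebra.commutes _ _).symm

/-- The coefficients of a polynomial evaluated at `-x`. -/
noncomputable def evalNeg : E[X] →+* PowerSeries E :=
  Polynomial.eval₂RingHom' PowerSeries.C (-PowerSeries.X) fun _ =>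
    (PowerSeries.commute_X _).neg_right

theorem coeff_evalGeom (p : E[X]) (a : ℕ) :
    PowerSeries.coeff a (evalGeom p) = geomTransform p.coeff a := by
  have h1 : ∀ b, PowerSeries.coeff a (PowerSeries.C (p.coeff b) *
      (PowerSeries.map (algebraMap ℤ[X] E) geomSeries) ^ b)
      = PowerSeries.coeff a (geomSeries ^ b) • p.coeff b := by
    intro b
    rw [PowerSeries.coeff_C_mul, ← map_pow, PowerSeries.coeff_map, Algebra.smul_def,
      Algebra.commutes]
  change PowerSeries.coeff a (Polynomial.eval₂ _ _ p) = _
  rw [Polynomial.eval₂_eq_sum_range' _ (n := max (p.natDegree + 1) (a + 1)) (by omega), map_sum]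
  simp only [h1]
  symm
  refine Finset.sum_subset (Finset.range_subset_range.2 (le_max_right _ _)) fun b _ hb => ?_
  rw [Finset.mem_range] at hb
  rw [coeff_geomSeries_pow_of_lt (by omega), zero_smul]

theorem coeff_evalNeg (p : E[X]) (a : ℕ) :
    PowerSeries.coeff a (evalNeg p) = (-1) ^ a * p.coeff a := by
  have h1 : ∀ b, PowerSeries.coeff a (PowerSeries.C (p.coeff b) * (-PowerSeries.X) ^ b)
      = if a = b then (-1) ^ a * p.coeff a else 0 := by
    intro b
    rw [PowerSeries.coeff_C_mul, neg_pow, PowerSeries.coeff_mul_X_pow']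
    rcases lt_trichotomy a b with h | rfl | h
    · rw [if_neg (by omega), mul_zero, if_neg (by omega)]
    · rw [if_pos le_rfl, if_pos rfl, Nat.sub_self]
      rcases Nat.even_or_odd a with h | h <;> simp [h.neg_one_pow]
    · rw [if_pos h.le, if_neg (by omega)]
      have h3 : PowerSeries.coeff (a - b) (1 : PowerSeries E) = 0 := by
        rw [PowerSeries.coeff_one, if_neg (by omega)]
      rcases Nat.even_or_odd b with h | h <;> simp [h.neg_one_pow, h3]
  change PowerSeries.coeff a (Polynomial.eval₂ _ _ p) = _
  rw [Polynomial.eval₂_eq_sum_range' _ (n := max (p.natDegree + 1) (a + 1)) (by omega), map_sum]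
  simp only [h1, Finset.sum_ite_eq, Finset.mem_range]
  rw [if_pos (by omega)]

/-- With g = x/(1-βx), the product is 1 + u(g - x) - u²gx = 1 + u(g - βgx - x), and g - βgx = x.
This is the one place where the particular substitution matters. -/
theorem evalGeom_mul_evalNeg {u : E} (hu : u * u = β • u) :
    evalGeom (1 + Polynomial.C u * Polynomial.X) * evalNeg (1 + Polynomial.C u * Polynomial.X)
      = 1 := by
  set g := PowerSeries.map (algebraMap ℤ[X] E) geomSeries with hg
  have h1 : evalGeom (1 + Polynomial.C u * Polynomial.X) = 1 + PowerSeries.C u * g := by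
    rw [map_add, map_one, map_mul]
    congr 2
    · exact Polynomial.eval₂_C _ _
    · exact Polynomial.eval₂_X _ _
  have h2 : evalNeg (1 + Polynomial.C u * Polynomial.X) = 1 - PowerSeries.C u * PowerSeries.X := by
    rw [map_add, map_one, map_mul, sub_eq_add_neg, ← mul_neg]
    congr 2
    · exact Polynomial.eval₂_C _ _
    · exact Polynomial.eval₂_X _ _
  have h3 : g - PowerSeries.C (algebraMap ℤ[X] E β) * (g * PowerSeries.X) = PowerSeries.X := by
    have := congrArg (PowerSeries.map (algebraMap ℤ[X] E)) geomSeries_mul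
    rw [mul_sub, mul_one, mul_left_comm, map_sub, map_mul, map_mul, PowerSeries.map_C,
      PowerSeries.map_X] at this
    exact this
  have h4 : g * PowerSeries.C u = PowerSeries.C u * g := by
    ext1 a
    rw [PowerSeries.coeff_C_mul, PowerSeries.coeff_mul_C, PowerSeries.coeff_map]
    exact Algebra.commutes _ _
  have h5 : PowerSeries.C u * PowerSeries.C u
      = PowerSeries.C u * PowerSeries.C (algebraMap ℤ[X] E β) := by
    rw [← map_mul, ← map_mul, hu, Algebra.smul_def, Algebra.commutes]
  calc _ = (1 + PowerSeries.C u * g) * (1 - PowerSeries.C u * PowerSeries.X) := by rw [h1, h2]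
    _ = 1 + PowerSeries.C u * (g - PowerSeries.X)
        - PowerSeries.C u * (g * PowerSeries.C u) * PowerSeries.X := by noncomm_ring
    _ = 1 + PowerSeries.C u * (g - PowerSeries.X)
        - PowerSeries.C u * PowerSeries.C u * (g * PowerSeries.X) := by
        rw [h4]; simp only [mul_assoc]
    _ = 1 + PowerSeries.C u * (g - PowerSeries.C (algebraMap ℤ[X] E β) * (g * PowerSeries.X)
        - PowerSeries.X) := by rw [h5]; noncomm_ring
    _ = 1 := by rw [h3, sub_self, mul_zero, add_zero]

/-- The factors cancel from the inside outwards, which forces the opposite order in the second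
product. -/
theorem evalGeom_prod_mul_evalNeg_prod {L : List E} (hL : ∀ u ∈ L, u * u = β • u) :
    evalGeom (L.map fun u => 1 + Polynomial.C u * Polynomial.X).prod *
      evalNeg (L.reverse.map fun u => 1 + Polynomial.C u * Polynomial.X).prod = 1 := by
  induction L with
  | nil => simp
  | cons u L ih =>
    rw [List.map_cons, List.prod_cons, List.reverse_cons, List.map_append, List.prod_append,
      List.map_singleton, List.prod_singleton, map_mul, map_mul, mul_assoc,
      ← mul_assoc (evalGeom (List.prod _)), ih fun v hv => hL v (List.mem_cons_of_mem _ hv),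
      one_mul, evalGeom_mul_evalNeg (hL u List.mem_cons_self)]

/-- For a palindromic product p the two orders agree, so p(x/(1-βx)) p(-x) = 1; the claim is its
coefficient of x^a, up to the sign (-1)^a. -/
theorem sum_geomTransform_mul {L : List E} (hL : ∀ u ∈ L, u * u = β • u) {p : E[X]}
    (h1 : p = (L.map fun u => 1 + Polynomial.C u * Polynomial.X).prod)
    (h2 : p = (L.reverse.map fun u => 1 + Polynomial.C u * Polynomial.X).prod) {a : ℕ}
    (ha : 0 < a) :
    ∑ j ∈ Finset.range (a + 1), (-1) ^ j * (geomTransform p.coeff j * p.coeff (a - j)) = 0 := by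
  have h := evalGeom_prod_mul_evalNeg_prod hL
  rw [← h1, ← h2] at h
  have h3 := congrArg (PowerSeries.coeff a) h
  rw [PowerSeries.coeff_mul, PowerSeries.coeff_one, if_neg ha.ne',
    Finset.Nat.sum_antidiagonal_eq_sum_range_succ_mk] at h3
  rw [← mul_zero ((-1) ^ a), ← h3, Finset.mul_sum]
  refine Finset.sum_congr rfl fun j hj => ?_
  rw [Finset.mem_range] at hj
  simp only [coeff_evalGeom, coeff_evalNeg]
  obtain ⟨b, rfl⟩ : ∃ b, a = j + b := ⟨a - j, by omega⟩
  rw [Nat.add_sub_cancel_left, pow_add]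
  rcases Nat.even_or_odd b with h | h <;> simp [h.neg_one_pow]

end Algebra

/-! ### The involution `ψ` on the weight enumerators -/

section Valleys

open scoped Classical

set_option linter.unusedSectionVars false

variable {P : Type*} [PartialOrder P]

/-- All elements of `V` are valleys of `(P, γ)`. -/
def IsValleySet (γ : P → ℤ) (V : Set P) : Prop :=
  ∀ v ∈ V, ∀ s, (s ⋖ v → γ v < γ s) ∧ (v ⋖ s → γ v < γ s)

theorem isValleySet_empty (γ : P → ℤ) : IsValleySet γ ∅ := fun _ h => absurd h (Set.notMem_empty _)

variable [Fintype P]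

/-- Once s has received its largest letter it is no longer pending, so of the first operator only
the branch with factor β survives. -/
theorem boxOp_mul_self (s : P) : boxOp s * boxOp s = β • boxOp s := by
  ext1 U K
  rw [boxOp_mul_apply, Matrix.smul_apply, smul_eq_mul]
  split_ifs with h
  · have h1 : boxOp s (U.erase s) K = 0 := by
      rw [boxOp, if_neg]
      exact fun h' => Finset.notMem_erase s U h'.2.1
    rw [h1, zero_add]
  · rw [boxOp, if_neg h, mul_zero]

theorem isMinOf_erase_iff {s t : P} {U : Finset P} (hs : IsMinOf s U) (hst : s ≠ t)
    (h : ¬ s ⋖ t) : IsMinOf t (U.erase s) ↔ IsMinOf t U := by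
  constructor
  · rintro ⟨-, h2, h3⟩
    refine ⟨hs.1, Finset.mem_of_mem_erase h2, fun r hr hrt => ?_⟩
    refine h3 r (Finset.mem_erase.2 ⟨?_, hr⟩) hrt
    rintro rfl
    exact h hrt
  · rintro ⟨-, h2, h3⟩
    exact ⟨hs.isUpperSet_erase, Finset.mem_erase.2 ⟨hst.symm, h2⟩,
      fun r hr => h3 r (Finset.mem_of_mem_erase hr)⟩

/-- If neither box covers the other, completing one of them does not affect whether the other is
minimal. -/
theorem boxOp_comm {s t : P} (h1 : ¬ s ⋖ t) (h2 : ¬ t ⋖ s) : Commute (boxOp s) (boxOp t) := by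
  rcases eq_or_ne s t with rfl | hst
  · exact Commute.refl _
  ext1 U K
  rw [boxOp_mul_apply, boxOp_mul_apply]
  by_cases hs : IsMinOf s U
  · rw [if_pos hs]
    by_cases ht : IsMinOf t U
    · rw [if_pos ht, boxOp, boxOp, boxOp, boxOp, if_pos hs, if_pos ht,
        if_pos ((isMinOf_erase_iff hs hst h1).2 ht),
        if_pos ((isMinOf_erase_iff ht hst.symm h2).2 hs),
        Finset.erase_right_comm]
      ring
    · rw [if_neg ht, boxOp, boxOp, if_neg ht,
        if_neg fun h => ht ((isMinOf_erase_iff hs hst h1).1 h)]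
      ring
  · rw [if_neg hs]
    split_ifs with ht
    · rw [boxOp, boxOp, if_neg hs, if_neg fun h => hs ((isMinOf_erase_iff ht hst.symm h2).1 h)]
      ring
    · rfl

theorem boxPoly_singleton (s : P) :
    boxPoly [s] = 1 + Polynomial.C (boxOp s) * Polynomial.X := by
  simp [boxPoly]

theorem commute_boxPoly {s : P} {L : List P} (h : ∀ t ∈ L, ¬ s ⋖ t ∧ ¬ t ⋖ s) :
    Commute (boxPoly [s]) (boxPoly L) := by
  refine Commute.list_prod_right _ _ fun x hx => ?_
  obtain ⟨t, ht, rfl⟩ := List.mem_map.1 hx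
  rw [boxPoly_singleton]
  refine Commute.add_left (Commute.one_left _) (Commute.add_right (Commute.one_right _) ?_)
  have hc : Commute (Polynomial.C (boxOp s)) (Polynomial.C (boxOp t)) :=
    (boxOp_comm (h t ht).1 (h t ht).2).map Polynomial.C
  exact ((hc.mul_right (Polynomial.commute_X _).symm)).mul_left
    ((Polynomial.commute_X _).mul_right (Polynomial.commute_X _))

theorem boxPoly_reverse {L : List P} (h : ∀ s ∈ L, ∀ t ∈ L, ¬ s ⋖ t) :
    boxPoly L.reverse = boxPoly L := by
  induction L with
  | nil => rfl
  | cons s L ih =>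
    have h' : ∀ t ∈ L, ¬ s ⋖ t ∧ ¬ t ⋖ s := fun t ht =>
      ⟨h s List.mem_cons_self t (List.mem_cons_of_mem _ ht),
        h t (List.mem_cons_of_mem _ ht) s List.mem_cons_self⟩
    rw [List.reverse_cons, boxPoly_append, ih fun a ha b hb =>
      h a (List.mem_cons_of_mem _ ha) b (List.mem_cons_of_mem _ hb), ← (commute_boxPoly h').eq,
      ← boxPoly_append, List.singleton_append]

variable {γ : P → ℤ} {V : Set P}

theorem IsValleySet.not_covBy (hV : IsValleySet γ V) {v s : P} (hv : v ∈ V) (h : γ s ≤ γ v) :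
    ¬ s ⋖ v ∧ ¬ v ⋖ s :=
  ⟨fun h' => h.not_gt ((hV v hv s).1 h'), fun h' => h.not_gt ((hV v hv s).2 h')⟩

/-- A box before v ∈ V in the sorted list has a label at most that of v, whereas all neighbours of a
valley have larger labels. So the two factors commute, and the factors of V can be moved to the
front. -/
theorem boxPoly_filter (hV : IsValleySet γ V) {l : List P}
    (hl : l.Pairwise fun s t => γ s ≤ γ t) :
    boxPoly l = boxPoly (l.filter fun s => s ∈ V) * boxPoly (l.filter fun s => s ∉ V) := by
  induction l with
  | nil => simp [boxPoly_nil]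
  | cons s l ih =>
    rw [List.pairwise_cons] at hl
    rw [← List.singleton_append, boxPoly_append, ih hl.2, List.filter_append, List.filter_append,
      boxPoly_append, boxPoly_append]
    by_cases hs : s ∈ V
    · simp [hs, boxPoly_nil, mul_assoc]
    · have hc : Commute (boxPoly [s]) (boxPoly (l.filter fun s => s ∈ V)) := by
        refine commute_boxPoly fun t ht => ?_
        rw [List.mem_filter, decide_eq_true_eq] at ht
        exact hV.not_covBy ht.2 (hl.1 t ht.1)
      simp only [hs, List.filter_cons, decide_false, not_false_eq_true, decide_true, if_true,
        Bool.false_eq_true, if_false, List.filter_nil, boxPoly_nil, one_mul]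
      rw [← mul_assoc, hc.eq, mul_assoc]

theorem boxPoly_filter_reverse (hV : IsValleySet γ V) {l : List P}
    (hl : l.Pairwise fun s t => γ s ≤ γ t) :
    boxPoly l.reverse = boxPoly (l.reverse.filter fun s => s ∉ V) *
      boxPoly (l.reverse.filter fun s => s ∈ V) := by
  induction l with
  | nil => simp [boxPoly_nil]
  | cons s l ih =>
    rw [List.pairwise_cons] at hl
    rw [List.reverse_cons, boxPoly_append, ih hl.2, List.filter_append, List.filter_append,
      boxPoly_append, boxPoly_append]
    by_cases hs : s ∈ V
    · simp [hs, boxPoly_nil, mul_assoc]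
    · have hc : Commute (boxPoly [s]) (boxPoly (l.reverse.filter fun s => s ∈ V)) := by
        refine commute_boxPoly fun t ht => ?_
        rw [List.mem_filter, decide_eq_true_eq, List.mem_reverse] at ht
        exact hV.not_covBy ht.2 (hl.1 t ht.1)
      simp only [hs, List.filter_cons, decide_false, not_false_eq_true, decide_true, if_true,
        Bool.false_eq_true, if_false, List.filter_nil, boxPoly_nil, mul_one]
      rw [mul_assoc, mul_assoc, hc.eq]

/-- Let A and N be the parts of l inside and outside V. The product becomes N^r · A · N, and its
reversal N^r · A^r · N; no two valleys form a cover, so A^r and A give the same factor. -/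
theorem boxPoly_boxOrder_reverse (hV : IsValleySet γ V) {l : List P}
    (hl : l.Pairwise fun s t => γ s ≤ γ t) :
    boxPoly (boxOrder l V).reverse = boxPoly (boxOrder l V) := by
  have h1 : (boxOrder l V).reverse = l.reverse ++ l.filter fun s => s ∉ V := by
    rw [boxOrder, List.reverse_append, List.filter_reverse, List.reverse_reverse]
  rw [h1, boxPoly_append, boxOrder, boxPoly_append, boxPoly_filter hV hl,
    boxPoly_filter_reverse hV hl, mul_assoc]
  congr 2
  rw [List.filter_reverse, boxPoly_reverse]
  intro s hs t ht hst
  rw [List.mem_filter, decide_eq_true_eq] at hs ht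
  exact lt_asymm ((hV s hs.2 t).2 hst) ((hV t ht.2 s).1 hst)

/-- The matrix entry which computes the coefficients of `Ω(P, γ, V)`. -/
noncomputable def fullEntry (P : Type*) [Fintype P] : StateMatrix P →ₗ[ℤ[X]] ℤ[X] :=
  Matrix.entryLinearMap ℤ[X] ℤ[X] Finset.univ ∅

theorem hasExpansion_OmegaV (hγ : ∀ s t, s ⋖ t → γ s ≠ γ t) {l : List P} (hn : l.Nodup)
    (hl : l.Pairwise fun s t => γ s ≤ γ t) (hc : ∀ s, s ∈ l) (V : Set P) :
    HasExpansion (fullEntry P) (boxPoly (boxOrder l V)).coeff (OmegaV γ V : Series) :=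
  fun _ _ hls hm => coeff_OmegaV hγ hn hl hc V hls hm

theorem coeffL_substGeom_OmegaV (hγ : ∀ s t, s ⋖ t → γ s ≠ γ t) (hV : IsValleySet γ V)
    (α : Composition n) : coeffL (substGeom (OmegaV γ V)) (compl α) = coeffL (OmegaV γ V) α := by
  obtain ⟨l, hn, hl, hc⟩ := exists_sorted_list γ
  refine (hasExpansion_OmegaV hγ hn hl hc V).coeffL_substGeom (boxPoly_coeff_zero _) ?_ α
  intro p hp
  refine sum_geomTransform_mul (L := (boxOrder l V).map boxOp) ?_ ?_ ?_ hp
  · intro u hu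
    obtain ⟨s, -, rfl⟩ := List.mem_map.1 hu
    exact boxOp_mul_self s
  · rw [List.map_map]
    rfl
  · rw [← List.map_reverse, List.map_map]
    exact (boxPoly_boxOrder_reverse hV hl).symm

theorem substGeom_OmegaV_mem (hγ : ∀ s t, s ⋖ t → γ s ≠ γ t) (V : Set P) :
    substGeom (OmegaV γ V) ∈ QSym := by
  obtain ⟨l, hn, hl, hc⟩ := exists_sorted_list γ
  exact (hasExpansion_OmegaV hγ hn hl hc V).substGeom.mem_QSym

theorem psi_OmegaV (hγ : ∀ s t, s ⋖ t → γ s ≠ γ t) (hV : IsValleySet γ V) :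
    (psi (OmegaV γ V) : Series) = substGeom (OmegaV γ V) :=
  twist_eq (fun _ => bijective_compl) (substGeom_OmegaV_mem hγ V)
    fun _ => coeffL_substGeom_OmegaV hγ hV

/-- The coefficients of `g` are those of `f` with exponents reversed. -/
def IsReversal (f g : Series) : Prop :=
  ∀ (n : ℕ) (α : Composition n),
    MvPowerSeries.coeff (packed α.reverse) g = MvPowerSeries.coeff (packed α) f

theorem rho_eq {f g : QSym} (h : IsReversal f g) : rho f = g :=
  Subtype.ext <| twist_eq (fun _ => bijective_reverse) g.2 fun n α => coeffL_reverse α (h n)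

/-- Complement and reversal commute, so ω is handled as ρ followed by ψ, with f the reversal of the
weight enumerator. -/
theorem omega_eq_substGeom_OmegaV {f : QSym} (hγ : ∀ s t, s ⋖ t → γ s ≠ γ t)
    (hV : IsValleySet γ V) (h : IsReversal f (OmegaV γ V)) :
    (omega f : Series) = substGeom (OmegaV γ V) := by
  refine twist_eq (τ := fun _ α => (compl α).reverse)
    (fun _ => bijective_reverse.comp bijective_compl) (substGeom_OmegaV_mem hγ V) fun n α => ?_
  rw [← compl_reverse, coeffL_substGeom_OmegaV hγ hV, coeffL_reverse α (h n)]

end Valleys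

/-! ### Reversing the order of the letters -/

section Reversal

set_option linter.unusedSectionVars false

/-- `i ↦ k + 1 - i`. -/
def flipIndex (k : ℕ) (i : ℕ+) : ℕ+ := Nat.succPNat (k - 1 - i.natPred)

theorem flipIndex_succPNat (k a : ℕ) : flipIndex k (Nat.succPNat a) = Nat.succPNat (k - 1 - a) := by
  rw [flipIndex, Nat.natPred_succPNat]

theorem flipIndex_flipIndex {k : ℕ} {i : ℕ+} (h : i.natPred < k) :
    flipIndex k (flipIndex k i) = i := by
  rw [flipIndex, flipIndex, Nat.natPred_succPNat, Nat.sub_sub_self (by omega),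
    PNat.succPNat_natPred]

theorem flipIndex_lt {k : ℕ} {i j : ℕ+} (hj : j.natPred < k) (hij : i < j) :
    flipIndex k j < flipIndex k i := by
  have : i.natPred < j.natPred := PNat.natPred_lt_natPred.2 hij
  rw [flipIndex, flipIndex, Nat.succPNat_lt_succPNat]
  omega

theorem packed_reverse (α : Composition n) :
    packed α.reverse = (packed α).mapDomain (flipIndex α.length) := by
  have hl : α.reverse.length = α.length := by simp [Composition.length]
  rw [packed, packed, Finsupp.mapDomain_finsetSum]
  refine Fintype.sum_equiv ((finCongr hl).trans Fin.revPerm) _ _ fun r => ?_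
  have hr : (r : ℕ) < α.length := r.2.trans_eq hl
  rw [Finsupp.mapDomain_single, flipIndex_succPNat]
  congr 1
  · congr 1
    simp only [Equiv.trans_apply, Fin.revPerm_apply, Fin.val_rev, finCongr_apply, Fin.val_cast]
    omega
  · simp only [Composition.blocksFun, Composition.reverse_blocks, List.get_eq_getElem,
      List.getElem_reverse, Equiv.trans_apply, Fin.revPerm_apply, Fin.val_rev, finCongr_apply,
      Fin.val_cast]
    congr 1
    simp only [Composition.length]
    omega

theorem natPred_lt_of_mem_support_packed {α : Composition n} {i : ℕ+}
    (hi : i ∈ (packed α).support) : i.natPred < α.length := by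
  rw [Finsupp.mem_support_iff, packed, Finsupp.coe_finsetSum, Finset.sum_apply] at hi
  obtain ⟨r, -, hr⟩ := Finset.exists_ne_zero_of_sum_ne_zero hi
  rw [Finsupp.single_apply, ite_ne_right_iff] at hr
  rw [← hr.1, Nat.natPred_succPNat]
  exact r.2

open scoped Classical in
/-- Reversal of letters; the mark is changed unless `p` holds. -/
noncomputable def flipLetter (k : ℕ) (p : Prop) (x : Marked) : Marked :=
  toLex (flipIndex k (ofLex x).1, if p then (ofLex x).2 else !(ofLex x).2)

theorem flipLetter_flipLetter {k : ℕ} (p : Prop) {x : Marked} (h : (absVal x).natPred < k) :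
    flipLetter k p (flipLetter k p x) = x := by
  refine ofLex.injective (Prod.ext (flipIndex_flipIndex h) ?_)
  by_cases hp : p <;> simp [flipLetter, hp]

variable {P Q : Type*} [PartialOrder P] [PartialOrder Q]

theorem le_iff_absVal {x y : Marked} :
    x ≤ y ↔ absVal x < absVal y ∨ absVal x = absVal y ∧ (IsUnprimed x → IsUnprimed y) := by
  rw [Prod.Lex.le_iff]
  refine or_congr Iff.rfl (and_congr_right fun _ => ?_)
  exact Bool.le_iff_imp

theorem isUnprimed_flipLetter {k : ℕ} {p : Prop} {x : Marked} :
    IsUnprimed (flipLetter k p x) ↔ (p ↔ IsUnprimed x) := by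
  by_cases hp : p <;> simp [flipLetter, hp, IsUnprimed]

theorem not_isUnprimed {x : Marked} : ¬ IsUnprimed x ↔ IsPrimed x := by
  simp [IsPrimed, IsUnprimed]

theorem marked_ext {x y : Marked} (h1 : absVal x = absVal y) (h2 : IsUnprimed x ↔ IsUnprimed y) :
    x = y := by
  exact le_antisymm (le_iff_absVal.2 (Or.inr ⟨h1, h2.1⟩))
    (le_iff_absVal.2 (Or.inr ⟨h1.symm, h2.2⟩))

theorem absVal_flipLetter (k : ℕ) (p : Prop) (x : Marked) :
    absVal (flipLetter k p x) = flipIndex k (absVal x) := rfl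

/-- Reversal of the letters in a filling. -/
noncomputable def flipFilling (k : ℕ) (V : Set P) (e : P ≃ Q) (σ : P → Finset Marked) :
    Q → Finset Marked :=
  fun q => (σ (e.symm q)).image (flipLetter k (e.symm q ∈ V))

variable {γ : P → ℤ} {V : Set P} {γ' : Q → ℤ} {V' : Set Q} {e : P ≃ Q} {k : ℕ}

/-- Consider letters of equal absolute value in boxes s ⋖ t. If labels increase, the letter in t
must be unprimed; if they decrease, the letter in s must be primed. As V consists of valleys, the
box with the forced mark lies outside V, so its mark does change. The changed mark alone gives the
order and intersection conditions along the dual edge, whatever happens in the other box. -/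
theorem flipFilling_mem (hγ : ∀ s t, s ⋖ t → γ s ≠ γ t) (hV : IsValleySet γ V)
    (he : ∀ s t, e t ⋖ e s → s ⋖ t) (hγ' : ∀ s, γ' (e s) = γ s) (hV' : ∀ s, e s ∈ V' → s ∈ V)
    {σ : P → Finset Marked} (hσ : σ ∈ enriched γ V)
    (hk : ∀ s, ∀ x ∈ σ s, (absVal x).natPred < k) : flipFilling k V e σ ∈ enriched γ' V' := by
  obtain ⟨h1, h2, h3⟩ := hσ
  refine ⟨fun q => (h1 _).image _, fun q' q hq => ?_, fun q hq x' hx' => ?_⟩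
  · obtain ⟨t, rfl⟩ := e.surjective q'
    obtain ⟨s, rfl⟩ := e.surjective q
    have hst := he s t hq
    obtain ⟨h4, h5, h6⟩ := h2 s t hst
    have hneq := hγ s t hst
    have hlt : γ s < γ t → t ∉ V ∧ ∀ x ∈ σ s, ∀ y ∈ σ t, absVal x = absVal y → IsUnprimed y := by
      refine fun h => ⟨fun ht => lt_asymm h ((hV t ht s).1 hst), fun x hx y hy hxy => ?_⟩
      by_contra hy'
      have hx' : ¬ IsUnprimed x := fun h' => (le_iff_absVal.1 (h4 x hx y hy)).elim
        (fun h'' => h''.ne hxy) fun h'' => hy' (h''.2 h')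
      obtain rfl := marked_ext hxy (iff_of_false hx' hy')
      exact hx' (h5 h x hx hy)
    have hgt : γ t < γ s → s ∉ V ∧ ∀ x ∈ σ s, ∀ y ∈ σ t, absVal x = absVal y →
        ¬ IsUnprimed x := by
      refine fun h => ⟨fun hs => lt_asymm h ((hV s hs t).2 hst), fun x hx y hy hxy hx' => ?_⟩
      have hy' : IsUnprimed y := (le_iff_absVal.1 (h4 x hx y hy)).elim
        (fun h'' => absurd hxy h''.ne) fun h'' => h''.2 hx'
      obtain rfl := marked_ext hxy (iff_of_true hx' hy')
      exact not_isPrimed_and (h6 h x hx hy) hx'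
    simp only [flipFilling, Equiv.symm_apply_apply, hγ']
    have hinj : ∀ {x y}, x ∈ σ s → y ∈ σ t → flipLetter k (t ∈ V) y = flipLetter k (s ∈ V) x →
        absVal x = absVal y := by
      intro x y hx hy h
      have h' := congrArg absVal h
      rw [absVal_flipLetter, absVal_flipLetter] at h'
      rw [← flipIndex_flipIndex (hk s x hx), ← h', flipIndex_flipIndex (hk t y hy)]
    refine ⟨?_, fun h z hz hz' => ?_, fun h z hz hz' => ?_⟩
    · intro y' hy' x' hx'
      obtain ⟨y, hy, rfl⟩ := Finset.mem_image.1 hy'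
      obtain ⟨x, hx, rfl⟩ := Finset.mem_image.1 hx'
      rw [le_iff_absVal, absVal_flipLetter, absVal_flipLetter]
      rcases le_iff_absVal.1 (h4 x hx y hy) with h | ⟨h, -⟩
      · exact Or.inl (flipIndex_lt (hk t y hy) h)
      · refine Or.inr ⟨by rw [h], ?_⟩
        rw [isUnprimed_flipLetter, isUnprimed_flipLetter]
        intro h'
        rcases lt_or_gt_of_ne hneq with h'' | h''
        · exact absurd (h'.2 ((hlt h'').2 x hx y hy h)) (hlt h'').1
        · exact iff_of_false (hgt h'').1 ((hgt h'').2 x hx y hy h)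
    · obtain ⟨y, hy, rfl⟩ := Finset.mem_image.1 hz
      obtain ⟨x, hx, hxy⟩ := Finset.mem_image.1 hz'
      rw [← hxy, isUnprimed_flipLetter]
      exact iff_of_false (hgt h).1 ((hgt h).2 x hx y hy (hinj hx hy hxy.symm))
    · obtain ⟨y, hy, rfl⟩ := Finset.mem_image.1 hz
      obtain ⟨x, hx, hxy⟩ := Finset.mem_image.1 hz'
      rw [← not_isUnprimed, isUnprimed_flipLetter]
      exact fun h' => (hlt h).1 (h'.2 ((hlt h).2 x hx y hy (hinj hx hy hxy.symm)))
  · obtain ⟨v, rfl⟩ := e.surjective q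
    have hv := hV' v hq
    rw [flipFilling, Equiv.symm_apply_apply] at hx'
    obtain ⟨x, hx, rfl⟩ := Finset.mem_image.1 hx'
    rw [isUnprimed_flipLetter]
    exact iff_of_true hv (h3 v hv x hx)

theorem flipFilling_flipFilling (hV' : ∀ s, e s ∈ V' ↔ s ∈ V) {σ : P → Finset Marked}
    (hk : ∀ s, ∀ x ∈ σ s, (absVal x).natPred < k) :
    flipFilling k V' e.symm (flipFilling k V e σ) = σ := by
  funext s
  simp only [flipFilling, Equiv.symm_symm, Equiv.symm_apply_apply, hV', Finset.image_image]
  conv_rhs => rw [← Finset.image_id (s := σ s)]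
  exact Finset.image_congr fun x hx => flipLetter_flipLetter _ (hk s x hx)

theorem flipLetter_injOn {p : Prop} {S : Finset Marked}
    (hk : ∀ x ∈ S, (absVal x).natPred < k) : Set.InjOn (flipLetter k p) S := by
  intro x hx y hy h
  rw [← flipLetter_flipLetter p (hk x hx), h, flipLetter_flipLetter p (hk y hy)]

variable [Fintype P] [Fintype Q]

theorem weight_flipFilling {σ : P → Finset Marked}
    (hk : ∀ s, ∀ x ∈ σ s, (absVal x).natPred < k) :
    weight (flipFilling k V e σ) = (weight σ).mapDomain (flipIndex k) := by
  simp only [weight, Finsupp.mapDomain_finsetSum, Finsupp.mapDomain_single]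
  refine Fintype.sum_equiv e.symm _ _ fun q => ?_
  rw [flipFilling, Finset.sum_image (flipLetter_injOn (hk _))]
  rfl

theorem size_flipFilling {σ : P → Finset Marked}
    (hk : ∀ s, ∀ x ∈ σ s, (absVal x).natPred < k) : size (flipFilling k V e σ) = size σ :=
  Fintype.sum_equiv e.symm _ _ fun _ => Finset.card_image_of_injOn (flipLetter_injOn (hk _))

/-- Weight enumerators of antiisomorphic labeled posets have reversed coefficients. -/
theorem isReversal_OmegaV (e : P ≃ Q) (he : ∀ s t, e t ⋖ e s ↔ s ⋖ t)
    (hγ : ∀ s t, s ⋖ t → γ s ≠ γ t) (hV : IsValleySet γ V) (hγ' : ∀ s, γ' (e s) = γ s)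
    (hV' : ∀ s, e s ∈ V' ↔ s ∈ V) : IsReversal (OmegaV γ V) (OmegaV γ' V') := by
  intro n α
  have h1 : ∀ {σ : P → Finset Marked}, weight σ = packed α →
      ∀ s, ∀ x ∈ σ s, (absVal x).natPred < α.length := by
    intro σ h s x hx
    exact natPred_lt_of_mem_support_packed (h ▸ mem_support_weight.2 ⟨s, x, hx, rfl⟩)
  have hl : α.reverse.length = α.length := by simp [Composition.length]
  have h2 : ∀ {σ : Q → Finset Marked}, weight σ = packed α.reverse →
      ∀ s, ∀ x ∈ σ s, (absVal x).natPred < α.length := by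
    intro σ h s x hx
    rw [← hl]
    exact natPred_lt_of_mem_support_packed (h ▸ mem_support_weight.2 ⟨s, x, hx, rfl⟩)
  have he' : ∀ s t, e.symm t ⋖ e.symm s ↔ s ⋖ t := fun s t => by
    rw [← he, Equiv.apply_symm_apply, Equiv.apply_symm_apply]
  have hγs : ∀ s, γ (e.symm s) = γ' s := fun s => by rw [← hγ', Equiv.apply_symm_apply]
  have hVs : ∀ s, e.symm s ∈ V ↔ s ∈ V' := fun s => by rw [← hV', Equiv.apply_symm_apply]
  have hγ2 : ∀ s t, s ⋖ t → γ' s ≠ γ' t := fun s t hst => by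
    rw [← hγs, ← hγs]
    exact (hγ _ _ ((he' s t).2 hst)).symm
  have hV2 : IsValleySet γ' V' := by
    intro v hv s
    rw [← hγs, ← hγs, ← he' s v, ← he' v s]
    exact (hV _ ((hVs v).2 hv) _).symm
  change (∑ᶠ σ ∈ {σ | σ ∈ enriched γ' V' ∧ weight σ = packed α.reverse},
      β ^ (size σ - Fintype.card Q))
    = ∑ᶠ σ ∈ {σ | σ ∈ enriched γ V ∧ weight σ = packed α}, β ^ (size σ - Fintype.card P)
  symm
  refine finsum_mem_eq_of_bijOn (flipFilling α.length V e) ?_ ?_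
  · refine Set.InvOn.bijOn (f' := flipFilling α.length V' e.symm) ⟨?_, ?_⟩ ?_ ?_
    · rintro σ ⟨-, h⟩
      exact flipFilling_flipFilling hV' (h1 h)
    · rintro σ ⟨-, h⟩
      exact flipFilling_flipFilling hVs (h2 h)
    · rintro σ ⟨hσ, h⟩
      refine ⟨flipFilling_mem hγ hV (fun s t => (he s t).1) hγ' (fun s => (hV' s).1) hσ (h1 h), ?_⟩
      rw [weight_flipFilling (h1 h), h, packed_reverse]
    · rintro σ ⟨hσ, h⟩
      refine ⟨flipFilling_mem hγ2 hV2 (fun s t => (he' s t).1) hγs (fun s => (hVs s).1) hσ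
        (h2 h), ?_⟩
      rw [weight_flipFilling (h2 h), h, ← hl, ← packed_reverse, Composition.reverse_reverse]
  · rintro σ ⟨-, h⟩
    rw [size_flipFilling (h1 h), Fintype.card_congr e]

end Reversal

/-! ### Moving a valley along an edge -/

section Slide

open scoped Classical

set_option linter.unusedSectionVars false

/-- Once all terms containing ba are dropped, the sides differ only in ab² versus a²b, and both
equal wab. -/
theorem mul_mul_mul_eq_of_mul_eq_zero {A : Type*} [Ring A] {a b w : A} (hw : Commute a w)
    (ha : a * a = w * a) (hb : b * b = w * b) (hba : b * a = 0) :
    (1 + a) * (1 + b) * ((1 + b) * (1 + a)) = (1 + b) * (1 + a) * ((1 + a) * (1 + b)) := by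
  have h1 : a * (b * b) = a * a * b := by rw [hb, ← mul_assoc, hw.eq, ha]
  have h2 : (1 + a) * (1 + b) * ((1 + b) * (1 + a)) = 1 + 2 * a + a * a + 2 * b + b * b
      + 2 * (a * b) + a * (b * b) + 2 * (b * a) + b * (b * a) + 2 * (a * (b * a))
      + a * (b * (b * a)) := by noncomm_ring
  have h3 : (1 + b) * (1 + a) * ((1 + a) * (1 + b)) = 1 + 2 * a + a * a + 2 * b + b * b
      + 2 * (a * b) + a * a * b + 2 * (b * a) + (b * a) * a + 2 * (b * a * b)
      + b * a * a * b := by noncomm_ring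
  rw [h2, h3, h1, hba]
  simp

/-- The products aba-type and bab-type are not equal here, only conjugate up to an intertwiner s.
The third relation rewrites bs and sa in terms of each other. -/
theorem mul_mul_eq_of_intertwine {A : Type*} [Ring A] {a b s : A} (h1 : a * s = a)
    (h2 : s * b = b) (h3 : b * s + 2 * a = s * a + 2 * b) (hba : b * a = 0) :
    (1 + a) * ((1 + b) * (1 + a)) * s = s * ((1 + b) * ((1 + a) * (1 + b))) := by
  have e1 : b * s = s * a + 2 * b - 2 * a := by rw [← h3]; noncomm_ring
  have e2 : s * a = b * s + 2 * a - 2 * b := by rw [h3]; noncomm_ring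
  have h4 : (1 + a) * ((1 + b) * (1 + a)) * s = s + 2 * (a * s) + a * (a * s) + b * s
      + a * (b * s) + b * a * s + a * (b * a) * s := by noncomm_ring
  have h5 : s * ((1 + b) * ((1 + a) * (1 + b))) = s + 2 * (s * b) + s * b * b + s * a
      + s * a * b + s * (b * a) + s * (b * a) * b := by noncomm_ring
  have h6 : a * (b * s) = 2 * (a * b) - a * a := by
    rw [e1]
    calc a * (s * a + 2 * b - 2 * a) = a * s * a + 2 * (a * b) - 2 * (a * a) := by noncomm_ring
      _ = _ := by rw [h1]; noncomm_ring
  have h7 : s * a * b = 2 * (a * b) - b * b := by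
    rw [e2]
    calc (b * s + 2 * a - 2 * b) * b = b * (s * b) + 2 * (a * b) - 2 * (b * b) := by noncomm_ring
      _ = _ := by rw [h2]; noncomm_ring
  rw [h4, h5, h6, h7, h1, h2, hba, e1]
  simp only [zero_mul, mul_zero, add_zero]
  abel

variable {P : Type*} [PartialOrder P] [Fintype P]

/-- The edge `a ⋖ b` is the only edge going up from `a` and the only edge going down from `b`. -/
structure IsIsolatedEdge (a b : P) : Prop where
  covBy : a ⋖ b
  eq_of_covBy : ∀ t, a ⋖ t → t = b
  eq_of_covBy' : ∀ t, t ⋖ b → t = a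

/-- States in which `a` but not `b` has received its largest letter. -/
def IsHalf (a b : P) (U : Finset P) : Prop := IsUpperSet (U : Set P) ∧ a ∉ U ∧ b ∈ U

/-- The matrix which intertwines the operators for valleys at `b` and at `a`. -/
noncomputable def slideMatrix (a b : P) : StateMatrix P := fun U K =>
  if IsHalf a b U then (if U = K then 1 else 0) - β * (if insert a U = K then 1 else 0)
  else 2 * (if U = K then 1 else 0)

theorem slideMatrix_mul_apply (a b : P) (N : StateMatrix P) (U K : Finset P) :
    (slideMatrix a b * N) U K
      = if IsHalf a b U then N U K - β * N (insert a U) K else 2 * N U K := by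
  rw [Matrix.mul_apply]
  split_ifs with h
  · simp only [slideMatrix, if_pos h, sub_mul, ite_mul, one_mul, zero_mul, Finset.sum_sub_distrib,
      Finset.sum_ite_eq, Finset.mem_univ, if_true, mul_assoc, ← Finset.mul_sum]
  · simp only [slideMatrix, if_neg h, mul_assoc, ite_mul, one_mul, zero_mul, ← Finset.mul_sum,
      Finset.sum_ite_eq, Finset.mem_univ, if_true]

variable {a b : P}

theorem IsHalf.isUpperSet_insert (h : IsIsolatedEdge a b) {U : Finset P} (hU : IsHalf a b U) :
    IsUpperSet ((insert a U : Finset P) : Set P) := by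
  intro t t' htt' ht
  rw [Finset.mem_coe, Finset.mem_insert] at ht ⊢
  rcases ht with rfl | ht
  · rcases eq_or_lt_of_le htt' with rfl | hlt
    · exact Or.inl rfl
    · obtain ⟨r, hr, hrt⟩ := exists_covBy_le_of_lt hlt
      rw [h.eq_of_covBy r hr] at hrt
      exact Or.inr (hU.1 hrt hU.2.2)
  · exact Or.inr (hU.1 htt' ht)

theorem isMinOf_insert (h : IsIsolatedEdge a b) {U : Finset P} (hU : IsHalf a b U) :
    IsMinOf a (insert a U) := by
  refine ⟨hU.isUpperSet_insert h, Finset.mem_insert_self _ _, fun t ht hta => ?_⟩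
  rcases Finset.mem_insert.1 ht with rfl | ht
  · exact hta.lt.ne rfl
  · exact hU.2.1 (hU.1 hta.le ht)

theorem isMinOf_right_iff (h : IsIsolatedEdge a b) {U : Finset P} :
    IsMinOf b U ↔ IsHalf a b U := by
  constructor
  · rintro ⟨h1, h2, h3⟩
    exact ⟨h1, fun ha => h3 a ha h.covBy, h2⟩
  · rintro ⟨h1, h2, h3⟩
    exact ⟨h1, h3, fun t ht htb => h2 (h.eq_of_covBy' t htb ▸ ht)⟩

theorem not_isMinOf_left {U : Finset P} (hU : IsHalf a b U) : ¬ IsMinOf a U := fun h => hU.2.1 h.2.1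

theorem isHalf_erase (h : IsIsolatedEdge a b) {U : Finset P} (hU : IsMinOf a U) :
    IsHalf a b (U.erase a) :=
  ⟨hU.isUpperSet_erase, Finset.notMem_erase _ _,
    Finset.mem_erase.2 ⟨h.covBy.lt.ne', hU.1 h.covBy.le hU.2.1⟩⟩

/-- The box b can receive a letter only after a is complete, and then a accepts no more letters. -/
theorem boxOp_mul_boxOp_eq_zero (h : IsIsolatedEdge a b) : boxOp b * boxOp a = 0 := by
  ext1 U K
  rw [boxOp_mul_apply]
  split_ifs with hU
  · have h1 := (isMinOf_right_iff h).1 hU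
    rw [boxOp, boxOp, if_neg (not_isMinOf_left h1), if_neg fun h2 =>
      h1.2.1 (Finset.mem_of_mem_erase h2.2.1), mul_zero, add_zero]
    rfl
  · rfl

/-- Write S for `slideMatrix a b`. Completing a leads to a half state, where S subtracts β times the
state U; staying in U gives 2β times U. The sum is again one β. -/
theorem boxOp_mul_slideMatrix (h : IsIsolatedEdge a b) : boxOp a * slideMatrix a b = boxOp a := by
  ext1 U K
  rw [boxOp_mul_apply]
  split_ifs with hU
  · rw [boxOp, if_pos hU, slideMatrix, slideMatrix, if_pos (isHalf_erase h hU),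
      if_neg fun h' : IsHalf a b U => h'.2.1 hU.2.1, Finset.insert_erase hU.2.1]
    ring
  · rw [boxOp, if_neg hU]

theorem slideMatrix_mul_boxOp (h : IsIsolatedEdge a b) : slideMatrix a b * boxOp b = boxOp b := by
  ext1 U K
  rw [slideMatrix_mul_apply]
  split_ifs with hU
  · have h1 : boxOp b (insert a U) K = 0 :=
      if_neg fun h' => h'.2.2 a (Finset.mem_insert_self _ _) h.covBy
    rw [h1, mul_zero, sub_zero]
  · rw [boxOp, if_neg fun h' => hU ((isMinOf_right_iff h).1 h'), mul_zero]

theorem boxOp_slideMatrix_add (h : IsIsolatedEdge a b) :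
    boxOp b * slideMatrix a b + 2 * boxOp a = slideMatrix a b * boxOp a + 2 * boxOp b := by
  ext1 U K
  rw [Matrix.add_apply, Matrix.add_apply, two_mul, two_mul, Matrix.add_apply, Matrix.add_apply,
    boxOp_mul_apply, slideMatrix_mul_apply]
  by_cases hU : IsHalf a b U
  · have hb := (isMinOf_right_iff h).2 hU
    rw [if_pos hb, if_pos hU, boxOp, boxOp, boxOp, if_neg (not_isMinOf_left hU),
      if_pos (isMinOf_insert h hU), if_pos hb, slideMatrix, slideMatrix, if_pos hU,
      if_neg fun h' : IsHalf a b (U.erase b) => Finset.notMem_erase b U h'.2.2,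
      Finset.erase_insert hU.2.1]
    ring
  · have hb : ¬ IsMinOf b U := fun h' => hU ((isMinOf_right_iff h).1 h')
    rw [if_neg hb, if_neg hU]
    have h1 : boxOp b U K = 0 := if_neg hb
    rw [h1]
    ring

theorem isMinOf_insert_iff (h : IsIsolatedEdge a b) {s : P} (ha : s ≠ a) (hb : s ≠ b)
    {U : Finset P} (hU : IsHalf a b U) : IsMinOf s (insert a U) ↔ IsMinOf s U := by
  constructor
  · rintro ⟨-, h2, h3⟩
    exact ⟨hU.1, (Finset.mem_insert.1 h2).resolve_left ha,
      fun t ht => h3 t (Finset.mem_insert_of_mem ht)⟩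
  · rintro ⟨-, h2, h3⟩
    refine ⟨hU.isUpperSet_insert h, Finset.mem_insert_of_mem h2, fun t ht hts => ?_⟩
    rcases Finset.mem_insert.1 ht with rfl | ht
    · exact hb (h.eq_of_covBy s hts)
    · exact h3 t ht hts

/-- S can only change whether a is pending. Boxes other than a and b do not notice this, since b
alone covers a. -/
theorem commute_boxOp_slideMatrix (h : IsIsolatedEdge a b) {s : P} (ha : s ≠ a) (hb : s ≠ b) :
    Commute (boxOp s) (slideMatrix a b) := by
  ext1 U K
  rw [boxOp_mul_apply, slideMatrix_mul_apply]
  by_cases hU : IsHalf a b U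
  · rw [if_pos hU]
    by_cases hs : IsMinOf s U
    · have h1 : IsHalf a b (U.erase s) := ⟨hs.isUpperSet_erase, fun h' => hU.2.1
        (Finset.mem_of_mem_erase h'), Finset.mem_erase.2 ⟨hb.symm, hU.2.2⟩⟩
      rw [if_pos hs, slideMatrix, slideMatrix, if_pos h1, if_pos hU, boxOp, boxOp, if_pos hs,
        if_pos ((isMinOf_insert_iff h ha hb hU).2 hs), Finset.erase_insert_of_ne ha.symm]
      ring
    · rw [if_neg hs, boxOp, boxOp, if_neg hs, if_neg fun h' =>
        hs ((isMinOf_insert_iff h ha hb hU).1 h')]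
      ring
  · rw [if_neg hU]
    by_cases hs : IsMinOf s U
    · have h1 : ¬ IsHalf a b (U.erase s) := fun h' => hU ⟨hs.1, fun h2 => h'.2.1
        (Finset.mem_erase.2 ⟨ha.symm, h2⟩), Finset.mem_of_mem_erase h'.2.2⟩
      rw [if_pos hs, slideMatrix, slideMatrix, if_neg h1, if_neg hU, boxOp, if_pos hs]
      ring
    · rw [if_neg hs, boxOp, if_neg hs, mul_zero]

theorem commute_boxPoly_slideMatrix (h : IsIsolatedEdge a b) {L : List P} (ha : a ∉ L)
    (hb : b ∉ L) : Commute (boxPoly L) (Polynomial.C (slideMatrix a b)) := by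
  refine Commute.list_prod_left _ _ fun x hx => ?_
  obtain ⟨s, hs, rfl⟩ := List.mem_map.1 hx
  have h1 := (commute_boxOp_slideMatrix h (ne_of_mem_of_not_mem hs ha)
    (ne_of_mem_of_not_mem hs hb)).map Polynomial.C
  exact (Commute.one_left _).add_left (h1.mul_left (Polynomial.commute_X _))

variable {γ γ' : P → ℤ} {V V' : Set P}

theorem boxPoly_slide_plain (h : IsIsolatedEdge a b) :
    boxPoly [a, b] * boxPoly [b, a] = boxPoly [b, a] * boxPoly [a, b] := by
  have hX : ∀ u v : StateMatrix P, Polynomial.C u * Polynomial.X * (Polynomial.C v * Polynomial.X)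
      = Polynomial.C (u * v) * Polynomial.X * Polynomial.X := by
    intro u v
    rw [mul_assoc, Polynomial.X_mul, map_mul]
    simp only [mul_assoc]
  simp only [boxPoly, List.map_cons, List.map_nil, List.prod_cons, List.prod_nil, mul_one]
  have hw : ∀ u : StateMatrix P, Commute (Polynomial.C u * Polynomial.X)
      (Polynomial.C (algebraMap ℤ[X] (StateMatrix P) β) * Polynomial.X) := by
    intro u
    rw [Commute, SemiconjBy, hX, hX, Algebra.commutes]
  refine mul_mul_mul_eq_of_mul_eq_zero (hw _) ?_ ?_ ?_
  · rw [hX, hX, boxOp_mul_self, Algebra.smul_def]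
  · rw [hX, hX, boxOp_mul_self, Algebra.smul_def]
  · rw [hX, boxOp_mul_boxOp_eq_zero h, map_zero, zero_mul, zero_mul]

/-- The valley box takes no primed letter, so each side has three factors instead of four. -/
theorem boxPoly_slide_valley (h : IsIsolatedEdge a b) :
    boxPoly [a] * boxPoly [b, a] * Polynomial.C (slideMatrix a b)
      = Polynomial.C (slideMatrix a b) * (boxPoly [b] * boxPoly [a, b]) := by
  have hX : ∀ u v : StateMatrix P, Polynomial.C u * Polynomial.X * Polynomial.C v
      = Polynomial.C (u * v) * Polynomial.X := by
    intro u v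
    rw [mul_assoc, Polynomial.X_mul, map_mul, mul_assoc]
  simp only [boxPoly, List.map_cons, List.map_nil, List.prod_cons, List.prod_nil, mul_one]
  refine mul_mul_eq_of_intertwine ?_ ?_ ?_ ?_
  · rw [hX, boxOp_mul_slideMatrix h]
  · rw [← mul_assoc, ← map_mul, slideMatrix_mul_boxOp h]
  · have h1 := congrArg (fun M => Polynomial.C M * Polynomial.X) (boxOp_slideMatrix_add h)
    simp only [map_add, map_mul, two_mul, add_mul, mul_assoc] at h1
    rw [hX, map_mul, two_mul, two_mul]
    simpa only [mul_assoc] using h1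
  · rw [← mul_assoc, hX, boxOp_mul_boxOp_eq_zero h, map_zero, zero_mul, zero_mul]

theorem prod_intertwine {A : Type*} [Ring A] {S : A} {ι : Type*} {B B' : ι → A}
    (h : ∀ i, B i * S = S * B' i) (ls : List ι) : (ls.map B).prod * S = S * (ls.map B').prod := by
  induction ls with
  | nil => simp
  | cons i ls ih =>
    rw [List.map_cons, List.map_cons, List.prod_cons, List.prod_cons, mul_assoc, ih, ← mul_assoc, h,
      mul_assoc]

/-- A valley may be moved along an isolated edge. -/
theorem OmegaV_slide (h : IsIsolatedEdge a b) (h1 : γ b < γ a) (h2 : ∀ s, s ≠ a → s ≠ b → γ a < γ s)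
    (h1' : γ' a < γ' b) (h2' : ∀ s, s ≠ a → s ≠ b → γ' b < γ' s)
    (hγ : ∀ s, s ≠ a → s ≠ b → γ' s = γ s) (hγ0 : ∀ s t, s ⋖ t → γ s ≠ γ t)
    (hγ0' : ∀ s t, s ⋖ t → γ' s ≠ γ' t)
    (hV : ∀ s, s ≠ a → s ≠ b → (s ∈ V ↔ s ∈ V'))
    (hab : (a ∉ V ∧ b ∈ V ∧ a ∈ V' ∧ b ∉ V') ∨ (a ∉ V ∧ b ∉ V ∧ a ∉ V' ∧ b ∉ V')) :
    OmegaV γ V = OmegaV γ' V' := by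
  have hne := h.covBy.lt.ne
  obtain ⟨l0, hn0, hl0, hc0⟩ := exists_sorted_list γ
  set l := l0.filter fun s => s ≠ a ∧ s ≠ b with hl
  have hmem : ∀ s, s ∈ l ↔ s ≠ a ∧ s ≠ b := by simp [hl, hc0]
  have hnl : l.Nodup := hn0.filter _
  have hll : l.Pairwise fun s t => γ s ≤ γ t := hl0.filter _
  have ha : a ∉ l := fun h => ((hmem a).1 h).1 rfl
  have hb : b ∉ l := fun h => ((hmem b).1 h).2 rfl
  have hexp := hasExpansion_OmegaV hγ0 (l := b :: a :: l) (by simp [hnl, ha, hb, hne.symm])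
    (by
      refine List.pairwise_cons.2 ⟨?_, List.pairwise_cons.2 ⟨fun s hs => ?_, hll⟩⟩
      · intro s hs
        rcases List.mem_cons.1 hs with rfl | hs
        · exact h1.le
        · exact (h1.trans (h2 s ((hmem s).1 hs).1 ((hmem s).1 hs).2)).le
      · exact (h2 s ((hmem s).1 hs).1 ((hmem s).1 hs).2).le)
    (by intro s; simp only [List.mem_cons, hmem]; tauto) V
  have hexp' := hasExpansion_OmegaV hγ0' (l := a :: b :: l) (by simp [hnl, ha, hb, hne])
    (by
      refine List.pairwise_cons.2 ⟨?_, List.pairwise_cons.2 ⟨fun s hs => ?_, ?_⟩⟩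
      · intro s hs
        rcases List.mem_cons.1 hs with rfl | hs
        · exact h1'.le
        · exact (h1'.trans (h2' s ((hmem s).1 hs).1 ((hmem s).1 hs).2)).le
      · exact (h2' s ((hmem s).1 hs).1 ((hmem s).1 hs).2).le
      · refine hll.imp_of_mem fun {s t} hs ht hst => ?_
        rwa [hγ s ((hmem s).1 hs).1 ((hmem s).1 hs).2, hγ t ((hmem t).1 ht).1 ((hmem t).1 ht).2])
    (by intro s; simp only [List.mem_cons, hmem]; tauto) V'
  set R := l.reverse.filter fun s => s ∉ V with hR
  have hR' : (l.reverse.filter fun s => s ∉ V') = R := by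
    rw [hR]
    refine List.filter_congr fun s hs => ?_
    have hs' := (hmem s).1 (List.mem_reverse.1 hs)
    simp only [hV s hs'.1 hs'.2]
  have hRa : a ∉ R := fun h => ha (List.mem_reverse.1 (List.mem_of_mem_filter h))
  have hRb : b ∉ R := fun h => hb (List.mem_reverse.1 (List.mem_of_mem_filter h))
  -- As a and b carry the two smallest labels, their factors sit together in the middle of the
  -- product, and only that middle differs between the two labelings.
  have ho : boxPoly (boxOrder (b :: a :: l) V) = boxPoly R *
      (boxPoly ([a, b].filter fun s => s ∉ V) * boxPoly [b, a]) * boxPoly l := by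
    rw [← boxPoly_append, ← boxPoly_append, ← boxPoly_append, boxOrder, List.reverse_cons,
      List.reverse_cons, List.filter_append, List.filter_append, ← hR,
      show [a, b] = [a] ++ [b] from rfl, List.filter_append]
    simp only [List.append_assoc]
    rfl
  have ho' : boxPoly (boxOrder (a :: b :: l) V') = boxPoly R *
      (boxPoly ([b, a].filter fun s => s ∉ V') * boxPoly [a, b]) * boxPoly l := by
    rw [← boxPoly_append, ← boxPoly_append, ← boxPoly_append, boxOrder, List.reverse_cons,
      List.reverse_cons, List.filter_append, List.filter_append, hR',
      show [b, a] = [b] ++ [a] from rfl, List.filter_append]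
    simp only [List.append_assoc]
    rfl
  have key : ∀ ls : List ℕ, fullEntry P (ls.map (boxPoly (boxOrder (b :: a :: l) V)).coeff).prod
      = fullEntry P (ls.map (boxPoly (boxOrder (a :: b :: l) V')).coeff).prod := by
    rcases hab with ⟨v1, v2, v3, v4⟩ | ⟨v1, v2, v3, v4⟩
    · have hs : boxPoly (boxOrder (b :: a :: l) V) * Polynomial.C (slideMatrix a b)
          = Polynomial.C (slideMatrix a b) * boxPoly (boxOrder (a :: b :: l) V') := by
        have e1 : ([a, b].filter fun s => s ∉ V) = [a] := by simp [v1, v2]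
        have e2 : ([b, a].filter fun s => s ∉ V') = [b] := by simp [v3, v4]
        rw [ho, ho', e1, e2, mul_assoc, (commute_boxPoly_slideMatrix h ha hb).eq, ← mul_assoc,
          mul_assoc (boxPoly R), boxPoly_slide_valley h, ← mul_assoc,
          (commute_boxPoly_slideMatrix h hRa hRb).eq]
        simp only [mul_assoc]
      have hc : ∀ i, (boxPoly (boxOrder (b :: a :: l) V)).coeff i * slideMatrix a b
          = slideMatrix a b * (boxPoly (boxOrder (a :: b :: l) V')).coeff i := by
        intro i
        rw [← Polynomial.coeff_mul_C, hs, Polynomial.coeff_C_mul]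
      intro ls
      have h5 := congrFun (congrFun (prod_intertwine hc ls) Finset.univ) ∅
      -- The full state is not a half state, so S multiplies its row by 2; in the column ∅ only the
      -- row ∅ of S is nonzero, again with entry 2. Cancelling 2 in ℤ[β] leaves the required entries
      -- equal.
      rw [slideMatrix_mul_apply, if_neg fun h' => h'.2.1 (Finset.mem_univ _), Matrix.mul_apply,
        Finset.sum_eq_single ∅] at h5
      · rw [slideMatrix, if_neg fun h' => Finset.notMem_empty _ h'.2.2, if_pos rfl, mul_one,
          mul_comm] at h5
        exact mul_left_cancel₀ two_ne_zero h5
      · intro K _ hK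
        rw [slideMatrix, if_neg hK, if_neg (Finset.insert_ne_empty _ _)]
        simp
      · exact fun h' => absurd (Finset.mem_univ _) h'
    · have e1 : ([a, b].filter fun s => s ∉ V) = [a, b] := by simp [v1, v2]
      have e2 : ([b, a].filter fun s => s ∉ V') = [b, a] := by simp [v3, v4]
      intro ls
      rw [ho, ho', e1, e2, boxPoly_slide_plain h]
  refine Subtype.ext (MvPowerSeries.ext fun m => ?_)
  have hs := (Finset.sortedLT_sort m.support).pairwise
  rw [hexp m.support.sort m hs fun i hi => (Finset.mem_sort _).2 hi,
    hexp' m.support.sort m hs fun i hi => (Finset.mem_sort _).2 hi]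
  have := key (m.support.sort.map m)
  rw [List.map_map, List.map_map] at this
  exact this

end Slide

/-! ### Chains -/

section Chains

/-- Labelings of a chain with descent set `D`. -/
def IsChainLabeling (D : Finset ℕ) (γ : Fin n → ℤ) : Prop :=
  ∀ i j : Fin n, (j : ℕ) = i + 1 → ((j : ℕ) ∈ D → γ j < γ i) ∧ ((j : ℕ) ∉ D → γ i < γ j)

/-- A labeling of a chain with descent set `D`. -/
def chainLabel (D : Finset ℕ) (i : Fin n) : ℤ :=
  ∑ j ∈ Finset.range i, if j + 1 ∈ D then -1 else 1

/-- Such labels may repeat at distant boxes. The weight enumerators only compare labels along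
covers, which is why distinctness is required there and not globally. -/
theorem isChainLabeling_chainLabel (D : Finset ℕ) :
    IsChainLabeling D (chainLabel D : Fin n → ℤ) := by
  intro i j h
  simp only [chainLabel, h, Finset.sum_range_succ]
  constructor <;> intro h' <;> simp [h']

theorem neg_le_chainLabel (D : Finset ℕ) (i : Fin n) : -(n : ℤ) ≤ chainLabel D i := by
  have h : ∀ k : ℕ, -(k : ℤ) ≤ ∑ j ∈ Finset.range k, if j + 1 ∈ D then (-1 : ℤ) else 1 := by
    intro k
    induction k with
    | zero => simp
    | succ k ih =>
      rw [Finset.sum_range_succ]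
      split_ifs <;> push_cast <;> omega
  have h1 := h i
  have h2 := i.2
  rw [chainLabel]
  omega

theorem fin_covBy_iff {i j : Fin n} : i ⋖ j ↔ (j : ℕ) = i + 1 := by
  constructor
  · intro h
    by_contra hne
    have h1 := Fin.lt_def.1 h.lt
    have h2 := j.2
    refine h.2 (c := ⟨i + 1, by omega⟩) ?_ ?_ <;> rw [Fin.lt_def] <;> simp only <;> omega
  · intro h
    refine ⟨Fin.lt_def.2 (by omega), fun k h1 h2 => ?_⟩
    rw [Fin.lt_def] at h1 h2
    omega

variable {D : Finset ℕ} {γ γ' : Fin n → ℤ} {V : Set (Fin n)}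

theorem IsChainLabeling.ne_of_covBy (h : IsChainLabeling D γ) {i j : Fin n} (hij : i ⋖ j) :
    γ i ≠ γ j := by
  have h1 := h i j (fin_covBy_iff.1 hij)
  by_cases hD : (j : ℕ) ∈ D
  · exact (h1.1 hD).ne'
  · exact (h1.2 hD).ne

theorem IsChainLabeling.lt_iff (h : IsChainLabeling D γ) {i j : Fin n} (hij : i ⋖ j) :
    γ i < γ j ↔ (j : ℕ) ∉ D := by
  have h1 := h i j (fin_covBy_iff.1 hij)
  exact ⟨fun h2 hD => lt_asymm h2 (h1.1 hD), h1.2⟩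

theorem IsChainLabeling.gt_iff (h : IsChainLabeling D γ) {i j : Fin n} (hij : i ⋖ j) :
    γ j < γ i ↔ (j : ℕ) ∈ D := by
  have h1 := h i j (fin_covBy_iff.1 hij)
  exact ⟨fun h2 => by_contra fun hD => lt_asymm h2 (h1.2 hD), h1.1⟩

theorem IsChainLabeling.enriched_eq (h : IsChainLabeling D γ) (V : Set (Fin n)) :
    enriched γ V = {S | (∀ i, (S i).Nonempty) ∧
      (∀ i j : Fin n, (j : ℕ) = i + 1 → WeakLE (S i) (S j) ∧
        ((j : ℕ) ∈ D → ∀ x ∈ S i, x ∈ S j → IsPrimed x) ∧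
        ((j : ℕ) ∉ D → ∀ x ∈ S i, x ∈ S j → IsUnprimed x)) ∧
      ∀ v ∈ V, ∀ x ∈ S v, IsUnprimed x} := by
  ext S
  refine and_congr_right fun _ => and_congr_left fun _ => forall₂_congr fun i j => ?_
  rw [← fin_covBy_iff]
  refine forall_congr' fun hij => and_congr_right fun _ => ?_
  rw [h.lt_iff hij, h.gt_iff hij, and_comm]

theorem OmegaV_eq_of_enriched_eq {P : Type*} [PartialOrder P] [Fintype P] {γ γ' : P → ℤ}
    {V V' : Set P} (h : enriched γ V = enriched γ' V') : OmegaV γ V = OmegaV γ' V' :=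
  Subtype.ext (congrArg enumerator h)

theorem IsChainLabeling.OmegaV_eq (h : IsChainLabeling D γ) (h' : IsChainLabeling D γ')
    (V : Set (Fin n)) : OmegaV γ V = OmegaV γ' V :=
  OmegaV_eq_of_enriched_eq (by rw [h.enriched_eq, h'.enriched_eq])

/-- The valleys of a chain with descent set `D` if `c` holds, and no elements otherwise. -/
def valleys (c : Prop) (D : Finset ℕ) : Set (Fin n) :=
  {j | c ∧ ((j : ℕ) = 0 ∨ (j : ℕ) ∈ D) ∧ (j : ℕ) + 1 ∉ D}

theorem IsChainLabeling.isValleySet (h : IsChainLabeling D γ) (c : Prop) :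
    IsValleySet γ (valleys c D) := by
  rintro v ⟨-, h1, h2⟩ s
  refine ⟨fun hs => ?_, fun hs => ?_⟩
  · have h3 := fin_covBy_iff.1 hs
    exact (h.gt_iff hs).2 (h1.resolve_left (by omega))
  · have h3 := fin_covBy_iff.1 hs
    rw [h.lt_iff hs, h3]
    exact h2

/-- The weight enumerator of the chain of `n` elements with descent set `D`, with or without a
condition on the valleys. -/
noncomputable def chainOmega (n : ℕ) (c : Prop) (D : Finset ℕ) : QSym :=
  OmegaV (chainLabel D : Fin n → ℤ) (valleys c D)

theorem psi_chainOmega (c : Prop) (D : Finset ℕ) :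
    (psi (chainOmega n c D) : Series) = substGeom (chainOmega n c D) :=
  psi_OmegaV (fun _ _ => (isChainLabeling_chainLabel D).ne_of_covBy)
    ((isChainLabeling_chainLabel D).isValleySet c)

theorem omega_chainOmega {c : Prop} {D : Finset ℕ} {f : QSym}
    (h : IsReversal f (chainOmega n c D)) : (omega f : Series) = substGeom (chainOmega n c D) :=
  omega_eq_substGeom_OmegaV (fun _ _ => (isChainLabeling_chainLabel D).ne_of_covBy)
    ((isChainLabeling_chainLabel D).isValleySet c) h

/-- Turning the chain upside down with the same labels sends position j to n - j and exchanges
ascents with descents; its valleys stay valleys. -/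
theorem isReversal_chainOmega (c : Prop) {D : Finset ℕ} (hD : D ⊆ Finset.Ico 1 n) :
    IsReversal (chainOmega n c D)
      (chainOmega n c ((Finset.Ico 1 n).filter fun j => n - j ∉ D)) := by
  set D' := (Finset.Ico 1 n).filter fun j => n - j ∉ D with hD'
  have hmem : ∀ j, j ∈ D' ↔ (1 ≤ j ∧ j < n) ∧ n - j ∉ D := by
    intro j
    rw [hD', Finset.mem_filter, Finset.mem_Ico]
  have hlab := isChainLabeling_chainLabel (n := n) D
  have hlab' : IsChainLabeling D' fun i : Fin n => chainLabel D i.rev := by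
    intro i j hij
    have h1 := j.2
    have h2 := hlab j.rev i.rev (by rw [Fin.val_rev, Fin.val_rev]; omega)
    have h3 : (i.rev : ℕ) = n - j := by rw [Fin.val_rev]; omega
    rw [h3] at h2
    rw [hmem]
    exact ⟨fun h => h2.2 h.2, fun h => h2.1 (by_contra fun h' => h ⟨⟨by omega, h1⟩, h'⟩)⟩
  rw [chainOmega, chainOmega, (isChainLabeling_chainLabel D').OmegaV_eq hlab']
  refine isReversal_OmegaV Fin.revPerm (fun s t => ?_) (fun _ _ => hlab.ne_of_covBy)
    (hlab.isValleySet c) (fun s => ?_) fun s => ?_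
  · rw [fin_covBy_iff, fin_covBy_iff, Fin.revPerm_apply, Fin.revPerm_apply, Fin.val_rev,
      Fin.val_rev]
    omega
  · rw [Fin.revPerm_apply, Fin.rev_rev]
  · rw [Fin.revPerm_apply]
    refine and_congr_right fun _ => ?_
    have hs := s.2
    rw [hmem, hmem, Fin.val_rev]
    have e1 : n - (n - (↑s + 1)) = s + 1 := by omega
    have e2 : n - (n - (↑s + 1) + 1) = s := by omega
    rw [e1, e2]
    have hn : ∀ j ∈ D, 1 ≤ j ∧ j < n := fun j hj => Finset.mem_Ico.1 (hD hj)
    constructor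
    · rintro ⟨h1, h2⟩
      refine ⟨?_, fun h => ?_⟩
      · by_contra! h
        exact h2 ⟨by omega, h.2⟩
      · have := hn _ h
        rcases h1 with h1 | h1
        · omega
        · exact h1.2 h
    · rintro ⟨h1, h2⟩
      refine ⟨?_, fun h => ?_⟩
      · by_cases h3 : n - ((s : ℕ) + 1) = 0
        · exact Or.inl h3
        · exact Or.inr ⟨by omega, h2⟩
      · rcases h1 with h1 | h1
        · omega
        · exact h.2 h1

/-- The descent p ends a descending run that either has another descent just before p or starts at
the bottom of the chain. The box at index p is then a valley, and it may exchange order with the box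
at p - 1, which becomes the valley. -/
theorem chainOmega_erase (c : Prop) {D : Finset ℕ} {p : ℕ} (hp : p ∈ D) (h0 : 1 ≤ p) (hn : p < n)
    (h1 : p = 1 ∨ p - 1 ∈ D) (h2 : p + 1 ∉ D) :
    chainOmega n c D = chainOmega n c (D.erase p) := by
  -- The boxes p - 1 and p get the labels u and v from {0, 1}; the shift by n + 2 puts all other
  -- labels above them, as `OmegaV_slide` requires.
  let γ : ℤ → ℤ → Fin n → ℤ := fun u v i =>
    if (i : ℕ) = p - 1 then u else if (i : ℕ) = p then v else chainLabel D i + n + 2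
  have hpos : ∀ i : Fin n, 2 ≤ chainLabel D i + n + 2 := fun i => by
    have := neg_le_chainLabel D i
    omega
  have hlab : IsChainLabeling D (γ 1 0) := by
    intro i j hij
    have h3 := isChainLabeling_chainLabel (n := n) D i j hij
    have hi := hpos i
    have hj := hpos j
    by_cases e1 : (j : ℕ) = p
    · have e2 : (i : ℕ) = p - 1 := by omega
      simp [γ, e1, e2, hp, show p ≠ p - 1 by omega]
    · by_cases e2 : (j : ℕ) = p - 1
      · have e3 : (j : ℕ) ∈ D := e2 ▸ h1.resolve_left (by omega)
        simp only [γ, if_pos e2, if_neg (show (i : ℕ) ≠ p - 1 by omega),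
          if_neg (show (i : ℕ) ≠ p by omega)]
        exact ⟨fun _ => by omega, fun h => absurd e3 h⟩
      · by_cases e3 : (j : ℕ) = p + 1
        · simp only [γ, if_neg e2, if_neg e1, if_neg (show (i : ℕ) ≠ p - 1 by omega),
            if_pos (show (i : ℕ) = p by omega)]
          exact ⟨fun h => absurd (e3 ▸ h) h2, fun _ => by omega⟩
        · simp only [γ, if_neg e2, if_neg e1, if_neg (show (i : ℕ) ≠ p - 1 by omega),
            if_neg (show (i : ℕ) ≠ p by omega)]
          exact ⟨fun h => by have := h3.1 h; omega, fun h => by have := h3.2 h; omega⟩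
  have hlab' : IsChainLabeling (D.erase p) (γ 0 1) := by
    intro i j hij
    have h3 := hlab i j hij
    by_cases e1 : (j : ℕ) = p
    · have e2 : (i : ℕ) = p - 1 := by omega
      simp [γ, e1, e2, show p ≠ p - 1 by omega]
    · have hi := hpos i
      have hj := hpos j
      rw [Finset.mem_erase, and_iff_right e1]
      simp only [γ] at h3 ⊢
      refine ⟨fun h => ?_, fun h => ?_⟩
      · have h4 := h3.1 h
        split_ifs at h4 ⊢ <;> omega
      · have h4 := h3.2 h
        split_ifs at h4 ⊢ <;> omega
  rw [chainOmega, chainOmega, (isChainLabeling_chainLabel D).OmegaV_eq hlab,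
    (isChainLabeling_chainLabel (D.erase p)).OmegaV_eq hlab']
  have ha : ∀ {s : Fin n}, s ≠ ⟨p - 1, by omega⟩ → (s : ℕ) ≠ p - 1 := fun h h' => h (Fin.ext h')
  have hb : ∀ {s : Fin n}, s ≠ ⟨p, hn⟩ → (s : ℕ) ≠ p := fun h h' => h (Fin.ext h')
  have hpp : p ≠ p - 1 := by omega
  refine OmegaV_slide (a := ⟨p - 1, by omega⟩) (b := ⟨p, hn⟩) ⟨?_, fun t ht => ?_, fun t ht => ?_⟩
    ?_ (fun s h3 h4 => ?_) ?_ (fun s h3 h4 => ?_) (fun s h3 h4 => ?_) (fun _ _ => hlab.ne_of_covBy)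
    (fun _ _ => hlab'.ne_of_covBy) (fun s h3 h4 => ?_) ?_
  · rw [fin_covBy_iff]
    simp only
    omega
  · rw [fin_covBy_iff] at ht
    refine Fin.ext ?_
    simp only at ht ⊢
    omega
  · rw [fin_covBy_iff] at ht
    refine Fin.ext ?_
    simp only at ht ⊢
    omega
  · simp [γ, hpp]
  · have := hpos s
    simp only [γ, if_neg (ha h3), if_neg (hb h4), if_true]
    omega
  · simp [γ, hpp]
  · have := hpos s
    simp only [γ, if_neg (ha h3), if_neg (hb h4), if_neg hpp, if_true]
    omega
  · simp only [γ, if_neg (ha h3), if_neg (hb h4)]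
  · have h5 := ha h3
    refine and_congr_right fun _ => ?_
    rw [Finset.mem_erase, Finset.mem_erase, and_iff_right (hb h4),
      and_iff_right (show (s : ℕ) + 1 ≠ p by omega)]
  · have e : p - 1 + 1 = p := by omega
    by_cases hc : c
    · left
      refine ⟨fun h => h.2.2 (e.symm ▸ hp), ⟨hc, Or.inr hp, h2⟩, ⟨hc, ?_, ?_⟩, fun h => ?_⟩
      · rcases h1 with h1 | h1
        · left
          simp only
          omega
        · exact Or.inr (Finset.mem_erase.2 ⟨hpp.symm, h1⟩)
      · simp only [e]
        exact Finset.notMem_erase _ _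
      · rcases h.2.1 with h | h
        · simp only at h
          omega
        · exact Finset.notMem_erase _ _ h
    · right
      exact ⟨fun h => hc h.1, fun h => hc h.1, fun h => hc h.1, fun h => hc h.1⟩

/-- The peaks of a descent set `D`. -/
def peaks (D : Finset ℕ) : Finset ℕ := D.filter fun p => p ≠ 1 ∧ p - 1 ∉ D

/-- Non-peak descents are erased one at a time, starting from the largest. -/
theorem chainOmega_peaks (c : Prop) {D : Finset ℕ} (hD : D ⊆ Finset.Ico 1 n) :
    chainOmega n c D = chainOmega n c (peaks D) := by
  induction D using Finset.strongInduction with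
  | H D ih =>
    rcases (D \ peaks D).eq_empty_or_nonempty with h | h
    · rw [Finset.sdiff_eq_empty_iff_subset] at h
      congr 1
      exact h.antisymm (Finset.filter_subset _ _)
    · obtain ⟨p, hp, hmax⟩ := (D \ peaks D).exists_max_image id h
      have hpk : ∀ q, q ∈ D \ peaks D ↔ q ∈ D ∧ (q = 1 ∨ q - 1 ∈ D) := by
        intro q
        rw [Finset.mem_sdiff, peaks, Finset.mem_filter]
        tauto
      rw [hpk] at hp
      have hp' := Finset.mem_Ico.1 (hD hp.1)
      -- Otherwise p + 1 would be a larger non-peak. This also ensures that erasing p creates no new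
      -- peak.
      have h2 : p + 1 ∉ D := fun h' => by
        have := hmax (p + 1) ((hpk _).2 ⟨h', Or.inr hp.1⟩)
        simp at this
      rw [chainOmega_erase c hp.1 hp'.1 hp'.2 hp.2 h2, ih _ (Finset.erase_ssubset hp.1)
        ((Finset.erase_subset _ _).trans hD)]
      congr 1
      ext q
      rw [peaks, peaks, Finset.mem_filter, Finset.mem_filter, Finset.mem_erase, Finset.mem_erase]
      constructor
      · rintro ⟨⟨h3, h4⟩, h5, h6⟩
        refine ⟨h4, h5, fun h7 => h6 ⟨fun h8 => h2 ?_, h7⟩⟩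
        have := (Finset.mem_Ico.1 (hD h4)).1
        rwa [← h8, Nat.sub_add_cancel this]
      · rintro ⟨h3, h4, h5⟩
        refine ⟨⟨?_, h3⟩, h4, fun h6 => h5 h6.2⟩
        rintro rfl
        exact hp.2.elim h4 h5

end Chains

/-! ### Multipeak quasisymmetric functions as weight enumerators of chains -/

theorem K_eq_chainOmega (α : Composition n) : K α = chainOmega n False (I α) := by
  refine Subtype.ext (congrArg enumerator ?_)
  rw [(isChainLabeling_chainLabel (I α)).enriched_eq]
  ext S
  exact and_congr_right fun _ => (and_iff_left fun v hv => hv.1.elim).symm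

/-- Since no two descents are adjacent and 1 is not a descent, the boxes at 0 and at the descents
are exactly the valleys. At a descent the upper box is thus unprimed, so a primed intersection is
empty and ≼ becomes ≺. -/
theorem KBar_eq_chainOmega (α : Composition n) (h1 : 1 ∉ I α) (h2 : ∀ j ∈ I α, j + 1 ∉ I α) :
    KBar α = chainOmega n True (I α) := by
  refine Subtype.ext (congrArg enumerator ?_)
  rw [(isChainLabeling_chainLabel (I α)).enriched_eq]
  have hval : ∀ j : Fin n, j ∈ valleys True (I α) ↔ ((j : ℕ) = 0 ∨ (j : ℕ) ∈ I α) := by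
    intro j
    refine (and_iff_right trivial).trans (and_iff_left_of_imp ?_)
    rintro (h | h)
    · rw [h]
      exact h1
    · exact h2 _ h
  ext S
  refine and_congr_right fun _ => ?_
  simp only [hval]
  refine and_congr_left fun h => ?_
  refine forall₂_congr fun i j => forall_congr' fun hij => and_congr_right fun hle => ?_
  refine and_congr_left fun _ => forall_congr' fun hj =>
    ⟨fun h3 x hx hx' => ?_, fun h3 x hx y hy => ?_⟩
  · exact absurd (h3 x hx x hx') (lt_irrefl _)
  · refine lt_of_le_of_ne (hle x hx y hy) ?_
    rintro rfl
    exact not_isPrimed_and (h3 x hx hy) (h j (Or.inr hj) x hy)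

theorem IsPeak.notMem {α : Composition n} (hα : IsPeak α) :
    1 ∉ I α ∧ ∀ j ∈ I α, j + 1 ∉ I α := by
  have hstep : ∀ i, i + 1 < α.length → α.sizeUpTo i + 2 ≤ α.sizeUpTo (i + 1) := by
    intro i hi
    have h := hα ⟨i, by omega⟩ hi
    rw [α.sizeUpTo_succ (by omega : i < α.length)]
    exact Nat.add_le_add_left h _
  constructor
  · intro h
    obtain ⟨i, hi, h⟩ := Finset.mem_image.1 h
    rw [Finset.mem_Ioo] at hi
    have h1 := hstep 0 (by omega)
    have h2 := α.monotone_sizeUpTo (show 0 + 1 ≤ i by omega)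
    omega
  · intro j hj hj'
    obtain ⟨i, hi, h⟩ := Finset.mem_image.1 hj
    obtain ⟨i', hi', h'⟩ := Finset.mem_image.1 hj'
    rw [Finset.mem_Ioo] at hi hi'
    have hlt : i < i' := by
      by_contra hle
      have := α.monotone_sizeUpTo (not_lt.1 hle)
      omega
    have h1 := hstep i (by omega)
    have h2 := α.monotone_sizeUpTo (show i + 1 ≤ i' by omega)
    omega

theorem length_flat (α : Composition n) (hα : IsPeak α) : (flat α hα).length = α.length := by
  simp [Composition.length, flat]

/-- The extra 1 in the first part of α^♭ shifts all proper partial sums by one; the last part, where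
1 is removed, does not enter them. -/
theorem sizeUpTo_flat (α : Composition n) (hα : IsPeak α) {i : ℕ} (h0 : 0 < i)
    (hi : i < α.length) : (flat α hα).sizeUpTo i = α.reverse.sizeUpTo i + 1 := by
  have hl := length_flat α hα
  have hr : α.reverse.length = α.length := by simp [Composition.length]
  have hb : ∀ i (h : i < α.length), (flat α hα).blocks[i]'(h.trans_eq hl.symm)
      = α.reverse.blocks[i]'(h.trans_eq hr.symm) + (if i = 0 then 1 else 0)
        - (if i + 1 = α.length then 1 else 0) := by
    intro i h
    refine (List.getElem_ofFn _).trans ?_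
    simp only [Composition.reverse_blocks, List.getElem_reverse,
      Composition.blocksFun, List.get_eq_getElem, Fin.val_rev]
    simp only [Nat.sub_sub, Nat.add_comm 1]
  induction i with
  | zero => exact absurd h0 (lt_irrefl _)
  | succ i ih =>
    rw [Composition.sizeUpTo_succ _ (by omega : i < (flat α hα).length),
      Composition.sizeUpTo_succ _ (by omega : i < α.reverse.length), hb i (by omega),
      if_neg (show ¬ i + 1 = α.length by omega)]
    rcases Nat.eq_zero_or_pos i with rfl | hi0
    · simp
    · rw [ih hi0 (by omega), if_neg hi0.ne']
      omega

theorem mem_I_flat (α : Composition n) (hα : IsPeak α) {j : ℕ} :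
    j ∈ I (flat α hα) ↔ j ≤ n ∧ n + 1 - j ∈ I α := by
  have hr : α.reverse.length = α.length := by simp [Composition.length]
  have h : ∀ j, j ∈ I (flat α hα) ↔ ∃ i ∈ I α.reverse, i + 1 = j := by
    intro j
    simp only [I, Finset.mem_image, Finset.mem_Ioo, length_flat, hr]
    constructor
    · rintro ⟨i, hi, rfl⟩
      exact ⟨_, ⟨i, hi, rfl⟩, (sizeUpTo_flat α hα hi.1 hi.2).symm⟩
    · rintro ⟨_, ⟨i, hi, rfl⟩, rfl⟩
      exact ⟨i, hi, sizeUpTo_flat α hα hi.1 hi.2⟩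
  rw [h]
  constructor
  · rintro ⟨i, hi, rfl⟩
    have h1 := Finset.mem_Ico.1 (I_subset_Ico _ hi)
    have h2 := mem_I_reverse.1 hi
    exact ⟨by omega, by rw [show n + 1 - (i + 1) = n - i by omega]; exact h2.2⟩
  · rintro ⟨h1, h2⟩
    have h3 := Finset.mem_Ico.1 (I_subset_Ico _ h2)
    have h4 : j ≠ 0 := by rintro rfl; omega
    refine ⟨j - 1, mem_I_reverse.2 ⟨by omega, ?_⟩, by omega⟩
    rwa [show n - (j - 1) = n + 1 - j by omega]

/-- A peak j of the reversed complement has n - j outside I(α) and n - j + 1 inside. As I(α) has no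
two consecutive elements, the second condition implies the first. -/
theorem IsPeak.I_flat {α : Composition n} (hα : IsPeak α) :
    I (flat α hα) = peaks ((Finset.Ico 1 n).filter fun j => n - j ∉ I α) := by
  obtain ⟨h1, h2⟩ := hα.notMem
  ext j
  rw [mem_I_flat, peaks, Finset.mem_filter, Finset.mem_filter, Finset.mem_filter, Finset.mem_Ico,
    Finset.mem_Ico]
  constructor
  · rintro ⟨h3, h4⟩
    have h5 := Finset.mem_Ico.1 (I_subset_Ico _ h4)
    have h6 : n + 1 - j ≠ 1 := fun h => h1 (h ▸ h4)
    refine ⟨⟨by omega, fun h => h2 _ h ?_⟩, by omega, fun h => h.2 ?_⟩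
    · rwa [show n - j + 1 = n + 1 - j by omega]
    · rwa [show n - (j - 1) = n + 1 - j by omega]
  · rintro ⟨⟨h3, h4⟩, h5, h6⟩
    refine ⟨by omega, by_contra fun h => h6 ⟨by omega, ?_⟩⟩
    rwa [show n - (j - 1) = n + 1 - j by omega]

theorem IsPeak.notMem_flat {α : Composition n} (hα : IsPeak α) :
    1 ∉ I (flat α hα) ∧ ∀ j ∈ I (flat α hα), j + 1 ∉ I (flat α hα) := by
  simp only [hα.I_flat, peaks, Finset.mem_filter]
  refine ⟨fun h => h.2.1 rfl, fun j hj hj' => hj'.2.2 ?_⟩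
  rw [Nat.add_sub_cancel]
  exact hj.1

theorem IsPeak.isReversal_chainOmega {α : Composition n} (hα : IsPeak α) (c : Prop) :
    IsReversal (chainOmega n c (I α)) (chainOmega n c (I (flat α hα))) := by
  rw [hα.I_flat, ← chainOmega_peaks c (Finset.filter_subset _ _)]
  exact Multipeak.isReversal_chainOmega c (I_subset_Ico α)

theorem IsPeak.chainOmega_formulas {α : Composition n} (hα : IsPeak α) (c : Prop) :
    (omega (chainOmega n c (I α)) : Series) = substGeom (chainOmega n c (I (flat α hα))) ∧
      (psi (chainOmega n c (I α)) : Series) = substGeom (chainOmega n c (I α)) ∧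
      rho (chainOmega n c (I α)) = chainOmega n c (I (flat α hα)) :=
  ⟨omega_chainOmega (hα.isReversal_chainOmega c), psi_chainOmega c _,
    rho_eq (hα.isReversal_chainOmega c)⟩

theorem IsPeak.formulas {α : Composition n} (hα : IsPeak α) :
    ((omega (K α) : Series) = substGeom (K (flat α hα)) ∧
      (psi (K α) : Series) = substGeom (K α) ∧ rho (K α) = K (flat α hα)) ∧
    ((omega (KBar α) : Series) = substGeom (KBar (flat α hα)) ∧
      (psi (KBar α) : Series) = substGeom (KBar α) ∧ rho (KBar α) = KBar (flat α hα)) := by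
  rw [K_eq_chainOmega, K_eq_chainOmega, KBar_eq_chainOmega α hα.notMem.1 hα.notMem.2,
    KBar_eq_chainOmega _ hα.notMem_flat.1 hα.notMem_flat.2]
  exact ⟨hα.chainOmega_formulas False, hα.chainOmega_formulas True⟩

/-! ### Labeled posets -/

theorem Omega_formulas {P : Type*} [PartialOrder P] [Fintype P] {γ : P → ℤ}
    (hγ : Function.Injective γ) :
    (omega (Omega γ) : Series) = substGeom (Omega (fun s : Pᵒᵈ => γ (OrderDual.ofDual s))) ∧
      (psi (Omega γ) : Series) = substGeom (Omega γ) ∧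
      rho (Omega γ) = Omega (fun s : Pᵒᵈ => γ (OrderDual.ofDual s)) := by
  have hγ0 : ∀ s t, s ⋖ t → γ s ≠ γ t := fun s t h => hγ.ne h.lt.ne
  have hrev : IsReversal (Omega γ) (Omega (fun s : Pᵒᵈ => γ (OrderDual.ofDual s))) :=
    isReversal_OmegaV OrderDual.toDual (fun _ _ => toDual_covBy_toDual_iff) hγ0
      (isValleySet_empty γ) (fun _ => rfl) fun _ => Iff.rfl
  exact ⟨omega_eq_substGeom_OmegaV (fun s t h => hγ.ne h.lt.ne) (isValleySet_empty _) hrev,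
    psi_OmegaV hγ0 (isValleySet_empty γ), rho_eq hrev⟩

/-! ### Transfer matrices with a boundary -/

section YangBaxter

variable {A E : Type*} [CommRing A] [Ring E] [Algebra A E]

/-- The relations of the operators which insert a letter into the boxes of given content. -/
structure ShiftedRelations (b : A) (u : ℕ → E) : Prop where
  mul_self : ∀ i, u i * u i = b • u i
  comm : ∀ i j, i + 2 ≤ j → Commute (u i) (u j)
  down : ∀ i, u (i + 1) * u i * u (i + 1) = 0
  -- The relation starts at u_1 u_2 u_1: nothing is imposed on u_0 u_1 u_0, since no box of content
  -- -1 lies between two diagonal boxes. The index 0 plays the role of the boundary.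
  up : ∀ i, u (i + 1) * u (i + 2) * u (i + 1) = 0

/-- The factor `1 + x u_i`. -/
def factor (u : ℕ → E) (i : ℕ) (x : A) : E := 1 + x • u i

/-- The product `h_i(x) ⋯ h_1(x) (1 + p u_0) h_1(x) ⋯ h_i(x)`. -/
def dressed (u : ℕ → E) (p x : A) : ℕ → E
  | 0 => factor u 0 p
  | i + 1 => factor u (i + 1) x * dressed u p x i * factor u (i + 1) x

variable {b : A} {u : ℕ → E}

/-- Parameters combine under the formal group law x ⊕ y = x + y + bxy; the hypotheses relating x, y,
z, s below say x = y ⊕ z and s = x ⊕ y. -/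
theorem ShiftedRelations.factor_mul (h : ShiftedRelations b u) (i : ℕ) (x y : A) :
    factor u i x * factor u i y = factor u i (x + y + b * (x * y)) := by
  simp only [factor, mul_add, add_mul, one_mul, mul_one, smul_mul_assoc, mul_smul_comm, h.mul_self]
  module

theorem ShiftedRelations.factor_comm (h : ShiftedRelations b u) {i j : ℕ} (hij : i + 2 ≤ j)
    (x y : A) : Commute (factor u i x) (factor u j y) :=
  (Commute.one_left _).add_left ((Commute.one_right _).add_right
    (((h.comm i j hij).smul_left x).smul_right y))

theorem ShiftedRelations.dressed_comm (h : ShiftedRelations b u) {i j : ℕ} (hij : i + 2 ≤ j)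
    (p x y : A) : Commute (dressed u p x i) (factor u j y) := by
  induction i with
  | zero => exact h.factor_comm hij p y
  | succ i ih =>
    exact ((h.factor_comm hij x y).mul_left (ih (by omega))).mul_left (h.factor_comm hij x y)

theorem ShiftedRelations.yangBaxter (h : ShiftedRelations b u) (i : ℕ) {x y s : A}
    (hs : s = x + y + b * (x * y)) :
    factor u (i + 1) x * factor u (i + 2) s * factor u (i + 1) y
      = factor u (i + 2) y * factor u (i + 1) s * factor u (i + 2) x := by
  have h1 := h.mul_self (i + 1)
  have h2 := h.mul_self (i + 2)
  have h3 := h.up i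
  have h4 := h.down (i + 1)
  have e : i + 1 + 1 = i + 2 := rfl
  rw [e] at h4
  subst hs
  simp only [factor, mul_add, add_mul, one_mul, mul_one, smul_mul_assoc, mul_smul_comm, h1, h2, h3,
    h4, smul_zero, add_zero]
  module

/-- After reduction by the relations, the two sides differ by multiples of u_0u_1 and u_1u_0 only,
and `hp` is exactly what makes these coefficients agree. -/
theorem ShiftedRelations.reflection_zero (h : ShiftedRelations b u) {p q z s : A}
    (hp : p * s = z * (p + q + b * (p * q)) + q * s * (1 + b * z)) :
    factor u 1 z * factor u 0 p * (factor u 1 s * factor u 0 q)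
      = factor u 0 q * factor u 1 s * (factor u 0 p * factor u 1 z) := by
  have h1 := h.mul_self 0
  have h2 := h.mul_self 1
  have h3 : u 1 * u 0 * u 1 = 0 := h.down 0
  have h6 : ∀ w, w * u 1 * u 0 * u 1 = 0 := fun w => by
    rw [mul_assoc, mul_assoc, ← mul_assoc (u 1), h3, mul_zero]
  have h4 : ∀ w, w * u 0 * u 0 = b • (w * u 0) := fun w => by rw [mul_assoc, h1, mul_smul_comm]
  have h5 : ∀ w, w * u 1 * u 1 = b • (w * u 1) := fun w => by rw [mul_assoc, h2, mul_smul_comm]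
  simp only [factor, mul_add, add_mul, one_mul, mul_one, smul_mul_assoc, mul_smul_comm, ← mul_assoc,
    h1, h2, h3, h4, h5, h6, smul_zero, add_zero]
  linear_combination (norm := module) hp • (u 0 * u 1) - hp • (u 1 * u 0)

/-- Dressing a solution of the reflection equation by one more pair of factors gives another
solution: two Yang-Baxter moves bring the old equation to the middle, and two more restore the outer
factors. -/
theorem reflection_step {M : Type*} [Monoid M] {hx hy hz hs gx gy gz gs Bx By : M}
    (c1 : Bx * gy = gy * Bx) (c2 : By * gx = gx * By) (y1 : hx * gs * hy = gy * hs * gx)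
    (y2 : gz * hx * gy = hy * gx * hz) (y3 : hz * gx * hy = gy * hx * gz)
    (y4 : gx * hs * gy = hy * gs * hx) (r : hz * Bx * (hs * By) = By * hs * (Bx * hz)) :
    gz * (hx * Bx * hx) * (gs * (hy * By * hy))
      = hy * By * hy * gs * (hx * Bx * hx * gz) := by
  calc gz * (hx * Bx * hx) * (gs * (hy * By * hy))
      = gz * hx * Bx * (hx * gs * hy) * By * hy := by simp only [mul_assoc]
    _ = gz * hx * (Bx * gy) * hs * (gx * By) * hy := by rw [y1]; simp only [mul_assoc]
    _ = (gz * hx * gy) * Bx * hs * By * gx * hy := by rw [c1, ← c2]; simp only [mul_assoc]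
    _ = hy * gx * (hz * Bx * (hs * By)) * gx * hy := by rw [y2]; simp only [mul_assoc]
    _ = hy * gx * By * hs * Bx * (hz * gx * hy) := by rw [r]; simp only [mul_assoc]
    _ = hy * (gx * By) * hs * (Bx * gy) * hx * gz := by rw [y3]; simp only [mul_assoc]
    _ = hy * By * (gx * hs * gy) * Bx * hx * gz := by rw [c1, ← c2]; simp only [mul_assoc]
    _ = _ := by rw [y4]; simp only [mul_assoc]

/-- The reflection equation. -/
theorem ShiftedRelations.reflection (h : ShiftedRelations b u) {p q x y z s : A}
    (hx : x = y + z + b * (y * z)) (hs : s = x + y + b * (x * y))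
    (hp : p * s = z * (p + q + b * (p * q)) + q * s * (1 + b * z)) (i : ℕ) :
    factor u (i + 1) z * dressed u p x i * (factor u (i + 1) s * dressed u q y i)
      = dressed u q y i * factor u (i + 1) s * (dressed u p x i * factor u (i + 1) z) := by
  induction i with
  | zero => exact h.reflection_zero hp
  | succ i ih =>
    have hx' : x = z + y + b * (z * y) := by rw [hx]; ring
    have hs' : s = y + x + b * (y * x) := by rw [hs]; ring
    exact reflection_step (h.dressed_comm le_rfl p x y) (h.dressed_comm le_rfl q y x)
      (h.yangBaxter i hs) (h.yangBaxter i hx).symm (h.yangBaxter i hx') (h.yangBaxter i hs').symm ih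

/-- The inner factors fuse to h(x ⊕ y), and h(x) on the left splits as h(y)h(z). The reflection
equation then exchanges the two dressed operators, and the fusions are undone in the opposite order.
-/
theorem ShiftedRelations.dressed_mul_comm (h : ShiftedRelations b u) {p q x y z s : A}
    (hx : x = y + z + b * (y * z)) (hs : s = x + y + b * (x * y))
    (hp : p * s = z * (p + q + b * (p * q)) + q * s * (1 + b * z)) (i : ℕ) :
    Commute (dressed u p x i) (dressed u q y i) := by
  cases i with
  | zero =>
    change factor u 0 p * factor u 0 q = factor u 0 q * factor u 0 p
    rw [h.factor_mul, h.factor_mul]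
    congr 1
    ring
  | succ i =>
    have e1 : factor u (i + 1) x = factor u (i + 1) y * factor u (i + 1) z := by
      rw [h.factor_mul, hx]
    have e1' : factor u (i + 1) x = factor u (i + 1) z * factor u (i + 1) y := by
      rw [h.factor_mul, hx]
      congr 1
      ring
    have e2 : factor u (i + 1) x * factor u (i + 1) y = factor u (i + 1) s := by
      rw [h.factor_mul, hs]
    have e2' : factor u (i + 1) y * factor u (i + 1) x = factor u (i + 1) s := by
      rw [h.factor_mul, hs]
      congr 1
      ring
    have r := h.reflection hx hs hp i
    simp only [dressed, Commute, SemiconjBy]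
    generalize dressed u p x i = Bx, dressed u q y i = By at *
    calc factor u (i + 1) x * Bx * factor u (i + 1) x *
          (factor u (i + 1) y * By * factor u (i + 1) y)
        = factor u (i + 1) x * Bx * (factor u (i + 1) x * factor u (i + 1) y) * By *
          factor u (i + 1) y := by simp only [mul_assoc]
      _ = factor u (i + 1) y * (factor u (i + 1) z * Bx * (factor u (i + 1) s * By)) *
          factor u (i + 1) y := by rw [e2, e1]; simp only [mul_assoc]
      _ = factor u (i + 1) y * By * factor u (i + 1) s * Bx *
          (factor u (i + 1) z * factor u (i + 1) y) := by rw [r]; simp only [mul_assoc]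
      _ = _ := by rw [← e1', ← e2']; simp only [mul_assoc]

end YangBaxter

/-! ### From commuting values of a polynomial to commuting coefficients -/

section Coefficients

variable {R : Type*} [CommRing R] {κ : Type*} [Fintype κ] [DecidableEq κ]

theorem ShiftedRelations.map {A : Type*} [CommRing A] [Algebra R A] {b : R} {u : ℕ → Matrix κ κ R}
    (h : ShiftedRelations b u) : ShiftedRelations (algebraMap R A b)
      fun i => (algebraMap R A).mapMatrix (u i) where
  mul_self i := by
    rw [← map_mul, h.mul_self]
    ext U K
    simp
  comm i j hij := (h.comm i j hij).map _
  down i := by rw [← map_mul, ← map_mul, h.down, map_zero]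
  up i := by rw [← map_mul, ← map_mul, h.up, map_zero]

/-- Evaluation of matrix-valued polynomials at scalars. -/
noncomputable def evalScalar {A : Type*} [CommRing A] [Algebra R A] (x : A) :
    (Matrix κ κ R)[X] →+* Matrix κ κ A :=
  Polynomial.eval₂RingHom' (algebraMap R A).mapMatrix (algebraMap A _ x)
    fun _ => Algebra.commute_algebraMap_right _ _

theorem evalScalar_one_add {A : Type*} [CommRing A] [Algebra R A] (x : A) (v : Matrix κ κ R) :
    evalScalar x (1 + Polynomial.C v * Polynomial.X)
      = 1 + x • (algebraMap R A).mapMatrix v := by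
  rw [map_add, map_one, map_mul, Algebra.smul_def, Algebra.commutes]
  congr 2
  · exact Polynomial.eval₂_C _ _
  · exact Polynomial.eval₂_X _ _

theorem evalScalar_apply {A : Type*} [CommRing A] [Algebra R A] (x : A) (F : (Matrix κ κ R)[X]) :
    evalScalar x F = ∑ i ∈ Finset.range (F.natDegree + 1),
      x ^ i • (algebraMap R A).mapMatrix (F.coeff i) := by
  refine (Polynomial.eval₂_eq_sum_range _ _).trans (Finset.sum_congr rfl fun i _ => ?_)
  rw [Algebra.smul_def, map_pow, ← map_pow, Algebra.commutes]

/-- If the values of a matrix-valued polynomial at a polynomial variable and at a power series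
variable commute, then its coefficients commute. -/
theorem commute_coeff_of_commute_evalScalar {F : (Matrix κ κ R)[X]}
    (h : Commute (evalScalar (Polynomial.X : (PowerSeries R)[X]) F)
      (evalScalar (Polynomial.C PowerSeries.X : (PowerSeries R)[X]) F)) (i j : ℕ) :
    Commute (F.coeff i) (F.coeff j) := by
  -- The monomials in the polynomial variable and the power series variable are independent, so a
  -- double coefficient can be read off.
  have key : ∀ (c : ℕ → ℕ → R) (d : ℕ), (∀ i, d < i → ∀ j, c i j = 0) → (∀ i j, d < j → c i j = 0) →
      ∀ i j, PowerSeries.coeff j ((∑ k ∈ Finset.range (d + 1), ∑ l ∈ Finset.range (d + 1),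
        Polynomial.X ^ k * (Polynomial.C PowerSeries.X) ^ l *
          algebraMap R (PowerSeries R)[X] (c k l)).coeff i) = c i j := by
    intro c d h1 h2 i j
    have hterm : ∀ k l, PowerSeries.coeff j ((Polynomial.X ^ k * (Polynomial.C PowerSeries.X) ^ l *
        algebraMap R (PowerSeries R)[X] (c k l)).coeff i)
          = if k = i then if l = j then c k l else 0 else 0 := by
      intro k l
      rw [mul_assoc, Polynomial.X_pow_mul, ← map_pow,
        IsScalarTower.algebraMap_apply R (PowerSeries R),
        Polynomial.algebraMap_eq, ← map_mul, Polynomial.coeff_C_mul_X_pow]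
      rw [apply_ite (PowerSeries.coeff j), map_zero, PowerSeries.algebraMap_apply,
        Algebra.algebraMap_self_apply, PowerSeries.coeff_mul_C, PowerSeries.coeff_X_pow]
      simp only [eq_comm, ite_mul, one_mul, zero_mul]
    simp only [Polynomial.finsetSum_coeff, map_sum, hterm, Finset.sum_ite_irrel,
      Finset.sum_const_zero, Finset.sum_ite_eq', Finset.mem_range]
    split_ifs with h3 h4
    · rfl
    · exact (h2 i j (by omega)).symm
    · exact (h1 i (by omega) j).symm
  have hprod : ∀ (U K : κ), ∀ G H : ℕ → Matrix κ κ R, ∀ d (x y : (PowerSeries R)[X]),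
      ((∑ i ∈ Finset.range (d + 1), x ^ i • (algebraMap R (PowerSeries R)[X]).mapMatrix (G i)) *
        ∑ i ∈ Finset.range (d + 1), y ^ i • (algebraMap R (PowerSeries R)[X]).mapMatrix (H i)) U K
      = ∑ k ∈ Finset.range (d + 1), ∑ l ∈ Finset.range (d + 1), x ^ k * y ^ l *
          algebraMap R (PowerSeries R)[X] ((G k * H l) U K) := by
    intro U K G H d x y
    rw [Finset.sum_mul_sum]
    simp only [Matrix.sum_apply, smul_mul_smul_comm, Matrix.smul_apply,
      RingHom.mapMatrix_apply, ← Matrix.map_mul, Matrix.map_apply, smul_eq_mul]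
  ext1 U K
  have h1 := congrFun₂ h.eq U K
  rw [evalScalar_apply, evalScalar_apply, hprod, hprod] at h1
  conv_rhs at h1 => rw [Finset.sum_comm]
  simp only [mul_comm (Polynomial.C _ ^ _)] at h1
  have hz : ∀ i, F.natDegree < i → F.coeff i = 0 := fun i =>
    Polynomial.coeff_eq_zero_of_natDegree_lt
  have hl : ∀ i, F.natDegree < i → ∀ j, (F.coeff i * F.coeff j) U K = 0 := fun i hi j => by
    rw [hz i hi, zero_mul, Matrix.zero_apply]
  have hr : ∀ i j, F.natDegree < j → (F.coeff i * F.coeff j) U K = 0 := fun i j hj => by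
    rw [hz j hj, mul_zero, Matrix.zero_apply]
  exact (key (fun k l => (F.coeff k * F.coeff l) U K) _ hl hr i j).symm.trans
    ((congrArg (fun f => PowerSeries.coeff j (Polynomial.coeff f i)) h1).trans
      (key (fun k l => (F.coeff l * F.coeff k) U K) _ (fun i hi j => hr j i hi)
        (fun i j hj => hl j hj i) i j))

/-- The polynomial `h_i(x) ⋯ h_1(x) F₀(x) h_1(x) ⋯ h_i(x)`. -/
noncomputable def dressedPoly {M : Type*} [Ring M] (u : ℕ → M) (F₀ : M[X]) : ℕ → M[X]
  | 0 => F₀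
  | i + 1 => (1 + Polynomial.C (u (i + 1)) * Polynomial.X) * dressedPoly u F₀ i *
      (1 + Polynomial.C (u (i + 1)) * Polynomial.X)

theorem evalScalar_dressedPoly {A : Type*} [CommRing A] [Algebra R A] {u : ℕ → Matrix κ κ R}
    {F₀ : (Matrix κ κ R)[X]} {p x : A} (h : evalScalar x F₀
      = factor (fun i => (algebraMap R A).mapMatrix (u i)) 0 p) (i : ℕ) :
    evalScalar x (dressedPoly u F₀ i)
      = dressed (fun i => (algebraMap R A).mapMatrix (u i)) p x i := by
  induction i with
  | zero => exact h
  | succ i ih =>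
    rw [dressedPoly, map_mul, map_mul, ih, evalScalar_one_add]
    rfl

theorem ShiftedRelations.commute_coeff {b : R} {u : ℕ → Matrix κ κ R} (h : ShiftedRelations b u)
    {F₀ : (Matrix κ κ R)[X]} (p : (PowerSeries R)[X] → (PowerSeries R)[X])
    (h₀ : ∀ x : (PowerSeries R)[X], evalScalar x F₀
      = factor (fun i => (algebraMap R (PowerSeries R)[X]).mapMatrix (u i)) 0 (p x))
    (hp : ∀ x y z s, x = y + z + algebraMap R _ b * (y * z) →
      s = x + y + algebraMap R _ b * (x * y) →
      p x * s = z * (p x + p y + algebraMap R _ b * (p x * p y)) +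
        p y * s * (1 + algebraMap R _ b * z))
    (N i j : ℕ) : Commute ((dressedPoly u F₀ N).coeff i) ((dressedPoly u F₀ N).coeff j) := by
  refine commute_coeff_of_commute_evalScalar ?_ i j
  rw [evalScalar_dressedPoly (h₀ _), evalScalar_dressedPoly (h₀ _)]
  -- The parameter z with x = y ⊕ z is (x - y)/(1 + by). A power series variable y makes the
  -- denominator invertible, whereas x may remain a polynomial variable.
  have hu : IsUnit (1 + algebraMap R (PowerSeries R)[X] b * Polynomial.C PowerSeries.X) := by
    have h1 : IsUnit (1 + algebraMap R (PowerSeries R) b * PowerSeries.X) := by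
      rw [PowerSeries.isUnit_iff_constantCoeff]
      simp
    have h2 := h1.map (Polynomial.C : PowerSeries R →+* (PowerSeries R)[X])
    rwa [map_add, map_one, map_mul] at h2
  obtain ⟨w, hw⟩ := hu.exists_right_inv
  have hx : (Polynomial.X : (PowerSeries R)[X]) = Polynomial.C PowerSeries.X +
      (Polynomial.X - Polynomial.C PowerSeries.X) * w + algebraMap R _ b *
        (Polynomial.C PowerSeries.X * ((Polynomial.X - Polynomial.C PowerSeries.X) * w)) := by
    linear_combination (Polynomial.C PowerSeries.X - Polynomial.X) * hw
  exact (h.map (A := (PowerSeries R)[X])).dressed_mul_comm hx rfl (hp _ _ _ _ hx rfl) N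

/-- Boundary parameter p(x) = x, the case of GP: diagonal boxes take unprimed letters only. -/
theorem ShiftedRelations.commute_coeff_simple {b : R} {u : ℕ → Matrix κ κ R}
    (h : ShiftedRelations b u) (N i j : ℕ) :
    Commute ((dressedPoly u (1 + Polynomial.C (u 0) * Polynomial.X) N).coeff i)
      ((dressedPoly u (1 + Polynomial.C (u 0) * Polynomial.X) N).coeff j) := by
  refine h.commute_coeff id (fun x => evalScalar_one_add x _) (fun x y z s hx hs => ?_) N i j
  simp only [id]
  rw [hs]
  linear_combination (x + y + algebraMap R _ b * (x * y)) * hx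

/-- Boundary parameter p(x) = x ⊕ x, the case of GQ: both marks are allowed on the diagonal. -/
theorem ShiftedRelations.commute_coeff_double {b : R} {u : ℕ → Matrix κ κ R}
    (h : ShiftedRelations b u) (N i j : ℕ) :
    Commute ((dressedPoly u ((1 + Polynomial.C (u 0) * Polynomial.X) *
        (1 + Polynomial.C (u 0) * Polynomial.X)) N).coeff i)
      ((dressedPoly u ((1 + Polynomial.C (u 0) * Polynomial.X) *
        (1 + Polynomial.C (u 0) * Polynomial.X)) N).coeff j) := by
  refine h.commute_coeff (fun x => x + x + algebraMap R _ b * (x * x)) (fun x => ?_)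
    (fun x y z s hx hs => ?_) N i j
  · rw [map_mul, evalScalar_one_add]
    exact (h.map (A := (PowerSeries R)[X])).factor_mul 0 x x
  · subst hs
    subst hx
    ring

end Coefficients

/-! ### Posets with contents -/

section Content

open scoped Classical

set_option linter.unusedSectionVars false

variable {P : Type*} [PartialOrder P]

/-- The properties of the content function of a skew shifted diagram which matter here. -/
structure IsContent (c : P → ℕ) : Prop where
  covBy : ∀ s t, s ⋖ t → c t = c s + 1 ∨ c s = c t + 1
  lt_or_lt : ∀ s t, s ≠ t → c s = c t → s < t ∨ t < s
  lt_or_lt_succ : ∀ s t, c t = c s + 1 → s < t ∨ t < s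
  exists_succ : ∀ s t, s < t → c s = c t → ∃ r, s < r ∧ r < t ∧ c r = c s + 1
  exists_pred : ∀ s t, s < t → c s = c t → c s ≠ 0 → ∃ r, s < r ∧ r < t ∧ c r + 1 = c s

variable [Fintype P]

theorem boxOp_ne_zero {s : P} {U K : Finset P} (h : boxOp s U K ≠ 0) :
    IsMinOf s U ∧ (K = U ∨ K = U.erase s) := by
  rw [boxOp] at h
  split_ifs at h with h1 h2 h3 h3
  · exact ⟨h1, Or.inr h2.symm⟩
  · exact ⟨h1, Or.inr h2.symm⟩
  · exact ⟨h1, Or.inl h3.symm⟩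
  · simp at h
  · exact absurd rfl h

/-- A pending box below s blocks s, and a box strictly between s and t is still pending after the
step at s and blocks t. -/
theorem boxOp_mul_eq_zero {s t : P} (h : t < s ∨ ∃ r, s < r ∧ r < t) : boxOp s * boxOp t = 0 := by
  ext1 U K
  rw [Matrix.mul_apply, Matrix.zero_apply]
  refine Finset.sum_eq_zero fun U' _ => by_contra fun hne => ?_
  obtain ⟨hs, hU'⟩ := boxOp_ne_zero (left_ne_zero_of_mul hne)
  obtain ⟨ht, -⟩ := boxOp_ne_zero (right_ne_zero_of_mul hne)
  rcases h with h | ⟨r, h1, h2⟩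
  · refine hs.not_lt (t := t) ?_ h
    rcases hU' with rfl | rfl
    · exact ht.2.1
    · exact Finset.mem_of_mem_erase ht.2.1
  · refine ht.not_lt (t := r) ?_ h2
    have hr := hs.1 h1.le hs.2.1
    rcases hU' with rfl | rfl
    · exact hr
    · exact Finset.mem_erase.2 ⟨h1.ne', hr⟩

/-- The same blocking argument with a step at t in between. If s = s', then s stays pending
throughout, so a comparable t blocks s or is blocked by it. -/
theorem boxOp_mul_mul_eq_zero {s t s' : P} (h : s' < s ∨ (∃ r, r ≠ t ∧ s < r ∧ r < s') ∨
    (s = s' ∧ (s < t ∨ t < s))) (hne : s' ≠ t) : boxOp s * boxOp t * boxOp s' = 0 := by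
  ext1 U K
  rw [mul_assoc, Matrix.mul_apply, Matrix.zero_apply]
  refine Finset.sum_eq_zero fun U' _ => ?_
  rw [Matrix.mul_apply, Finset.mul_sum]
  refine Finset.sum_eq_zero fun U'' _ => by_contra fun h0 => ?_
  obtain ⟨hs, hU'⟩ := boxOp_ne_zero (left_ne_zero_of_mul h0)
  obtain ⟨ht, hU''⟩ := boxOp_ne_zero (left_ne_zero_of_mul (right_ne_zero_of_mul h0))
  obtain ⟨hs', -⟩ := boxOp_ne_zero (right_ne_zero_of_mul (right_ne_zero_of_mul h0))
  have h1 : ∀ r ∈ U', r ∈ U := fun r hr => by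
    rcases hU' with rfl | rfl
    · exact hr
    · exact Finset.mem_of_mem_erase hr
  have h2 : ∀ r ∈ U'', r ∈ U' := fun r hr => by
    rcases hU'' with rfl | rfl
    · exact hr
    · exact Finset.mem_of_mem_erase hr
  have h3 : s' ∈ U' := h2 _ hs'.2.1
  rcases h with h | ⟨r, hrt, h4, h5⟩ | ⟨rfl, h⟩
  · exact hs.not_lt (h1 _ h3) h
  · refine hs'.not_lt (t := r) ?_ h5
    have hr : r ∈ U' := by
      have hr := hs.1 h4.le hs.2.1
      rcases hU' with rfl | rfl
      · exact hr
      · exact Finset.mem_erase.2 ⟨h4.ne', hr⟩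
    rcases hU'' with rfl | rfl
    · exact hr
    · exact Finset.mem_erase.2 ⟨hrt, hr⟩
  · rcases h with h | h
    · exact ht.not_lt h3 h
    · exact hs.not_lt (h1 _ ht.2.1) h

/-- The boxes of content `k`. -/
noncomputable def contentBoxes (c : P → ℕ) (k : ℕ) : List P :=
  (Finset.univ.filter fun s => c s = k).toList

theorem mem_contentBoxes {c : P → ℕ} {k : ℕ} {s : P} : s ∈ contentBoxes c k ↔ c s = k := by
  simp [contentBoxes]

/-- The operator which inserts a letter into a box of content `k`. -/
noncomputable def contentOp (c : P → ℕ) (k : ℕ) : StateMatrix P :=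
  ∑ s with c s = k, boxOp s

variable {c : P → ℕ}

theorem IsContent.boxOp_mul_boxOp (h : IsContent c) {s t : P} (hst : s ≠ t) (hc : c s = c t) :
    boxOp s * boxOp t = 0 := by
  refine boxOp_mul_eq_zero ((h.lt_or_lt s t hst hc).symm.imp_right fun hlt => ?_)
  obtain ⟨r, h1, h2, -⟩ := h.exists_succ s t hlt hc
  exact ⟨r, h1, h2⟩

/-- In the triple products, distinct outer boxes are comparable and have a box between them whose
content differs from that of the middle factor; equal outer boxes are comparable with the middle
one. -/
theorem IsContent.shiftedRelations (h : IsContent c) : ShiftedRelations β (contentOp c) where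
  mul_self k := by
    rw [contentOp, Finset.sum_mul_sum, Finset.smul_sum]
    refine Finset.sum_congr rfl fun s hs => ?_
    rw [Finset.sum_eq_single s, boxOp_mul_self]
    · intro t ht hts
      exact h.boxOp_mul_boxOp hts.symm
        ((Finset.mem_filter.1 hs).2.trans (Finset.mem_filter.1 ht).2.symm)
    · exact fun h' => absurd hs h'
  comm i j hij := by
    refine Commute.sum_left _ _ _ fun s hs => Commute.sum_right _ _ _ fun t ht => ?_
    have hs' := (Finset.mem_filter.1 hs).2
    have ht' := (Finset.mem_filter.1 ht).2
    refine boxOp_comm (fun hst => ?_) fun hst => ?_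
    · have := h.covBy _ _ hst
      omega
    · have := h.covBy _ _ hst
      omega
  down i := by
    simp only [contentOp, Finset.sum_mul, Finset.mul_sum]
    refine Finset.sum_eq_zero fun s' hs' => Finset.sum_eq_zero fun t ht =>
      Finset.sum_eq_zero fun s hs => ?_
    have hs := (Finset.mem_filter.1 hs).2
    have hs' := (Finset.mem_filter.1 hs').2
    have ht := (Finset.mem_filter.1 ht).2
    refine boxOp_mul_mul_eq_zero ?_ (by rintro rfl; omega)
    rcases eq_or_ne s s' with rfl | hne
    · exact Or.inr (Or.inr ⟨rfl, (h.lt_or_lt_succ t s (by omega)).symm⟩)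
    · refine (h.lt_or_lt s s' hne (by omega)).symm.imp_right fun hlt => Or.inl ?_
      obtain ⟨r, h1, h2, h3⟩ := h.exists_succ s s' hlt (by omega)
      exact ⟨r, by rintro rfl; omega, h1, h2⟩
  up i := by
    simp only [contentOp, Finset.sum_mul, Finset.mul_sum]
    refine Finset.sum_eq_zero fun s' hs' => Finset.sum_eq_zero fun t ht =>
      Finset.sum_eq_zero fun s hs => ?_
    have hs := (Finset.mem_filter.1 hs).2
    have hs' := (Finset.mem_filter.1 hs').2
    have ht := (Finset.mem_filter.1 ht).2
    refine boxOp_mul_mul_eq_zero ?_ (by rintro rfl; omega)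
    rcases eq_or_ne s s' with rfl | hne
    · exact Or.inr (Or.inr ⟨rfl, h.lt_or_lt_succ s t (by omega)⟩)
    · refine (h.lt_or_lt s s' hne (by omega)).symm.imp_right fun hlt => Or.inl ?_
      obtain ⟨r, h1, h2, h3⟩ := h.exists_pred s s' hlt (by omega) (by omega)
      exact ⟨r, by rintro rfl; omega, h1, h2⟩

/-- All cross terms vanish, so the product is linear in x and independent of the order. -/
theorem boxPoly_eq_of_mul_eq_zero {L : List P} (hL : L.Nodup)
    (h : ∀ s ∈ L, ∀ t ∈ L, s ≠ t → boxOp s * boxOp t = 0) :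
    boxPoly L = 1 + Polynomial.C (L.map boxOp).sum * Polynomial.X := by
  induction L with
  | nil => simp [boxPoly_nil]
  | cons s L ih =>
    rw [List.nodup_cons] at hL
    have h0 : boxOp s * (L.map boxOp).sum = 0 := by
      rw [← List.sum_map_mul_left]
      refine List.sum_eq_zero fun x hx => ?_
      obtain ⟨t, ht, rfl⟩ := List.mem_map.1 hx
      exact h s List.mem_cons_self t (List.mem_cons_of_mem _ ht)
        (ne_of_mem_of_not_mem ht hL.1).symm
    rw [boxPoly_cons, ih hL.2 fun s hs t ht => h s (List.mem_cons_of_mem _ hs) t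
      (List.mem_cons_of_mem _ ht), List.map_cons, List.sum_cons, map_add]
    have h1 : Polynomial.C (boxOp s) * Polynomial.X *
        (Polynomial.C (L.map boxOp).sum * Polynomial.X) = 0 := by
      rw [mul_assoc, ← mul_assoc Polynomial.X, Polynomial.X_mul, ← mul_assoc, ← mul_assoc,
        ← map_mul, h0, map_zero, zero_mul, zero_mul]
    rw [add_mul 1, one_mul, mul_add, mul_one, h1, add_zero, add_mul]
    abel

theorem IsContent.boxPoly_contentBoxes (h : IsContent c) (k : ℕ) {L : List P}
    (hL : L.Perm (contentBoxes c k)) :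
    boxPoly L = 1 + Polynomial.C (contentOp c k) * Polynomial.X := by
  rw [boxPoly_eq_of_mul_eq_zero (hL.nodup_iff.2 (Finset.nodup_toList _)), (hL.map _).sum_eq,
    contentBoxes, Finset.sum_map_toList]
  · rfl
  · intro s hs t ht hst
    exact h.boxOp_mul_boxOp hst ((mem_contentBoxes.1 (hL.mem_iff.1 hs)).trans
      (mem_contentBoxes.1 (hL.mem_iff.1 ht)).symm)

/-- The boxes of content at most `N`, sorted by content. -/
noncomputable def sortedBoxes (c : P → ℕ) (N : ℕ) : List P :=
  (List.range (N + 1)).flatMap (contentBoxes c)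

theorem sortedBoxes_succ (c : P → ℕ) (N : ℕ) :
    sortedBoxes c (N + 1) = sortedBoxes c N ++ contentBoxes c (N + 1) := by
  rw [sortedBoxes, List.range_succ, List.flatMap_append, List.flatMap_singleton]
  rfl

theorem nodup_sortedBoxes (c : P → ℕ) (N : ℕ) : (sortedBoxes c N).Nodup := by
  rw [sortedBoxes, List.nodup_flatMap]
  refine ⟨fun k _ => Finset.nodup_toList _, List.nodup_range.imp fun {k l} hkl s hs hs' => hkl ?_⟩
  rw [← mem_contentBoxes.1 hs, ← mem_contentBoxes.1 hs']

theorem pairwise_sortedBoxes (c : P → ℕ) (N : ℕ) :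
    (sortedBoxes c N).Pairwise fun s t => (c s : ℤ) ≤ c t := by
  rw [sortedBoxes, List.pairwise_flatMap]
  refine ⟨fun k _ => List.pairwise_of_forall_mem_list fun s hs t ht => ?_,
    List.pairwise_lt_range.imp fun {k l} hkl s hs t ht => ?_⟩
  · rw [mem_contentBoxes.1 hs, mem_contentBoxes.1 ht]
  · rw [mem_contentBoxes.1 hs, mem_contentBoxes.1 ht]
    exact_mod_cast hkl.le

variable {V : Set P}

/-- The boxes of largest content come first among the primed and last among the unprimed letters, so
each content wraps one more pair of factors around the product. -/
theorem IsContent.boxPoly_boxOrder (h : IsContent c) (hV : ∀ v ∈ V, c v = 0) (N : ℕ) :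
    boxPoly (boxOrder (sortedBoxes c N) V)
      = dressedPoly (contentOp c) (boxPoly (boxOrder (contentBoxes c 0) V)) N := by
  induction N with
  | zero => simp [sortedBoxes, dressedPoly]
  | succ N ih =>
    have h1 : (contentBoxes c (N + 1)).reverse.filter (fun s => s ∉ V)
        = (contentBoxes c (N + 1)).reverse := by
      refine List.filter_eq_self.2 fun s hs => decide_eq_true fun hs' => ?_
      have := mem_contentBoxes.1 (List.mem_reverse.1 hs)
      rw [hV s hs'] at this
      omega
    have h2 : boxOrder (sortedBoxes c (N + 1)) V = (contentBoxes c (N + 1)).reverse ++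
        boxOrder (sortedBoxes c N) V ++ contentBoxes c (N + 1) := by
      rw [sortedBoxes_succ, boxOrder, List.reverse_append, List.filter_append, h1, boxOrder]
      simp only [List.append_assoc]
    rw [h2, boxPoly_append, boxPoly_append, ih, dressedPoly,
      h.boxPoly_contentBoxes _ (List.reverse_perm _), h.boxPoly_contentBoxes _ (List.Perm.refl _)]

theorem IsContent.ne_of_covBy (h : IsContent c) (s t : P) (hst : s ⋖ t) : (c s : ℤ) ≠ c t := by
  have := h.covBy s t hst
  omega

/-- Commuting coefficients make products over blocks independent of the order of the blocks;
reversal is a special case. -/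
theorem IsContent.isReversal (h : IsContent c) (hV : ∀ v ∈ V, c v = 0)
    (hcomm : ∀ N i j, Commute ((dressedPoly (contentOp c)
      (boxPoly (boxOrder (contentBoxes c 0) V)) N).coeff i)
        ((dressedPoly (contentOp c) (boxPoly (boxOrder (contentBoxes c 0) V)) N).coeff j)) :
    IsReversal (OmegaV (fun s => (c s : ℤ)) V) (OmegaV (fun s => (c s : ℤ)) V) := by
  obtain ⟨N, hN⟩ : ∃ N, ∀ s, c s ≤ N := ⟨_, fun s => Finset.le_sup (f := c) (Finset.mem_univ s)⟩
  have hexp := hasExpansion_OmegaV h.ne_of_covBy (nodup_sortedBoxes c N) (pairwise_sortedBoxes c N)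
    (fun s => List.mem_flatMap.2 ⟨c s, List.mem_range.2 (Nat.lt_succ_of_le (hN s)),
      mem_contentBoxes.2 rfl⟩) V
  intro n α
  rw [hexp.coeff_packed, hexp.coeff_packed, Composition.reverse_blocks, List.map_reverse]
  congr 1
  refine (List.reverse_perm _).prod_eq' ?_
  refine List.pairwise_of_forall_mem_list fun x hx y hy => ?_
  rw [List.mem_reverse] at hx hy
  obtain ⟨i, -, rfl⟩ := List.mem_map.1 hx
  obtain ⟨j, -, rfl⟩ := List.mem_map.1 hy
  rw [h.boxPoly_boxOrder hV N]
  exact hcomm N i j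

theorem IsContent.isReversal_empty (h : IsContent c) :
    IsReversal (OmegaV (fun s => (c s : ℤ)) ∅) (OmegaV (fun s => (c s : ℤ)) ∅) := by
  refine h.isReversal (fun v hv => absurd hv (Set.notMem_empty v)) fun N i j => ?_
  have h1 : boxPoly (boxOrder (contentBoxes c 0) ∅)
      = (1 + Polynomial.C (contentOp c 0) * Polynomial.X) *
        (1 + Polynomial.C (contentOp c 0) * Polynomial.X) := by
    have h2 : boxOrder (contentBoxes c 0) ∅ = (contentBoxes c 0).reverse ++ contentBoxes c 0 := by
      simp [boxOrder]
    rw [h2, boxPoly_append, h.boxPoly_contentBoxes 0 (List.Perm.refl _),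
      h.boxPoly_contentBoxes 0 (List.reverse_perm _)]
  rw [h1]
  exact h.shiftedRelations.commute_coeff_double N i j

theorem IsContent.isReversal_zero (h : IsContent c) :
    IsReversal (OmegaV (fun s => (c s : ℤ)) {s | c s = 0})
      (OmegaV (fun s => (c s : ℤ)) {s | c s = 0}) := by
  refine h.isReversal (fun v hv => hv) fun N i j => ?_
  have h1 : boxPoly (boxOrder (contentBoxes c 0) {s | c s = 0})
      = 1 + Polynomial.C (contentOp c 0) * Polynomial.X := by
    rw [boxOrder, boxPoly_append, h.boxPoly_contentBoxes 0 (List.Perm.refl _),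
      List.filter_eq_nil_iff.2, boxPoly_nil, one_mul]
    intro s hs
    simpa using mem_contentBoxes.1 (List.mem_reverse.1 hs)
  rw [h1]
  exact h.shiftedRelations.commute_coeff_simple N i j

theorem IsContent.isValleySet (h : IsContent c) :
    IsValleySet (fun s => (c s : ℤ)) {s | c s = 0} := by
  intro v (hv : c v = 0) s
  constructor <;> intro hs <;> have := h.covBy _ _ hs <;> simp only <;> omega

end Content

/-! ### Shifted skew diagrams -/

section Diagram

variable {la mu : StrictPartition}

/-- Strictness makes λ_i + i weakly decreasing as long as the parts are positive; this gives the
convexity of the shifted diagram. -/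
theorem StrictPartition.part_add_le (la : StrictPartition) {i k : ℕ+} (hik : i ≤ k)
    (hk : la.part k ≠ 0) : la.part k + k ≤ la.part i + i := by
  induction k using PNat.recOn with
  | one =>
    obtain rfl := le_antisymm hik one_le
    exact le_rfl
  | succ k ih =>
    rcases eq_or_lt_of_le hik with rfl | hlt
    · exact le_rfl
    · have h1 := (la.strict k (k + 1) (PNat.lt_add_right _ _)).resolve_left hk
      have h2 := ih (PNat.lt_add_one_iff.1 hlt) (by omega)
      rw [PNat.add_coe, PNat.one_coe]
      omega

theorem mem_SD {c : ℕ+ × ℕ+} : c ∈ SD la mu ↔ (c.1 : ℕ) ≤ c.2 ∧ mu.part c.1 + c.1 ≤ c.2 ∧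
    (c.2 : ℕ) + 1 ≤ la.part c.1 + c.1 := by
  have := c.1.pos
  constructor
  · rintro ⟨j, h1, h2, h3, h4⟩
    omega
  · rintro ⟨h1, h2, h3⟩
    exact ⟨c.2 + 1 - c.1, by omega, by omega, by omega, by omega⟩

/-- The condition on r is needed: an interval in the componentwise order may contain positions below
the main diagonal. -/
theorem mem_SD_of_le {s r t : ℕ+ × ℕ+} (hs : s ∈ SD la mu) (ht : t ∈ SD la mu) (hsr : s ≤ r)
    (hrt : r ≤ t) (hr : r.1 ≤ r.2) : r ∈ SD la mu := by
  rw [mem_SD] at *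
  have h1 := PNat.coe_le_coe _ _ |>.2 hsr.2
  have h2 := PNat.coe_le_coe _ _ |>.2 hrt.2
  have h3 := PNat.coe_le_coe _ _ |>.2 hr
  refine ⟨h3, ?_, ?_⟩
  · by_cases h : mu.part r.1 = 0
    · omega
    · have := mu.part_add_le hsr.1 h
      omega
  · have := la.part_add_le hrt.1 (by omega)
    omega

/-- The content of a box. -/
def content (s : SD la mu) : ℕ := (s.1.2 : ℕ) - s.1.1

theorem content_add (s : SD la mu) : content s + s.1.1 = s.1.2 :=
  Nat.sub_add_cancel (mem_SD.1 s.2).1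

theorem SD_le_iff {s t : SD la mu} :
    s ≤ t ↔ (s.1.1 : ℕ) ≤ t.1.1 ∧ (s.1.2 : ℕ) ≤ t.1.2 := by
  rw [PNat.coe_le_coe, PNat.coe_le_coe]
  exact Iff.rfl

theorem SD_lt_iff {s t : SD la mu} : s < t ↔ ((s.1.1 : ℕ) ≤ t.1.1 ∧ (s.1.2 : ℕ) ≤ t.1.2) ∧
    ((s.1.1 : ℕ) < t.1.1 ∨ (s.1.2 : ℕ) < t.1.2) := by
  rw [lt_iff_le_not_ge, SD_le_iff, SD_le_iff]
  omega

theorem exists_right {s t : SD la mu} (hst : s ≤ t) (h : (s.1.2 : ℕ) < t.1.2) :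
    ∃ r : SD la mu, r.1.1 = s.1.1 ∧ r.1.2 = s.1.2 + 1 ∧ s < r ∧ r ≤ t := by
  have h1 := SD_le_iff.1 hst
  have h2 := (mem_SD.1 s.2).1
  have hr : (s.1.1, s.1.2 + 1) ∈ SD la mu := by
    refine mem_SD_of_le s.2 t.2 ⟨le_rfl, (PNat.lt_add_right _ _).le⟩ ⟨?_, ?_⟩ ?_ <;>
      simp only [← PNat.coe_le_coe, PNat.add_coe, PNat.one_coe] <;> omega
  refine ⟨⟨_, hr⟩, rfl, rfl, ?_, ?_⟩
  · rw [SD_lt_iff]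
    simp only [PNat.add_coe, PNat.one_coe]
    omega
  · rw [SD_le_iff]
    simp only [PNat.add_coe, PNat.one_coe]
    omega

theorem exists_below {s t : SD la mu} (hst : s ≤ t) (h : (s.1.1 : ℕ) < t.1.1)
    (h' : (s.1.1 : ℕ) < s.1.2) :
    ∃ r : SD la mu, r.1.1 = s.1.1 + 1 ∧ r.1.2 = s.1.2 ∧ s < r ∧ r ≤ t := by
  have h1 := SD_le_iff.1 hst
  have hr : (s.1.1 + 1, s.1.2) ∈ SD la mu := by
    refine mem_SD_of_le s.2 t.2 ⟨(PNat.lt_add_right _ _).le, le_rfl⟩ ⟨?_, ?_⟩ ?_ <;>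
      simp only [← PNat.coe_le_coe, PNat.add_coe, PNat.one_coe] <;> omega
  refine ⟨⟨_, hr⟩, rfl, rfl, ?_, ?_⟩
  · rw [SD_lt_iff]
    simp only [PNat.add_coe, PNat.one_coe]
    omega
  · rw [SD_le_iff]
    simp only [PNat.add_coe, PNat.one_coe]
    omega

theorem SD_covBy {s t : SD la mu} (h : s ⋖ t) :
    (t.1.1 = s.1.1 ∧ t.1.2 = s.1.2 + 1) ∨ (t.1.1 = s.1.1 + 1 ∧ t.1.2 = s.1.2) := by
  have h1 := SD_lt_iff.1 h.lt
  have h2 := (mem_SD.1 t.2).1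
  have hcov : ∀ r, s < r → r ≤ t → r = t := fun r hr hrt =>
    hrt.eq_of_not_lt fun hlt => h.2 hr hlt
  by_cases h3 : (s.1.2 : ℕ) < t.1.2
  · obtain ⟨r, e1, e2, hr, hrt⟩ := exists_right h.le h3
    rw [hcov r hr hrt] at e1 e2
    exact Or.inl ⟨e1, e2⟩
  · obtain ⟨r, e1, e2, hr, hrt⟩ := exists_below h.le (by omega) (by omega)
    rw [hcov r hr hrt] at e1 e2
    exact Or.inr ⟨e1, e2⟩

/-- One step right raises the content by one and one step down lowers it by one. Such steps stay in
the diagram when moving towards a larger box, except downwards from the diagonal, whence the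
exclusion of content 0 in `exists_pred`. -/
theorem isContent_content : IsContent (content : SD la mu → ℕ) where
  covBy s t h := by
    have hs := content_add s
    have ht := content_add t
    rcases SD_covBy h with ⟨h1, h2⟩ | ⟨h1, h2⟩
    all_goals
      rw [h1, h2] at ht
      simp only [PNat.add_coe, PNat.one_coe] at ht
      omega
  lt_or_lt s t hne h := by
    have hs := content_add s
    have ht := content_add t
    have h1 : (s.1.1 : ℕ) ≠ t.1.1 := fun h1 => hne <| Subtype.ext <|
      Prod.ext (PNat.coe_injective h1)
      (PNat.coe_injective (by omega))
    rw [SD_lt_iff, SD_lt_iff]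
    omega
  lt_or_lt_succ s t h := by
    have hs := content_add s
    have ht := content_add t
    rw [SD_lt_iff, SD_lt_iff]
    omega
  exists_succ s t hst h := by
    have hs := content_add s
    have ht := content_add t
    have h1 := SD_lt_iff.1 hst
    obtain ⟨r, e1, e2, hr, hrt⟩ := exists_right hst.le (by omega)
    have hr' := content_add r
    rw [e1, e2, PNat.add_coe, PNat.one_coe] at hr'
    refine ⟨r, hr, lt_of_le_of_ne hrt ?_, by omega⟩
    rintro rfl
    omega
  exists_pred s t hst h h0 := by
    have hs := content_add s
    have ht := content_add t
    have h1 := SD_lt_iff.1 hst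
    obtain ⟨r, e1, e2, hr, hrt⟩ := exists_below hst.le (by omega) (by omega)
    have hr' := content_add r
    rw [e1, e2, PNat.add_coe, PNat.one_coe] at hr'
    refine ⟨r, hr, lt_of_le_of_ne hrt ?_, by omega⟩
    rintro rfl
    omega

/-- Covers are horizontal or vertical steps, along which θ and the content increase or decrease
together. The content is not injective, but only comparisons along covers matter. -/
theorem OmegaV_content {θ : SD la mu → ℤ} (hθ : IsTableauLabeling θ) (V : Set (SD la mu)) :
    OmegaV θ V = OmegaV (fun s => (content s : ℤ)) V := by
  have h : ∀ s t : SD la mu, s ⋖ t → ((θ s < θ t ↔ (content s : ℤ) < content t) ∧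
      (θ t < θ s ↔ (content t : ℤ) < content s)) := by
    intro s t hst
    have hs := content_add s
    have ht := content_add t
    rcases SD_covBy hst with ⟨h1, h2⟩ | ⟨h1, h2⟩
    · have h3 := hθ.row s t h1 h2
      rw [h1, h2, PNat.add_coe, PNat.one_coe] at ht
      omega
    · have h3 := hθ.col s t h1 h2
      rw [h1, h2, PNat.add_coe, PNat.one_coe] at ht
      omega
  refine OmegaV_eq_of_enriched_eq ?_
  ext σ
  refine and_congr_right fun _ => and_congr_left fun _ => forall₂_congr fun s t =>
    forall_congr' fun hst => and_congr_right fun _ => ?_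
  rw [(h s t hst).1, (h s t hst).2]

theorem GP_eq {θ : SD la mu → ℤ} (hθ : IsTableauLabeling θ) :
    GP θ = OmegaV (fun s : SD la mu => (content s : ℤ)) {s : SD la mu | content s = 0} := by
  rw [GP, OmegaV_content hθ]
  congr 1
  ext s
  have h := content_add s
  simp only [Set.mem_ofPred_eq, ← PNat.coe_inj]
  omega

theorem omega_GP {θ : SD la mu → ℤ} (hθ : IsTableauLabeling θ) :
    (omega (GP θ) : Series) = substGeom (GP θ) := by
  rw [GP_eq hθ]
  exact omega_eq_substGeom_OmegaV isContent_content.ne_of_covBy isContent_content.isValleySet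
    isContent_content.isReversal_zero

theorem omega_GQ {θ : SD la mu → ℤ} (hθ : IsTableauLabeling θ) :
    (omega (GQ θ) : Series) = substGeom (GQ θ) := by
  rw [GQ, Omega, OmegaV_content hθ]
  exact omega_eq_substGeom_OmegaV isContent_content.ne_of_covBy (isValleySet_empty _)
    isContent_content.isReversal_empty

end Diagram

end Multipeak

open Multipeak in
theorem mainTheorem9 :
    (∀ (n : ℕ) (α : Composition n) (hα : IsPeak α),
      ((omega (K α) : Series) = substGeom (K (flat α hα)) ∧
        (psi (K α) : Series) = substGeom (K α) ∧
        rho (K α) = K (flat α hα)) ∧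
      ((omega (KBar α) : Series) = substGeom (KBar (flat α hα)) ∧
        (psi (KBar α) : Series) = substGeom (KBar α) ∧
        rho (KBar α) = KBar (flat α hα))) ∧
    (∀ (P : Type*) [PartialOrder P] [Fintype P] (γ : P → ℤ), Function.Injective γ →
      (omega (Omega γ) : Series) = substGeom (Omega (fun s : Pᵒᵈ => γ (OrderDual.ofDual s))) ∧
      (psi (Omega γ) : Series) = substGeom (Omega γ) ∧
      rho (Omega γ) = Omega (fun s : Pᵒᵈ => γ (OrderDual.ofDual s))) ∧
    (∀ la mu : StrictPartition, mu.Contained la →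
      ∀ θ : SD la mu → ℤ, IsTableauLabeling θ →
        (omega (GP θ) : Series) = substGeom (GP θ) ∧
        (omega (GQ θ) : Series) = substGeom (GQ θ)) := by
  refine ⟨fun n α hα => hα.formulas, fun P _ _ γ hγ => Omega_formulas hγ,
    fun la mu _ θ hθ => ⟨omega_GP hθ, omega_GQ hθ⟩⟩
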